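/- Let $k$ be a field, $G=G^2_3=\langle a,b,c\mid a^2=b^2=c^2=1,\ bca=acb\rangle$, $\Lambda=kG$ and $\Lambda^e=\Lambda\otimes_k\Lambda^{op}$. Let $S=\{a^2-1,\,b^2-1,\,c^2-1,\,ba-cabc,\,bca-acb\}$ and let $V$ be the set of leading words of $S$ in the tower order with $a>b>c$ (words are compared by the number of letters $a$, then, writing $w=u_0au_1a\cdots au_m$, lexicographically from the left in $(u_0,\dots,u_m)$, where words in $b,c$ are compared in the same way with $b$ in place of $a$, and powers of $c$ by length), so $V=\{a^2,b^2,c^2,ba,bca\}$. A word is reduced if it has no subword in $V$. *Chains.* A word $w=x_1\cdots x_t$ is an $n$-prechain ($n\ge1$) if there are integers $1=a_1<a_2\le b_1<a_3\le b_2<\dots<a_n\le b_{n-1}<b_n=t$ (just $1=a_1$, $b_1=t$ for $n=1$) with $x_{a_j}\cdots x_{b_j}\in V$ for all $j$; it is an $n$-chain if these integers can be chosen so that for all $1\le m\le n$ and $s<b_m$ the word $x_1\cdots x_s$ is not an $m$-prechain. The $0$-chains are the letters, the only $(-1)$-chain is the empty word. $V^{(n)}$ is the set of $n$-chains. A tuple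 $[w_1|\cdots|w_l]$ is called a chain if $w_1\cdots w_{i+1}\in V^{(i)}$ for all $0\le i<l$. *Morse complex.* Let $B_n=\Lambda\otimes(\Lambda/k)^{\otimes n}\otimes\Lambda$ be the two-sided bar resolution, $[\lambda_1|\cdots|\lambda_n]=1\otimes\lambda_1\otimes\cdots\otimes\lambda_n\otimes1$, with the $\Lambda^e$-linear differential $$d[\lambda_1|\cdots|\lambda_n]=\lambda_1[\lambda_2|\cdots|\lambda_n]+\sum_{i=1}^{n-1}(-1)^i[\lambda_1|\cdots|\lambda_i\lambda_{i+1}|\cdots|\lambda_n]+(-1)^n[\lambda_1|\cdots|\lambda_{n-1}]\lambda_n .$$ Let $X_n$ be the set of all $[w_1|\cdots|w_n]$ with the $w_i$ nonempty reduced words. Let $[x:y]\in\Lambda^e$ be the coefficients in $d(x)=\sum_{y\in X_{n-1}}[x:y]\,y$, $x\in X_n$, and let $\Gamma$ be the directed graph on $\bigcup_n X_n$ with an edge $x\to y$ of weight $[x:y]$ whenever $[x:y]\ne0$. Let $M$ be the set of edges $[w_1|\cdots|w_{i+1}|u|v|w_{i+3}|\cdots|w_n]\to[w_1|\cdots|w_n]$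 where $[w_1|\cdots|w_{i+1}]$ ($i\ge-1$) is the longest initial part of $[w_1|\cdots|w_n]$ that is a chain, $w_{i+2}=uv$, and $[w_1|\cdots|w_{i+1}|u]$ is a chain. Replace each edge $x\to y$ in $M$ by the reversed edge $y\to x$ of weight $-[x:y]^{-1}$. The vertices on no edge of $M$ are called critical. Let $B^M_n$ be the free $\Lambda^e$-module on the critical vertices in $X_n$, and let the Anick differential $d_{n+1}:B^M_{n+1}\to B^M_n$ be $d_{n+1}(x)=\sum_y\Gamma(x,y)\,y$, where $\Gamma(x,y)$ is the sum, over all directed paths from $x$ to $y$ in the modified graph, of the products of the weights along the path. **Theorem.** $S$ is a Gröbner–Shirshov basis of $kG$: its relations hold in $\Lambda$ and every element of $G$ is represented by exactly one reduced word; and $X_m$ is a $\Lambda^e$-basis of $B_m$ for every $m\ge0$. Let $n\ge3$. Then $$V^{(n)}=\{a^{n+1},b^{n+1},c^{n+1}\}\cup\{b^ia^j,\ b^ica^j\mid i+j=n+1,\ i,j\ge1\}.$$ For $m\in\{n-1,n\}$ the critical vertices in $X_{m+1}$ are $[x^{m+1}]=[x|\cdots|x]$ for $x\in\{a,b,c\}$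 and $[b^ia^j]=[b|\cdots|b|a|\cdots|a]$, $[b^ica^j]=[b|\cdots|b|ca|a|\cdots|a]$ for $i+j=m+1$, $i,j\ge1$. There are only finitely many paths from a given critical vertex in $X_{n+1}$ to critical vertices in $X_n$, and the Anick differential is given as follows. $$d_{n+1}[x^{n+1}]=x[x^n]+(-1)^{n+1}[x^n]x\qquad(x\in\{a,b,c\}).$$ If $n+1$ is even: $$\begin{aligned} d_{n+1}[b^na]&=b[b^{n-1}a]+[b^n]a-[b^{n-1}ca]bc-ca[b^n]c-cab[c^n],\\ d_{n+1}[ba^n]&=b[a^n]+[ba^{n-1}]a-ca[bca^{n-1}]-c[a^n]bc-[c^n]abc,\\ d_{n+1}[b^nca]&=b[b^{n-1}ca]+[b^n]ca-[b^{n-1}a]cb-ac[b^n]-a[c^n]b,\\ d_{n+1}[bca^n]&=bc[a^n]+[bca^{n-1}]a-ac[ba^{n-1}]-[a^n]cb-a[c^n]b; \end{aligned}$$ for $i+j=n+1$ and even $j$ with $2\le j\le n-1$, $$\begin{aligned} d_{n+1}[b^ia^j]&=b[b^{i-1}a^j]+[b^ia^{j-1}]a+[b^{i-1}ca^j]cb+ac[b^ica^{j-1}],\\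 d_{n+1}[b^ica^j]&=b[b^{i-1}ca^j]+[b^ica^{j-1}]a+[b^{i-1}a^j]bc+ca[b^ia^{j-1}]+\tbinom{(n-3)/2}{(j-2)/2}cab[c^n]abc-\tbinom{(n-3)/2}{(i-2)/2}[c^n]; \end{aligned}$$ for $i+j=n+1$ and odd $j$ with $3\le j\le n-2$, $$\begin{aligned} d_{n+1}[b^ia^j]&=b[b^{i-1}a^j]+[b^ia^{j-1}]a-[b^{i-1}ca^j]bc-ca[b^ica^{j-1}]-\tbinom{(n-3)/2}{(i-3)/2}cab[c^n]-\tbinom{(n-3)/2}{(j-3)/2}[c^n]abc,\\ d_{n+1}[b^ica^j]&=b[b^{i-1}ca^j]+[b^ica^{j-1}]a-[b^{i-1}a^j]cb-ac[b^ia^{j-1}]-\Bigl\{\tbinom{(n-3)/2}{(i-3)/2}+\tbinom{(n-3)/2}{(j-3)/2}\Bigr\}a[c^n]b. \end{aligned}$$ If $n+1$ is odd: $$\begin{aligned} d_{n+1}[b^na]&=b[b^{n-1}a]-[b^n]a+[b^{n-1}ca]bc+ac[b^n]c+a[c^n],\\ d_{n+1}[ba^n]&=b[a^n]-[ba^{n-1}]a-ca[bca^{n-1}]-c[a^n]cb-[c^n]b,\\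 d_{n+1}[b^nca]&=b[b^{n-1}ca]-[b^n]ca+[b^{n-1}a]cb+ca[b^n]+cab[c^n]b,\\ d_{n+1}[bca^n]&=bc[a^n]-[bca^{n-1}]a-ac[ba^{n-1}]-[a^n]bc-a[c^n]abc; \end{aligned}$$ for $i+j=n+1$ and even $j$ with $2\le j\le n-2$, $$\begin{aligned} d_{n+1}[b^ia^j]&=b[b^{i-1}a^j]-[b^ia^{j-1}]a-[b^{i-1}ca^j]cb-ca[b^ica^{j-1}]-\tbinom{(n-2)/2}{(j-2)/2}[c^n]b,\\ d_{n+1}[b^ica^j]&=b[b^{i-1}ca^j]-[b^ica^{j-1}]a-[b^{i-1}a^j]bc-ac[b^ia^{j-1}]-\tbinom{(n-2)/2}{(j-2)/2}a[c^n]abc; \end{aligned}$$ for $i+j=n+1$ and odd $j$ with $3\le j\le n-1$, $$\begin{aligned} d_{n+1}[b^ia^j]&=b[b^{i-1}a^j]-[b^ia^{j-1}]a+[b^{i-1}ca^j]bc+ac[b^ica^{j-1}]+\tbinom{(n-2)/2}{(i-2)/2}a[c^n],\\ d_{n+1}[b^ica^j]&=b[b^{i-1}ca^j]-[b^ica^{j-1}]a+[b^{i-1}a^j]cb+ca[b^ia^{j-1}]+\tbinom{(n-2)/2}{(i-2)/2}cab[c^n]b.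 \end{aligned}$$ -/

import Mathlib

open scoped TensorProduct

noncomputable section

namespace Bar

variable (k : Type*) [Field k] (Λ : Type*) [Ring Λ] [Algebra k Λ]

/-- The enveloping algebra `Λ ⊗ Λᵒᵖ`. -/
abbrev Env : Type _ := Λ ⊗[k] Λᵐᵒᵖ

/-- `Λ / k`. -/
abbrev Red : Type _ := Λ ⧸ LinearMap.range (Algebra.linearMap k Λ)

/-- `B_n = Λ ⊗ (Λ/k)^{⊗ n} ⊗ Λ`, with the two outer factors collected into `Λ ⊗ Λᵒᵖ`, so that
`(x ⊗ y) ⊗ t` stands for `x ⊗ t ⊗ y`. -/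
abbrev B (n : ℕ) : Type _ := Env k Λ ⊗[k] (⨂[k] _ : Fin n, Red k Λ)

variable {k Λ}

/-- `x · [l₁ | ⋯ | lₙ] · y` -/
def symb {n : ℕ} (x y : Λ) (l : Fin n → Λ) : B k Λ n :=
  (x ⊗ₜ[k] MulOpposite.op y) ⊗ₜ[k]
    PiTensorProduct.tprod k (fun i => (Submodule.Quotient.mk (l i) : Red k Λ))

/-- Multiply the entries number `i - 1` and `i` of `l` (entries numbered from `0`);
for `i = 0` this drops the first entry, for `i = n + 1` the last one. -/
def merge {n : ℕ} (i : Fin (n + 2)) (l : Fin (n + 1) → Λ) (t : Fin n) : Λ :=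
  if t.val + 1 < i.val then l t.castSucc
  else if t.val + 1 = i.val then l t.castSucc * l t.succ
  else l t.succ

def face {n : ℕ} (i : Fin (n + 2)) (l : Fin (n + 1) → Λ) : B k Λ n :=
  symb (if i = 0 then l 0 else 1) (if i = Fin.last (n + 1) then l (Fin.last n) else 1) (merge i l)

theorem merge_update {n : ℕ} (i : Fin (n + 2)) (l : Fin (n + 1) → Λ) (j : Fin (n + 1))
    (h0 : ¬(i = 0 ∧ j = 0)) (h1 : ¬(i = Fin.last (n + 1) ∧ j = Fin.last n)) :
    ∃ (t : Fin n) (g : Λ →ₗ[k] Λ), ∀ x, merge i (Function.update l j x) =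
      Function.update (merge i l) t (g x) := by
  rcases lt_trichotomy j.val i.val with h | h | h
  · -- the entry `j` is to the left of, or is, the left factor
    have hn : j.val < n := by
      by_contra hc
      exact h1 ⟨Fin.ext (by simp only [Fin.val_last]; omega), Fin.ext (by simp only [Fin.val_last]; omega)⟩
    rcases Nat.lt_or_ge (j.val + 1) i.val with h' | h'
    · refine ⟨⟨j, hn⟩, LinearMap.id, fun x => ?_⟩
      funext t
      simp only [merge, Function.update_apply, Fin.ext_iff, Fin.val_castSucc, Fin.val_succ,
        LinearMap.id_apply]
      split_ifs <;> first | rfl | omega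
    · refine ⟨⟨j, hn⟩, LinearMap.mulRight k (l (Fin.succ ⟨j, hn⟩)), fun x => ?_⟩
      funext t
      simp only [merge, Function.update_apply, Fin.ext_iff, Fin.val_castSucc, Fin.val_succ,
        LinearMap.mulRight_apply]
      split_ifs <;> first | rfl | omega | skip
      have : t = ⟨j, hn⟩ := Fin.ext (by assumption)
      rw [this]
  · have hj : 0 < j.val := by
      by_contra hc
      exact h0 ⟨Fin.ext (by simp only [Fin.val_zero]; omega), Fin.ext (by simp only [Fin.val_zero]; omega)⟩
    have hn : j.val - 1 < n := by omega
    refine ⟨⟨j.val - 1, hn⟩, LinearMap.mulLeft k (l (Fin.castSucc ⟨j.val - 1, hn⟩)), fun x => ?_⟩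
    funext t
    simp only [merge, Function.update_apply, Fin.ext_iff, Fin.val_castSucc, Fin.val_succ,
        LinearMap.mulLeft_apply]
    split_ifs with h1 h2 h3 h4 <;> first | rfl | omega | skip
    have : t = ⟨j.val - 1, hn⟩ := Fin.ext (by simp; omega)
    rw [this]
  · have hn : j.val - 1 < n := by omega
    refine ⟨⟨j.val - 1, hn⟩, LinearMap.id, fun x => ?_⟩
    funext t
    simp only [merge, Function.update_apply, Fin.ext_iff, Fin.val_castSucc, Fin.val_succ,
        LinearMap.id_apply]
    split_ifs <;> first | rfl | omega


theorem face_update {n : ℕ} (i : Fin (n + 2)) (l : Fin (n + 1) → Λ) (j : Fin (n + 1)) :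
    ∃ G : Λ →ₗ[k] B k Λ n, ∀ x, face i (Function.update l j x) = G x := by
  by_cases h0 : i = 0 ∧ j = 0
  · obtain ⟨rfl, rfl⟩ := h0
    have hm : ∀ x, merge 0 (Function.update l 0 x) = merge 0 l := fun x => by
      funext t
      simp [merge]
    refine ⟨((TensorProduct.mk k (Env k Λ) _).flip (PiTensorProduct.tprod k
      (fun t => (Submodule.Quotient.mk (merge 0 l t) : Red k Λ)))).comp
      ((TensorProduct.mk k Λ Λᵐᵒᵖ).flip 1), fun x => ?_⟩
    have : (0 : Fin (n + 2)) ≠ Fin.last (n + 1) := by simp [Fin.ext_iff]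
    simp [face, hm, this, symb]
  by_cases h1 : i = Fin.last (n + 1) ∧ j = Fin.last n
  · obtain ⟨rfl, rfl⟩ := h1
    have hm : ∀ x, merge (Fin.last (n + 1)) (Function.update l (Fin.last n) x) =
        merge (Fin.last (n + 1)) l := fun x => by
      funext t
      have : t.castSucc ≠ Fin.last n := (Fin.castSucc_lt_last t).ne
      simp [merge, this]
    refine ⟨((TensorProduct.mk k (Env k Λ) _).flip (PiTensorProduct.tprod k
      (fun t => (Submodule.Quotient.mk (merge (Fin.last (n + 1)) l t) : Red k Λ)))).comp
      ((TensorProduct.mk k Λ Λᵐᵒᵖ 1).comp (MulOpposite.opLinearEquiv k).toLinearMap), fun x => ?_⟩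
    have : Fin.last (n + 1) ≠ 0 := by simp [Fin.ext_iff]
    simp [face, hm, this, symb]
  · obtain ⟨t, g, hg⟩ := merge_update (k := k) i l j h0 h1
    refine ⟨(TensorProduct.mk k (Env k Λ) _
      ((if i = 0 then l 0 else 1) ⊗ₜ MulOpposite.op
        (if i = Fin.last (n + 1) then l (Fin.last n) else 1))).comp
      (((PiTensorProduct.tprod k).toLinearMap
      (fun t => (Submodule.Quotient.mk (merge i l t) : Red k Λ)) t).comp
        ((Submodule.mkQ _).comp g)), fun x => ?_⟩
    have e0 : (if i = 0 then Function.update l j x 0 else 1) = if i = 0 then l 0 else 1 := by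
      split_ifs with h
      · exact Function.update_of_ne (fun h' => h0 ⟨h, h'.symm⟩) _ _
      · rfl
    have e1 : (if i = Fin.last (n + 1) then Function.update l j x (Fin.last n) else 1) =
        if i = Fin.last (n + 1) then l (Fin.last n) else 1 := by
      split_ifs with h
      · exact Function.update_of_ne (fun h' => h1 ⟨h, h'.symm⟩) _ _
      · rfl
    have e2 : (fun s => (Submodule.Quotient.mk (merge i (Function.update l j x) s) : Red k Λ)) =
        Function.update (fun s => (Submodule.Quotient.mk (merge i l s) : Red k Λ)) t
          (Submodule.Quotient.mk (g x)) := by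
      rw [hg]
      funext s
      by_cases hs : s = t
      · subst hs; simp
      · simp [hs]
    simp only [face, symb, e0, e1, e2]
    rfl

/-- The bar differential on lifts to `Λ`: the map
`(l₁, …, lₙ₊₁) ↦ l₁[l₂|⋯] + ∑ (-1)ⁱ [l₁|⋯|lᵢlᵢ₊₁|⋯] + (-1)ⁿ⁺¹ [l₁|⋯|lₙ]lₙ₊₁`. -/
def pre (n : ℕ) : MultilinearMap k (fun _ : Fin (n + 1) => Λ) (B k Λ n) where
  toFun l := ∑ i : Fin (n + 2), (-1 : k) ^ i.val • face i l
  map_update_add' := by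
    intro inst l j x y
    rw [Subsingleton.elim inst (instDecidableEqFin _), ← Finset.sum_add_distrib]
    refine Finset.sum_congr rfl fun i _ => ?_
    obtain ⟨G, hG⟩ := face_update (k := k) i l j
    rw [hG, hG, hG, map_add, smul_add]
  map_update_smul' := by
    intro inst l j c x
    rw [Subsingleton.elim inst (instDecidableEqFin _), Finset.smul_sum]
    refine Finset.sum_congr rfl fun i _ => ?_
    obtain ⟨G, hG⟩ := face_update (k := k) i l j
    rw [hG, hG, map_smul, smul_comm]

theorem symb_eq_zero {n : ℕ} (x y : Λ) (l : Fin n → Λ) (t : Fin n) (h : l t = 1) :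
    (symb x y l : B k Λ n) = 0 := by
  have : (PiTensorProduct.tprod k (fun i => (Submodule.Quotient.mk (l i) : Red k Λ))) = 0 := by
    apply MultilinearMap.map_coord_zero _ t
    rw [h, Submodule.Quotient.mk_eq_zero]
    exact ⟨1, by simp⟩
  rw [symb, this, TensorProduct.tmul_zero]

theorem pre_one {n : ℕ} (l : Fin (n + 1) → Λ) (j : Fin (n + 1)) (h : l j = 1) :
    pre (k := k) n l = 0 := by
  change ∑ i : Fin (n + 2), (-1 : k) ^ i.val • face i l = (0 : B k Λ n)
  have key : (face j.castSucc l : B k Λ n) = face j.succ l := by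
    unfold face
    congr 1
    · have : j.succ ≠ 0 := Fin.succ_ne_zero j
      simp only [this, if_false]
      split_ifs with h'
      · have : j = 0 := by simpa using h'
        rw [← this, h]
      · rfl
    · have : j.castSucc ≠ Fin.last (n + 1) := (Fin.castSucc_lt_last j).ne
      simp only [this, if_false]
      split_ifs with h'
      · have : j = Fin.last n := by simpa using h'
        rw [← this, h]
      · rfl
    · funext t
      simp only [merge, Fin.val_castSucc, Fin.val_succ]
      split_ifs <;> first | rfl | omega | skip
      · have : t.succ = j := Fin.ext (by simp; omega)
        rw [this, h, mul_one]
      · have : t.castSucc = j := Fin.ext (by simp; omega)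
        rw [this, h, one_mul]
  rw [Finset.sum_eq_add j.castSucc j.succ]
  · rw [key, ← add_smul]
    simp [pow_succ]
  · simp [Fin.ext_iff]
  · intro i _ hi
    have h1 : i.val ≠ j.val := fun e => hi.1 (Fin.ext e)
    have h2 : i.val ≠ j.val + 1 := fun e => hi.2 (Fin.ext e)
    have : (face i l : B k Λ n) = 0 := by
      rcases Nat.lt_or_gt_of_ne h1 with h' | h'
      · refine symb_eq_zero _ _ _ ⟨j.val - 1, by omega⟩ ?_
        have e : Fin.succ (⟨j.val - 1, by omega⟩ : Fin n) = j := Fin.ext (by simp; omega)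
        simp only [merge]
        rw [if_neg (by omega), if_neg (by omega), e, h]
      · refine symb_eq_zero _ _ _ ⟨j.val, by omega⟩ ?_
        have e : Fin.castSucc (⟨j.val, by omega⟩ : Fin n) = j := Fin.ext (by simp)
        simp only [merge]
        rw [if_pos (by omega), e, h]
    rw [this, smul_zero]
  · simp
  · simp

/-- Some linear section of `Λ → Λ / k`. -/
def sec : Red k Λ →ₗ[k] Λ :=
  Classical.choose ((LinearMap.range (Algebra.linearMap k Λ)).mkQ.exists_rightInverse_of_surjective
    (Submodule.range_mkQ _))

theorem sec_spec (x : Red k Λ) : Submodule.Quotient.mk (sec x) = x :=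
  LinearMap.congr_fun (Classical.choose_spec
    ((LinearMap.range (Algebra.linearMap k Λ)).mkQ.exists_rightInverse_of_surjective
      (Submodule.range_mkQ _))) x

/-- The differential `d_{n+1} : B_{n+1} → B_n` of the two-sided bar resolution; by `d_symb` below it
does not depend on the section. -/
def d (n : ℕ) : B k Λ (n + 1) →ₗ[Env k Λ] B k Λ n :=
  TensorProduct.AlgebraTensorModule.lift
    (LinearMap.toSpanSingleton (Env k Λ) _
      (PiTensorProduct.lift ((pre n).compLinearMap (fun _ => sec))))

theorem pre_congr {n : ℕ} (l m : Fin (n + 1) → Λ)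
    (h : ∀ j, (Submodule.Quotient.mk (l j) : Red k Λ) = Submodule.Quotient.mk (m j)) :
    pre (k := k) n l = pre n m := by
  have key : ∀ s : Finset (Fin (n + 1)), pre (k := k) n (s.piecewise l m) = pre n m := by
    intro s
    induction s using Finset.induction_on with
    | empty => simp
    | insert j s hj ih =>
      rw [Finset.piecewise_insert]
      obtain ⟨c, hc⟩ := (Submodule.Quotient.eq _).1 (h j)
      have e : l j = m j + c • (1 : Λ) := by
        rw [← Algebra.algebraMap_eq_smul_one]
        simp only [Algebra.linearMap_apply] at hc
        rw [hc]; abel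
      rw [e, MultilinearMap.map_update_add, MultilinearMap.map_update_smul,
        pre_one (k := k) (Function.update (s.piecewise l m) j 1) j (by simp), smul_zero, add_zero,
        ← ih]
      congr 1
      rw [show m j = s.piecewise l m j by simp [hj], Function.update_eq_self]
  simpa using key Finset.univ

theorem d_symb (n : ℕ) (l : Fin (n + 1) → Λ) :
    d n (symb (k := k) 1 1 l) = ∑ i : Fin (n + 2), (-1 : k) ^ i.val • face i l := by
  change _ = pre n l
  rw [d, symb, TensorProduct.AlgebraTensorModule.lift_tmul]
  rw [pre_congr l (fun j => sec (Submodule.Quotient.mk (l j) : Red k Λ)) (fun j => (sec_spec _).symm)]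
  change ((1 : Env k Λ) • PiTensorProduct.lift ((pre n).compLinearMap fun _ => sec)) _ = _
  rw [one_smul, PiTensorProduct.lift.tprod]
  rfl

end Bar

/-! ### Chains, cells, and the Morse complex of the bar resolution -/

namespace Morse

variable {A : Type*} (V : Set (List A))

/-- The integers `a_1, …, a_n`, `b_1, …, b_n` exhibit the word `w` of length `t` as an `n`-prechain:
`1 = a_1 < a_2 ≤ b_1 < a_3 ≤ b_2 < ⋯ < a_n ≤ b_{n-1} < b_n = t`, and the subword of `w` from
position `a_j` to position `b_j` (counted from `1`) is an obstruction for every `j`. -/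
structure PrechainData (n : ℕ) (w : List A) (a b : ℕ → ℕ) : Prop where
  a_one : a 1 = 1
  b_last : b n = w.length
  a_lt : ∀ j, 1 ≤ j → j + 1 ≤ n → a j < a (j + 1)
  a_le : ∀ j, 1 ≤ j → j + 1 ≤ n → a (j + 1) ≤ b j
  b_lt : ∀ j, 1 ≤ j → j + 2 ≤ n → b j < a (j + 2)
  b_lt_last : 2 ≤ n → b (n - 1) < b n
  mem : ∀ j, 1 ≤ j → j ≤ n → (w.drop (a j - 1)).take (b j + 1 - a j) ∈ V

/-- `n`-prechains, for `n ≥ 1`. -/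
def IsPrechain (n : ℕ) (w : List A) : Prop := ∃ a b, PrechainData V n w a b

/-- The set `V^(n)` of `n`-chains: the letters for `n = 0`; for `n ≥ 1` the `n`-prechains whose
integers can be chosen so that, for every `m`, no prefix of length less than `b_m` is an
`m`-prechain. -/
def chains : ℕ → Set (List A)
  | 0 => {w | ∃ x, w = [x]}
  | n + 1 => {w | ∃ a b, PrechainData V (n + 1) w a b ∧
      ∀ m, 1 ≤ m → m ≤ n + 1 → ∀ s, s < b m → ¬ IsPrechain V m (w.take s)}

/-- `w` contains no obstruction as a subword. -/
def IsReduced (w : List A) : Prop := ∀ v ∈ V, ¬ v <:+: w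

/-- The vertices `[w_1 | ⋯ | w_n]`, with all `w_i` reduced and nonempty. -/
def cells (n : ℕ) : Set (List (List A)) :=
  {x | x.length = n ∧ ∀ w ∈ x, w ≠ [] ∧ IsReduced V w}

/-- `[w_1 | ⋯ | w_l]` is a chain with its subdivision: `w_1 ⋯ w_{i+1} ∈ V^(i)` for all `i < l`.
The empty tuple (the only `(-1)`-chain) qualifies. -/
def IsChainTuple (x : List (List A)) : Prop :=
  ∀ i, i < x.length → (x.take (i + 1)).flatten ∈ chains V i

variable {k : Type*} [Field k] {Λ : Type*} [Ring Λ] [Algebra k Λ] (gen : A → Λ)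

/-- The value in `Λ` of a word in the generators. -/
def val (w : List A) : Λ := (w.map gen).prod

variable (k)

/-- The element `[w_1 | ⋯ | w_n]` of `B_n`, for a list of length `n`. -/
def cellSymb (n : ℕ) (x : List (List A)) : Bar.B k Λ n :=
  Bar.symb 1 1 (fun t : Fin n => val gen (x.getD t []))

/-- The vertices `[w_1 | ⋯ | w_n]` form a basis of the `Λ ⊗ Λᵒᵖ`-module `B_n`. -/
def CellsBasis (n : ℕ) : Prop :=
  LinearIndependent (Bar.Env k Λ) (fun x : cells V n => cellSymb k gen n x.1) ∧
    Submodule.span (Bar.Env k Λ) (Set.range fun x : cells V n => cellSymb k gen n x.1) = ⊤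

/-- Coordinates in the basis of vertices (meaningful when `CellsBasis` holds). -/
def coords (n : ℕ) (z : Bar.B k Λ n) : cells V n →₀ Bar.Env k Λ :=
  Function.invFun
    (Finsupp.linearCombination (Bar.Env k Λ) (fun x : cells V n => cellSymb k gen n x.1)) z

open Classical in
/-- The coefficient `[x : y]` of the vertex `y` in `d x`. -/
def inc (x y : List (List A)) : Bar.Env k Λ :=
  if h : x ∈ cells V (y.length + 1) ∧ y ∈ cells V y.length then
    coords V k gen y.length (Bar.d y.length (cellSymb k gen (y.length + 1) x)) ⟨y, h.2⟩
  else 0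

/-- The edge `x → y` belongs to the matching: `y = [w_1 | ⋯ | w_n]`, `p = [w_1 | ⋯ | w_{i+1}]` is
the longest initial part of `y` that is a chain, `w_{i+2} = u v`,
`x = [w_1 | ⋯ | w_{i+1} | u | v | w_{i+3} | ⋯ | w_n]`, and `[w_1 | ⋯ | w_{i+1} | u]` is a chain. -/
def Matched (x y : List (List A)) : Prop :=
  inc V k gen x y ≠ 0 ∧ ∃ p s u v, y = p ++ (u ++ v) :: s ∧ x = p ++ u :: v :: s ∧
    IsChainTuple V p ∧ (∀ q, q <+: y → IsChainTuple V q → q.length ≤ p.length) ∧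
    IsChainTuple V (p ++ [u])

/-- The edges of the graph in which the matched edges are reversed. -/
def Edge (x y : List (List A)) : Prop :=
  (inc V k gen x y ≠ 0 ∧ ¬ Matched V k gen x y) ∨ Matched V k gen y x

open Classical in
/-- The weight of an edge of that graph. -/
def weight (x y : List (List A)) : Bar.Env k Λ :=
  if Matched V k gen y x then - Ring.inverse (inc V k gen y x) else inc V k gen x y

/-- Directed paths from `x` to `y`, as lists of vertices. -/
def paths (x y : List (List A)) : Set (List (List (List A))) :=
  {p | p.head? = some x ∧ p.getLast? = some y ∧ p.IsChain (Edge V k gen)}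

/-- The product of the weights along a path, in the order of the path. -/
def pathWeight (p : List (List (List A))) : Bar.Env k Λ :=
  (List.zipWith (weight V k gen) p p.tail).prod

/-- The sum `Γ(x, y)` of the weights of all paths from `x` to `y`. -/
def pathSum (x y : List (List A)) : Bar.Env k Λ :=
  ∑ᶠ p : paths V k gen x y, pathWeight V k gen p.1

/-- The critical vertices of degree `n`: those on no matched edge. -/
def critical (n : ℕ) : Set (List (List A)) :=
  {x | x ∈ cells V n ∧ ∀ y, ¬ Matched V k gen x y ∧ ¬ Matched V k gen y x}

/-- There are only finitely many paths from `x` to critical vertices of degree `n`. -/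
def FinitePaths (n : ℕ) (x : List (List A)) : Prop :=
  {p : List (List (List A)) | ∃ y ∈ critical V k gen n, p ∈ paths V k gen x y}.Finite

/-- The `n`-th module of the Morse complex: free over `Λ ⊗ Λᵒᵖ` on the critical vertices. -/
abbrev C (n : ℕ) : Type _ := critical V k gen n →₀ Bar.Env k Λ

/-- The Morse differential `x ↦ ∑ Γ(x, y) y` from degree `n + 1` to degree `n`. -/
def diff (n : ℕ) : C V k gen (n + 1) →ₗ[Bar.Env k Λ] C V k gen n :=
  Finsupp.linearCombination (Bar.Env k Λ) fun x : critical V k gen (n + 1) =>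
    ∑ᶠ y : critical V k gen n, Finsupp.single y (pathSum V k gen x.1 y.1)

open Classical in
/-- The basis element of `C n` given by a critical vertex. -/
def basisElt (n : ℕ) (x : List (List A)) : C V k gen n :=
  if h : x ∈ critical V k gen n then Finsupp.single ⟨x, h⟩ 1 else 0

end Morse

/-! ### The group `G^2_3` -/

namespace G23

inductive Letter
  | a
  | b
  | c
  deriving DecidableEq

abbrev Word := List Letter

open Letter

/-- The defining relators of `⟨a, b, c | a² = b² = c² = 1, bca = acb⟩`. -/
def rels : Set (FreeGroup Letter) :=
  {FreeGroup.of a ^ 2, FreeGroup.of b ^ 2, FreeGroup.of c ^ 2,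
    FreeGroup.of b * FreeGroup.of c * FreeGroup.of a *
      (FreeGroup.of a * FreeGroup.of c * FreeGroup.of b)⁻¹}

/-- The group `G^2_3`. -/
abbrev Grp : Type := PresentedGroup rels

/-- One step of the tower order: words `u_0 x u_1 x ⋯ x u_m` are compared first by the number of
occurrences of `x` and then lexicographically from left to right in `(u_0, …, u_m)`, where the
`u_i` are compared by `r`. -/
def towerStep (x : Letter) (r : Word → Word → Prop) (u v : Word) : Prop :=
  u.count x < v.count x ∨
    (u.count x = v.count x ∧ List.Lex r (u.splitOn x) (v.splitOn x))

/-- The (strict) tower order on words, with `a > b > c`. -/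
def towerLT : Word → Word → Prop :=
  towerStep a (towerStep b fun u v => u.length < v.length)

/-- The Gröbner–Shirshov basis `{a² - 1, b² - 1, c² - 1, ba - cabc, bca - acb}`; the pair `(u, v)`
stands for `u - v`. -/
def S : Set (Word × Word) :=
  {([a, a], []), ([b, b], []), ([c, c], []), ([b, a], [c, a, b, c]), ([b, c, a], [a, c, b])}

/-- The obstructions: the leading words of the elements of `S` in the tower order. -/
def V : Set Word := {u | ∃ v, ((u, v) ∈ S ∨ (v, u) ∈ S) ∧ towerLT v u}

/-- The value in `G^2_3` of a word. -/
def grpVal (w : Word) : Grp := (w.map PresentedGroup.of).prod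

variable (k : Type*) [Field k]

/-- The group algebra `k G^2_3`. -/
abbrev Alg : Type _ := MonoidAlgebra k Grp

/-- The generators of the group algebra. -/
def gen (x : Letter) : Alg k := MonoidAlgebra.of k Grp (PresentedGroup.of x)

/-- Critical vertices of degree `n` for `k G^2_3`. -/
abbrev critical (n : ℕ) : Set (List Word) := Morse.critical V k (gen k) n

/-- The `n`-th module of the Anick resolution of `k G^2_3`. -/
abbrev C (n : ℕ) : Type _ := Morse.C V k (gen k) n

/-- The Anick differential `d_{n+1}` of `k G^2_3`, from degree `n + 1` to degree `n`. -/
abbrev d (n : ℕ) : C k (n + 1) →ₗ[Bar.Env k (Alg k)] C k n := Morse.diff V k (gen k) n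

/-- `[x^n] = [x | ⋯ | x]` -/
def pw (x : Letter) (n : ℕ) : List Word := List.replicate n [x]

/-- `[b^i a^j] = [b | ⋯ | b | a | ⋯ | a]` -/
def ba (i j : ℕ) : List Word := List.replicate i [b] ++ List.replicate j [a]

/-- `[b^i c a^j] = [b | ⋯ | b | ca | a | ⋯ | a]`, for `j ≥ 1` -/
def bca (i j : ℕ) : List Word := List.replicate i [b] ++ [c, a] :: List.replicate (j - 1) [a]

/-- The element `u [x] v` of `C n`, for words `u`, `v` and a critical vertex `x` of degree `n`. -/
def tm (n : ℕ) (u : Word) (x : List Word) (v : Word) : C k n :=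
  (Morse.val (gen k) u ⊗ₜ[k] MulOpposite.op (Morse.val (gen k) v) : Bar.Env k (Alg k)) •
    Morse.basisElt V k (gen k) n x

end G23

end

open G23 G23.Letter

/-! The group is an extension of ℤ/2 by ℤ²: the relation `bca = acb` says that `ac` and `bc`
commute, and conjugation by `c` inverts both. So every element is `(ac)^X (bc)^Y c^ε` for exactly
one triple `(X, Y, ε)`. A word avoiding the obstructions is an alternating word in `a, c` followed
by an alternating word in `b, c`, and it can be recovered from its triple (`canon_ac`). This gives
the uniqueness of reduced words, the bases of the bar modules, and a computable normal form `nf`.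

Chain tuples are the tuples accepted by a small automaton (`step`, `run`): after `a` comes `a`;
after `b` comes `a`, `b` or `ca`; after `c` comes `c`. Admissible entries are prefix-free. Hence a
vertex either is accepted, or its first inadmissible entry has an admissible proper prefix (it is
the lower end of a matched edge), or that entry has no admissible prefix, is "dead" (it is the upper
end). This trichotomy identifies the critical vertices (`mem_critical_iff`).

A path from degree `n + 1` to a critical vertex of degree `n` stays in these two degrees: below them
it is lost (`Low`). The predicate `Ev` records finiteness of the set of paths together with the sum
of their weights, and `ev_up` computes it recursively: from `[p | uv | s]` one ascends to `[p | u |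
v | s]`, and then either contracts inside `[p | u]` or multiplies `v` into `s`; all other faces keep
the dead entry `v` and vanish.

Starting from `[b^i a^j]` or `[b^i c a^j]`, the only inner products that matter are `b·a = cabc` and
`b·ca = acb`. The words `cabc = ca·bc` and `acb = a·cb` are split before the rotation `bc` or `cb`;
the rotation is pushed to the right through letters by `bc·a = a·cb` and `cb·a = a·bc`, and at each
position it may be left behind while the next `b` is contracted. So one contraction lowers `i` by
one, exchanges the two families `fh true` and `fh false`, and inserts one rotation into the tail,
with alternating signs (`ev_fh`). At `i = 0` the start of the tuple is reached, and the contribution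
splits into tuples starting with powers of `c`, `a` and `b` (`cv`, `av`, `bev`).

The result depends on a tail only through the number `q` of letters before the first rotation and
through what follows that rotation. Summing over the insertion positions is a hockey-stick summation
over indices of one parity, which produces the binomial coefficients (`fhTrue_fhFalse`). One more
summation, for the tail without rotations, gives the differential; the listed formulas are its cases
by parity. -/

namespace G23
open Letter

/-! ### Obstructions and reduced words -/

theorem V_eq : V = {[a, a], [b, b], [c, c], [b, a], [b, c, a]} := by
  have h1 : towerLT [] [a, a] := Or.inl (by decide)
  have h2 : towerLT [] [b, b] :=
    Or.inr ⟨by decide, List.Lex.rel (Or.inl (by decide))⟩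
  have h3 : towerLT [] [c, c] :=
    Or.inr ⟨by decide, List.Lex.rel (Or.inr ⟨by decide, List.Lex.rel (by decide)⟩)⟩
  have h4 : towerLT [c, a, b, c] [b, a] :=
    Or.inr ⟨by decide, List.Lex.rel (Or.inl (by decide))⟩
  have h5 : towerLT [a, c, b] [b, c, a] :=
    Or.inr ⟨by decide, List.Lex.rel (Or.inl (by decide))⟩
  -- If the first blocks differ, they alone decide the lexicographic comparison.
  have lex {r : Word → Word → Prop} {u v : Word} {s t : List Word} (huv : u ≠ v)
      (h : List.Lex r (u :: s) (v :: t)) : r u v := by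
    cases h with
    | rel h => exact h
    | cons h => exact absurd rfl huv
  -- `V` admits both orientations of each relation, so the reverse comparisons have to be refuted as
  -- well.
  have n1 : ¬ towerLT [a, a] [] := by
    rintro (h | ⟨h, -⟩) <;> revert h <;> decide
  have n2 : ¬ towerLT [b, b] [] := by
    rintro (h | ⟨-, h⟩)
    · revert h; decide
    · rcases lex (u := [b, b]) (v := []) (by decide) h with h | ⟨h, -⟩ <;> revert h <;> decide
  have n3 : ¬ towerLT [c, c] [] := by
    rintro (h | ⟨-, h⟩)
    · revert h; decide
    · rcases lex (u := [c, c]) (v := []) (by decide) h with h | ⟨-, h⟩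
      · revert h; decide
      · have := lex (u := [c, c]) (v := []) (by decide) h
        revert this; decide
  have n4 : ¬ towerLT [b, a] [c, a, b, c] := by
    rintro (h | ⟨-, h⟩)
    · revert h; decide
    · rcases lex (u := [b]) (v := [c]) (by decide) h with h | ⟨h, -⟩ <;> revert h <;> decide
  have n5 : ¬ towerLT [b, c, a] [a, c, b] := by
    rintro (h | ⟨-, h⟩)
    · revert h; decide
    · rcases lex (u := [b, c]) (v := []) (by decide) h with h | ⟨h, -⟩ <;> revert h <;> decide
  ext u
  simp only [V, S, Set.mem_ofPred_eq, Set.mem_insert_iff, Set.mem_singleton_iff, Prod.mk.injEq]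
  constructor
  · rintro ⟨v, (h | h), hv⟩
    · rcases h with ⟨rfl, -⟩ | ⟨rfl, -⟩ | ⟨rfl, -⟩ | ⟨rfl, -⟩ | ⟨rfl, -⟩ <;> simp
    · rcases h with ⟨rfl, rfl⟩ | ⟨rfl, rfl⟩ | ⟨rfl, rfl⟩ | ⟨rfl, rfl⟩ | ⟨rfl, rfl⟩ <;> contradiction
  · rintro (rfl | rfl | rfl | rfl | rfl)
    · exact ⟨[], by simp, h1⟩
    · exact ⟨[], by simp, h2⟩
    · exact ⟨[], by simp, h3⟩
    · exact ⟨[c, a, b, c], by simp, h4⟩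
    · exact ⟨[a, c, b], by simp, h5⟩

/-- No obstruction is a prefix of `x :: w`. -/
def headOK : Letter → Word → Bool
  | a, a :: _ => false
  | b, b :: _ => false
  | b, a :: _ => false
  | b, c :: a :: _ => false
  | c, c :: _ => false
  | _, _ => true

/-- Decides whether a word is reduced. -/
def redB : Word → Bool
  | [] => true
  | x :: w => headOK x w && redB w

theorem isReduced_nil : Morse.IsReduced V [] := by
  intro v hv h
  rw [V_eq] at hv
  have := List.eq_nil_of_infix_nil h
  subst this
  simp at hv

theorem headOK_iff (x : Letter) (w : Word) : headOK x w = true ↔ ∀ v ∈ V, ¬ v <+: x :: w := by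
  rw [V_eq]
  rcases x with _ | _ | _ <;> rcases w with _ | ⟨(_ | _ | _), _ | ⟨(_ | _ | _), w⟩⟩ <;>
    simp [headOK, List.cons_prefix_cons]

theorem isReduced_iff (w : Word) : Morse.IsReduced V w ↔ redB w = true := by
  induction w with
  | nil => simp [redB, isReduced_nil]
  | cons x w ih =>
    rw [redB, Bool.and_eq_true, ← ih, headOK_iff]
    simp only [Morse.IsReduced, List.infix_cons_iff]
    constructor
    · intro h
      exact ⟨fun v hv h' => h v hv (Or.inl h'), fun v hv h' => h v hv (Or.inr h')⟩
    · rintro ⟨h1, h2⟩ v hv (h | h)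
      · exact h1 v hv h
      · exact h2 v hv h

/-! ### Normal forms -/

/-- Coordinates of `(ac)^X (bc)^Y c^ε`. -/
abbrev Coord := ℤ × ℤ × Bool

/-- Left multiplication by a letter, in coordinates. -/
def act : Letter → Coord → Coord
  | a, t => (1 - t.1, -t.2.1, !t.2.2)
  | b, t => (-t.1, 1 - t.2.1, !t.2.2)
  | c, t => (-t.1, -t.2.1, !t.2.2)

theorem act_act (x : Letter) (t : Coord) : act x (act x t) = t := by
  rcases x with _ | _ | _ <;> simp [act]

/-- The coordinates of a word. -/
def coord : Word → Coord
  | [] => (0, 0, false)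
  | x :: w => act x (coord w)

def actPerm (x : Letter) : Equiv.Perm Coord := (show Function.Involutive (act x) from act_act x).toPerm

/-- This makes the group act on triples. Following the origin under the action is what separates
group elements. -/
theorem actPerm_rels : ∀ r ∈ rels, FreeGroup.lift actPerm r = 1 := by
  have hsq (x : Letter) : actPerm x ^ 2 = 1 := by
    ext1 t
    simp [actPerm, pow_two, act_act]
  have hinv (x : Letter) : (actPerm x)⁻¹ = actPerm x := by
    rw [inv_eq_iff_mul_eq_one, ← pow_two, hsq]
  intro r hr
  rcases hr with rfl | rfl | rfl | rfl
  · simp [hsq]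
  · simp [hsq]
  · simp [hsq]
  · simp only [map_mul, map_inv, FreeGroup.lift_apply_of, mul_inv_rev, hinv]
    ext1 t
    simp [actPerm, act]

/-- The action of the group on coordinates. -/
def actHom : Grp →* Equiv.Perm Coord := PresentedGroup.toGroup actPerm_rels

theorem actHom_grpVal (w : Word) : actHom (grpVal w) (0, 0, false) = coord w := by
  induction w with
  | nil => simp [grpVal, coord]
  | cons x w ih =>
    have : grpVal (x :: w) = PresentedGroup.of x * grpVal w := by simp [grpVal]
    rw [this, map_mul, Equiv.Perm.mul_apply, ih, coord, actHom, PresentedGroup.toGroup.of]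
    rfl

theorem grpVal_append (u v : Word) : grpVal (u ++ v) = grpVal u * grpVal v := by simp [grpVal]

theorem grpVal_cons (x : Letter) (v : Word) : grpVal (x :: v) = PresentedGroup.of x * grpVal v := by
  simp [grpVal]

theorem grpVal_nil : grpVal [] = 1 := rfl

theorem of_sq (x : Letter) : (PresentedGroup.of x : Grp) * PresentedGroup.of x = 1 := by
  have : (FreeGroup.of x) ^ 2 ∈ rels := by rcases x with _ | _ | _ <;> simp [rels]
  have := PresentedGroup.one_of_mem this
  rw [map_pow, pow_two] at this
  exact this

theorem of_bca : (PresentedGroup.of b : Grp) * PresentedGroup.of c * PresentedGroup.of a =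
    PresentedGroup.of a * PresentedGroup.of c * PresentedGroup.of b := by
  have : FreeGroup.of b * FreeGroup.of c * FreeGroup.of a *
      (FreeGroup.of a * FreeGroup.of c * FreeGroup.of b)⁻¹ ∈ rels := by simp [rels]
  have := PresentedGroup.one_of_mem this
  rw [map_mul, map_inv, mul_inv_eq_one, map_mul, map_mul, map_mul, map_mul] at this
  exact this

/-- `(ac)^X (bc)^Y c^ε`. -/
def ofCoord (t : Coord) : Grp :=
  (PresentedGroup.of a * PresentedGroup.of c) ^ t.1 *
    (PresentedGroup.of b * PresentedGroup.of c) ^ t.2.1 *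
      (if t.2.2 then PresentedGroup.of c else 1)

/-- Moving `c` to the right inverts the powers of `ac` and `bc`, which gives the rule for `c`. The
other two follow from `a = (ac)c` and `b = (bc)c`; for `b` the factor `bc` has to pass `(ac)^(-X)`,
which is where commutativity is used. -/
theorem of_mul_ofCoord (x : Letter) (t : Coord) :
    PresentedGroup.of x * ofCoord t = ofCoord (act x t) := by
  obtain ⟨X, Y, e⟩ := t
  have hc := of_sq c
  have ha := of_sq a
  have hb := of_sq b
  set A : Grp := PresentedGroup.of a
  set B : Grp := PresentedGroup.of b
  set C : Grp := PresentedGroup.of c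
  have hcc (g : Grp) : C * (C * g) = g := by rw [← mul_assoc, hc, one_mul]
  have hr : (A * C)⁻¹ = C * A := by
    rw [inv_eq_iff_mul_eq_one, mul_assoc, hcc, ha]
  have hs : (B * C)⁻¹ = C * B := by
    rw [inv_eq_iff_mul_eq_one, mul_assoc, hcc, hb]
  have c1 : SemiconjBy C (A * C) (A * C)⁻¹ := by
    rw [SemiconjBy, hr]; simp only [mul_assoc]
  have c2 : SemiconjBy C (B * C) (B * C)⁻¹ := by
    rw [SemiconjBy, hs]; simp only [mul_assoc]
  have hcomm : Commute (A * C) (B * C) := by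
    rw [Commute, SemiconjBy]
    have h : B * C * A = A * C * B := of_bca
    calc A * C * (B * C) = A * C * B * C := by simp only [mul_assoc]
      _ = B * C * A * C := by rw [h]
      _ = _ := by simp only [mul_assoc]
  have c1' : C * (A * C) ^ X = (A * C) ^ (-X) * C := by
    have := c1.zpow_right X
    rwa [inv_zpow', SemiconjBy] at this
  have c2' : C * (B * C) ^ Y = (B * C) ^ (-Y) * C := by
    have := c2.zpow_right Y
    rwa [inv_zpow', SemiconjBy] at this
  have hC : C * ofCoord (X, Y, e) = ofCoord (-X, -Y, !e) := by
    change C * ((A * C) ^ X * (B * C) ^ Y * (if e then C else 1)) =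
      (A * C) ^ (-X) * (B * C) ^ (-Y) * (if !e then C else 1)
    rw [← mul_assoc, ← mul_assoc, c1', mul_assoc _ C, c2', ← mul_assoc, mul_assoc _ C]
    cases e <;> simp [hc]
  rcases x with _ | _ | _
  · have : A = A * C * C := by rw [mul_assoc, hc, mul_one]
    change A * _ = _
    rw [this, mul_assoc, hC]
    simp only [ofCoord, act, sub_eq_add_neg, zpow_add, zpow_one, mul_assoc]
    rfl
  · have : B = B * C * C := by rw [mul_assoc, hc, mul_one]
    change B * _ = _
    rw [this, mul_assoc, hC]
    have := (hcomm.zpow_left (-X)).eq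
    simp only [ofCoord, act, sub_eq_add_neg, zpow_add, zpow_one]
    change (B * C) * ((A * C) ^ (-X) * (B * C) ^ (-Y) * _) = (A * C) ^ (-X) * ((B * C) * (B * C) ^ (-Y)) * _
    rw [← mul_assoc, ← mul_assoc, ← this]
    simp only [mul_assoc]
  · exact hC

theorem ofCoord_coord (w : Word) : ofCoord (coord w) = grpVal w := by
  induction w with
  | nil => simp [ofCoord, coord, grpVal]
  | cons x w ih => rw [coord, ← of_mul_ofCoord, ih, grpVal_cons]

/-- The orbit of the origin gives the triple of an element, and `ofCoord` gives the element of a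
triple. Equality in the group thus becomes a comparison of triples, and concrete identities can be
settled by `decide`. -/
theorem grpVal_eq_iff (u v : Word) : grpVal u = grpVal v ↔ coord u = coord v :=
  ⟨fun h => by rw [← actHom_grpVal, h, actHom_grpVal],
    fun h => by rw [← ofCoord_coord, h, ofCoord_coord]⟩

/-- The alternating word of length `n` starting with `x`. -/
def alt (x y : Letter) : ℕ → Word
  | 0 => []
  | n + 1 => x :: alt y x n

/-- The reduced word of `(ac)^X c^e`. -/
def acWord (X : ℤ) (e : Bool) : Word :=
  if 0 < X then alt a c (2 * X - cond e 1 0).toNat else alt c a (-2 * X + cond e 1 0).toNat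

/-- The reduced word with given coordinates. -/
def canon (t : Coord) : Word :=
  if 0 < t.2.1 then acWord t.1 false ++ alt b c (2 * t.2.1 - cond t.2.2 1 0).toNat
  else if t.2.1 < 0 then acWord t.1 true ++ alt b c (-2 * t.2.1 - cond t.2.2 0 1).toNat
  else acWord t.1 t.2.2

/-- The reduced word representing the same group element. -/
def nf (w : Word) : Word := canon (coord w)

theorem redB_alt_bc (n : ℕ) : redB (alt b c n) = true ∧ redB (alt c b n) = true := by
  induction n with
  | zero => exact ⟨rfl, rfl⟩
  | succ n ih =>
    rw [alt, alt, redB, redB, ih.1, ih.2]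
    rcases n with _ | _ | n <;> exact ⟨rfl, rfl⟩

theorem redB_alt_ac (n m : ℕ) :
    redB (alt a c n ++ alt b c m) = true ∧ redB (alt c a n ++ alt b c m) = true := by
  induction n with
  | zero => exact ⟨(redB_alt_bc m).1, (redB_alt_bc m).1⟩
  | succ n ih =>
    rw [alt, alt, List.cons_append, List.cons_append, redB, redB, ih.1, ih.2]
    rcases n with _ | _ | n <;> rcases m with _ | _ | m <;> exact ⟨rfl, rfl⟩

theorem redB_canon (t : Coord) : redB (canon t) = true := by
  have h (X : ℤ) (e : Bool) (m : ℕ) : redB (acWord X e ++ alt b c m) = true := by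
    unfold acWord
    split_ifs
    · exact (redB_alt_ac _ m).1
    · exact (redB_alt_ac _ m).2
  unfold canon
  split_ifs
  · exact h _ _ _
  · exact h _ _ _
  · simpa [alt] using h t.1 t.2.2 0

theorem coord_alt_bc (n : ℕ) :
    coord (alt b c (2 * n)) = ((0, n, false) : Coord) ∧
    coord (alt b c (2 * n + 1)) = ((0, n + 1, true) : Coord) := by
  induction n with
  | zero => exact ⟨rfl, rfl⟩
  | succ n ih =>
    have e1 : 2 * (n + 1) = 2 * n + 2 := by ring
    rw [e1]
    simp only [alt, coord] at ih ⊢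
    rw [ih.1, ih.2]
    constructor
    · simp [act, add_comm]
    · simp [act]; ring

/-- The product of an `ac`-word with the element with given coordinates. -/
theorem coord_alt_ac_append (n : ℕ) (w : Word) :
    coord (alt a c (2 * n) ++ w) = ((coord w).1 + n, (coord w).2.1, (coord w).2.2) ∧
    coord (alt a c (2 * n + 1) ++ w) = (n + 1 - (coord w).1, -(coord w).2.1, !(coord w).2.2) ∧
    coord (alt c a (2 * n) ++ w) = ((coord w).1 - n, (coord w).2.1, (coord w).2.2) ∧
    coord (alt c a (2 * n + 1) ++ w) = (-n - (coord w).1, -(coord w).2.1, !(coord w).2.2) := by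
  induction n with
  | zero => simp [alt, coord, act]
  | succ n ih =>
    have e1 : 2 * (n + 1) = 2 * n + 2 := by ring
    rw [e1]
    simp only [alt, coord, List.cons_append]
    rw [ih.1, ih.2.2.1]
    refine ⟨?_, ?_, ?_, ?_⟩ <;> (simp [act]; ring)

/-- This and the lemmas up to `canon_neg_natCast_add_one` are the cases by sign and parity, free of
`toNat`. -/
theorem acWord_natCast (n : ℕ) : acWord n false = alt a c (2 * n) := by
  unfold acWord
  rcases Nat.eq_zero_or_pos n with rfl | h
  · rfl
  · rw [if_pos (by omega)]
    congr 1

theorem acWord_natCast_add_one (n : ℕ) : acWord (n + 1) true = alt a c (2 * n + 1) := by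
  unfold acWord
  rw [if_pos (by omega)]
  congr 1
  simp only [cond]; omega

theorem acWord_neg_natCast (n : ℕ) : acWord (-n) false = alt c a (2 * n) := by
  unfold acWord
  rw [if_neg (by omega)]
  congr 1
  simp only [cond]; omega

theorem acWord_neg_natCast_true (n : ℕ) : acWord (-n) true = alt c a (2 * n + 1) := by
  unfold acWord
  rw [if_neg (by omega)]
  congr 1
  simp only [cond]; omega

theorem canon_natCast (X : ℤ) (n : ℕ) :
    canon (X, n, false) = acWord X false ++ alt b c (2 * n) := by
  unfold canon
  dsimp only
  rcases Nat.eq_zero_or_pos n with rfl | h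
  · simp [alt]
  · rw [if_pos (by omega)]
    congr 2

theorem canon_natCast_add_one (X : ℤ) (n : ℕ) :
    canon (X, n + 1, true) = acWord X false ++ alt b c (2 * n + 1) := by
  unfold canon
  dsimp only
  rw [if_pos (by omega)]
  congr 2
  simp only [cond]; omega

/-- For negative `Y` one uses `(bc)^(-m) = c (bc)^m c`: the first `c` joins the `ac`-part, hence the
flag `true` there, and the last `c` shifts the parity of the `bc`-part. -/
theorem canon_neg_natCast (X : ℤ) (n : ℕ) :
    canon (X, -n, true) = acWord X true ++ alt b c (2 * n) := by
  unfold canon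
  dsimp only
  rcases Nat.eq_zero_or_pos n with rfl | h
  · simp [alt]
  · rw [if_neg (by omega), if_pos (by omega)]
    congr 2
    simp only [cond]; omega

theorem canon_neg_natCast_add_one (X : ℤ) (n : ℕ) :
    canon (X, -(n + 1), false) = acWord X true ++ alt b c (2 * n + 1) := by
  unfold canon
  dsimp only
  rw [if_neg (by omega), if_pos (by omega)]
  congr 2
  simp only [cond]; omega

theorem coord_acWord_append (X : ℤ) (w : Word) (hw : (coord w).1 = 0) :
    coord (acWord X false ++ w) = (X, (coord w).2.1, (coord w).2.2) ∧
    coord (acWord X true ++ w) = (X, -(coord w).2.1, !(coord w).2.2) := by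
  constructor
  · rcases le_total 0 X with h | h
    · obtain ⟨n, rfl⟩ := Int.eq_ofNat_of_zero_le h
      rw [acWord_natCast, (coord_alt_ac_append n w).1, hw, zero_add]
    · obtain ⟨n, rfl⟩ := Int.exists_eq_neg_ofNat h
      rw [acWord_neg_natCast, (coord_alt_ac_append n w).2.2.1, hw, zero_sub]
  · rcases lt_or_ge 0 X with h | h
    · obtain ⟨n, hn⟩ := Int.eq_ofNat_of_zero_le (show 0 ≤ X - 1 by omega)
      obtain rfl : X = n + 1 := by omega
      rw [acWord_natCast_add_one, (coord_alt_ac_append n w).2.1, hw, sub_zero]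
    · obtain ⟨n, rfl⟩ := Int.exists_eq_neg_ofNat h
      rw [acWord_neg_natCast_true, (coord_alt_ac_append n w).2.2.2, hw, sub_zero]

theorem coord_canon (t : Coord) : coord (canon t) = t := by
  obtain ⟨X, Y, e⟩ := t
  cases e
  · rcases le_or_gt 0 Y with h | h
    · obtain ⟨n, rfl⟩ := Int.eq_ofNat_of_zero_le h
      rw [canon_natCast, (coord_acWord_append _ _ (by rw [(coord_alt_bc n).1])).1,
        (coord_alt_bc n).1]
    · obtain ⟨n, hn⟩ := Int.eq_ofNat_of_zero_le (show 0 ≤ -Y - 1 by omega)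
      obtain rfl : Y = -(n + 1) := by omega
      rw [canon_neg_natCast_add_one, (coord_acWord_append _ _ (by rw [(coord_alt_bc n).2])).2,
        (coord_alt_bc n).2]
      rfl
  · rcases lt_or_ge 0 Y with h | h
    · obtain ⟨n, hn⟩ := Int.eq_ofNat_of_zero_le (show 0 ≤ Y - 1 by omega)
      obtain rfl : Y = n + 1 := by omega
      rw [canon_natCast_add_one, (coord_acWord_append _ _ (by rw [(coord_alt_bc n).2])).1,
        (coord_alt_bc n).2]
    · obtain ⟨n, rfl⟩ := Int.exists_eq_neg_ofNat h
      rw [canon_neg_natCast, (coord_acWord_append _ _ (by rw [(coord_alt_bc n).1])).2,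
        (coord_alt_bc n).1]
      rfl

/-- Reduced words are alternating words in `a`, `c` followed by an alternating word in `b`, `c`. -/
theorem exists_alt (w : Word) (h : redB w = true) :
    ∃ n m, w = alt a c n ++ alt b c m ∨ w = alt c a n ++ alt b c m := by
  induction w with
  | nil => exact ⟨0, 0, Or.inl rfl⟩
  | cons x w ih =>
    rw [redB, Bool.and_eq_true] at h
    obtain ⟨n, m, rfl | rfl⟩ := ih h.2
    · rcases n with _ | n
      · rcases x with _ | _ | _
        · exact ⟨1, m, Or.inl rfl⟩
        · rcases m with _ | m
          · exact ⟨0, 1, Or.inl rfl⟩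
          · exact absurd h.1 (by simp [alt, headOK])
        · exact ⟨1, m, Or.inr rfl⟩
      · rcases x with _ | _ | _
        · exact absurd h.1 (by simp [alt, headOK])
        · exact absurd h.1 (by simp [alt, headOK])
        · exact ⟨n + 2, m, Or.inr rfl⟩
    · rcases n with _ | n
      · rcases x with _ | _ | _
        · exact ⟨1, m, Or.inl rfl⟩
        · rcases m with _ | m
          · exact ⟨0, 1, Or.inl rfl⟩
          · exact absurd h.1 (by simp [alt, headOK])
        · exact ⟨1, m, Or.inr rfl⟩
      · rcases x with _ | _ | _
        · exact ⟨n + 2, m, Or.inl rfl⟩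
        -- A letter `b` in front of an `ac`-part that starts with `c`: if this part is a single `c`,
        -- then `bc` joins the `bc`-part; otherwise the obstruction `bca` appears.
        · rcases n with _ | n
          · rcases m with _ | m
            · exact ⟨0, 2, Or.inl rfl⟩
            · exact ⟨0, m + 3, Or.inl rfl⟩
          · exact absurd h.1 (by simp [alt, headOK])
        · exact absurd h.1 (by simp [alt, headOK])

/-- The words described by `exists_alt` are determined by their triples. This proves uniqueness of
reduced words directly, with no resolution of overlaps in `S`. -/
theorem canon_ac (n m : ℕ) : canon (coord (alt a c n ++ alt b c m)) = alt a c n ++ alt b c m ∧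
    canon (coord (alt c a n ++ alt b c m)) = alt c a n ++ alt b c m := by
  obtain ⟨p, hp⟩ := Nat.even_or_odd' n
  obtain ⟨r, hr⟩ := Nat.even_or_odd' m
  rcases hp with rfl | rfl <;> rcases hr with rfl | rfl
  · simp only [coord_alt_ac_append, coord_alt_bc, zero_add, zero_sub, canon_natCast,
      acWord_natCast, acWord_neg_natCast, and_self]
  · simp only [coord_alt_ac_append, coord_alt_bc, zero_add, zero_sub, canon_natCast_add_one,
      acWord_natCast, acWord_neg_natCast, and_self]
  · simp only [coord_alt_ac_append, coord_alt_bc, sub_zero, Bool.not_false, canon_neg_natCast,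
      acWord_natCast_add_one, acWord_neg_natCast_true, and_self]
  · simp only [coord_alt_ac_append, coord_alt_bc, sub_zero, Bool.not_true,
      canon_neg_natCast_add_one, acWord_natCast_add_one, acWord_neg_natCast_true, and_self]

theorem nf_of_redB {w : Word} (h : redB w = true) : nf w = w := by
  obtain ⟨n, m, rfl | rfl⟩ := exists_alt w h
  · exact (canon_ac n m).1
  · exact (canon_ac n m).2

theorem redB_nf (w : Word) : redB (nf w) = true := redB_canon _

theorem grpVal_nf (w : Word) : grpVal (nf w) = grpVal w := by
  rw [grpVal_eq_iff, nf, coord_canon]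

theorem nf_eq_iff (u v : Word) : nf u = nf v ↔ grpVal u = grpVal v := by
  constructor
  · intro h
    rw [← grpVal_nf u, h, grpVal_nf]
  · intro h
    rw [nf, nf, (grpVal_eq_iff u v).1 h]

theorem exists_grpVal (g : Grp) : ∃ w, grpVal w = g := by
  induction g using PresentedGroup.induction_on with
  | _ g =>
  induction g using FreeGroup.induction_on with
  | C1 => exact ⟨[], by simp [grpVal_nil]⟩
  | of x => exact ⟨[x], by simp [grpVal]; rfl⟩
  | inv_of x h =>
    refine ⟨[x], ?_⟩
    rw [map_inv, eq_inv_iff_mul_eq_one, grpVal_cons, grpVal_nil, mul_one]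
    exact of_sq x
  | mul x y hx hy =>
    obtain ⟨u, hu⟩ := hx
    obtain ⟨v, hv⟩ := hy
    exact ⟨u ++ v, by rw [grpVal_append, hu, hv, map_mul]⟩

theorem existsUnique_reduced (g : Grp) : ∃! w : Word, Morse.IsReduced V w ∧ grpVal w = g := by
  obtain ⟨w, rfl⟩ := exists_grpVal g
  refine ⟨nf w, ⟨(isReduced_iff _).2 (redB_nf w), grpVal_nf w⟩, ?_⟩
  rintro u ⟨hu, he⟩
  rw [← nf_of_redB ((isReduced_iff u).1 hu), nf_eq_iff, he]

theorem grpVal_S : ∀ p ∈ S, grpVal p.1 = grpVal p.2 := by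
  rintro p (rfl | rfl | rfl | rfl | rfl) <;> rw [grpVal_eq_iff] <;> decide

end G23

namespace G23
open Letter Module

/-! ### The bar resolution of the group algebra -/

section Basis
variable (k : Type*) [Field k]

theorem val_eq (w : Word) : Morse.val (gen k) w = MonoidAlgebra.of k Grp (grpVal w) := by
  simp only [Morse.val, grpVal, map_list_prod, List.map_map]
  rfl

theorem val_append (u v : Word) :
    Morse.val (gen k) (u ++ v) = Morse.val (gen k) u * Morse.val (gen k) v := by
  simp [Morse.val]

theorem val_nf (w : Word) : Morse.val (gen k) (nf w) = Morse.val (gen k) w := by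
  rw [val_eq, val_eq, grpVal_nf]

theorem val_nil : Morse.val (gen k) [] = 1 := rfl

noncomputable section

/-- Forgetting the coefficient of the unit. -/
def dropOne : Alg k →ₗ[k] ({g : Grp | g ≠ 1} →₀ k) :=
  (Finsupp.lsubtypeDomain {g : Grp | g ≠ 1}).comp (MonoidAlgebra.coeffLinearEquiv k).toLinearMap

theorem dropOne_apply (x : Alg k) (g : {g : Grp | g ≠ 1}) : dropOne k x g = x.coeff g.1 := rfl

theorem ker_dropOne : LinearMap.ker (dropOne k) = LinearMap.range (Algebra.linearMap k (Alg k)) := by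
  ext x
  rw [LinearMap.mem_ker, LinearMap.mem_range]
  constructor
  · intro h
    refine ⟨x.coeff 1, ?_⟩
    ext g
    by_cases hg : g = 1
    · simp [hg]
    · have : x.coeff g = 0 := by
        rw [← dropOne_apply k x ⟨g, hg⟩, h]; rfl
      simp [this, Ne.symm hg]
  · rintro ⟨r, rfl⟩
    ext g
    rw [dropOne_apply]
    simp [Ne.symm (show g.1 ≠ 1 from g.2)]

theorem dropOne_surjective : Function.Surjective (dropOne k) := by
  classical
  intro f
  refine ⟨⟨f.extendDomain⟩, ?_⟩
  ext g
  rw [dropOne_apply]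
  have h : g.1 ≠ 1 := g.2
  simp [Finsupp.extendDomain, h]

/-- The nontrivial group elements form a basis of `Λ / k`. -/
def redBasis : Basis {g : Grp | g ≠ 1} k (Bar.Red k (Alg k)) :=
  Basis.ofRepr ((Submodule.quotEquivOfEq _ _ (ker_dropOne k).symm).trans
    ((dropOne k).quotKerEquivOfSurjective (dropOne_surjective k)))

theorem redBasis_apply (g : {g : Grp | g ≠ 1}) :
    redBasis k g = Submodule.Quotient.mk (MonoidAlgebra.of k Grp g.1) := by
  classical
  rw [← (redBasis k).repr.injective.eq_iff, Basis.repr_self]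
  change _ = dropOne k (MonoidAlgebra.of k Grp g.1)
  ext h
  rw [dropOne_apply]
  change Finsupp.single g 1 h = Finsupp.single g.1 1 h.1
  rw [Finsupp.single_apply, Finsupp.single_apply]
  simp only [Subtype.ext_iff]

/-- The tuples of nontrivial group elements form a basis of `B_m`. -/
def barBasis (m : ℕ) : Basis (Fin m → {g : Grp | g ≠ 1}) (Bar.Env k (Alg k)) (Bar.B k (Alg k) m) :=
  (Basis.piTensorProduct fun _ => redBasis k).baseChange (Bar.Env k (Alg k))

theorem barBasis_apply (m : ℕ) (f : Fin m → {g : Grp | g ≠ 1}) :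
    barBasis k m f = Bar.symb 1 1 fun t => MonoidAlgebra.of k Grp (f t).1 := by
  rw [barBasis, Basis.baseChange_apply, Basis.piTensorProduct_apply]
  simp only [redBasis_apply]
  rfl

end

theorem grpVal_ne_one {w : Word} (h : w ≠ []) (hr : Morse.IsReduced V w) : grpVal w ≠ 1 := by
  intro h1
  rw [← grpVal_nil, ← nf_eq_iff, nf_of_redB ((isReduced_iff w).1 hr)] at h1
  exact h h1

/-- The group elements in a cell. -/
def cellElts (m : ℕ) (x : Morse.cells V m) (t : Fin m) : {g : Grp | g ≠ 1} :=
  ⟨grpVal (x.1.getD t []), by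
    have ht : t.1 < x.1.length := by rw [x.2.1]; exact t.2
    rw [List.getD_eq_getElem _ _ ht]
    have := x.2.2 _ (List.getElem_mem ht)
    exact grpVal_ne_one this.1 this.2⟩

/-- A nontrivial element has exactly one reduced word, and this word is nonempty; so vertices are
the same thing as tuples of nontrivial elements, the standard basis of the normalized bar
resolution. -/
theorem cellElts_bijective (m : ℕ) : Function.Bijective (cellElts m) := by
  constructor
  · rintro ⟨x, hx⟩ ⟨y, hy⟩ h
    apply Subtype.ext
    apply List.ext_getElem (by rw [hx.1, hy.1])
    intro t h1 h2
    have := congr_arg Subtype.val (congr_fun h ⟨t, hx.1 ▸ h1⟩)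
    simp only [cellElts, List.getD_eq_getElem _ _ h1, List.getD_eq_getElem _ _ h2] at this
    rw [← nf_eq_iff, nf_of_redB ((isReduced_iff _).1 (hx.2 _ (List.getElem_mem h1)).2),
      nf_of_redB ((isReduced_iff _).1 (hy.2 _ (List.getElem_mem h2)).2)] at this
    exact this
  · intro f
    choose w hw using fun t => (existsUnique_reduced (f t).1).exists
    refine ⟨⟨List.ofFn w, by simp, ?_⟩, ?_⟩
    · intro u hu
      obtain ⟨t, rfl⟩ := (List.mem_ofFn' w u).1 hu
      refine ⟨fun h => (f t).2 ?_, (hw t).1⟩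
      rw [← (hw t).2, h, grpVal_nil]
    · funext t
      apply Subtype.ext
      simp [cellElts, (hw t).2]

theorem cellSymb_eq (m : ℕ) (x : Morse.cells V m) :
    Morse.cellSymb k (gen k) m x.1 = barBasis k m (cellElts m x) := by
  rw [barBasis_apply]
  simp only [Morse.cellSymb, val_eq]
  rfl

theorem cellsBasis (m : ℕ) : Morse.CellsBasis V k (gen k) m := by
  have h : (fun x : Morse.cells V m => Morse.cellSymb k (gen k) m x.1) =
      barBasis k m ∘ cellElts m := funext fun x => cellSymb_eq k m x
  rw [Morse.CellsBasis, h]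
  refine ⟨(barBasis k m).linearIndependent.comp _ (cellElts_bijective m).1, ?_⟩
  rw [(cellElts_bijective m).2.range_comp, Basis.span_eq]

/-- `u ⊗ v` for words `u`, `v`: multiplication by `u` on the left and by `v` on the right. -/
noncomputable def lr (u v : Word) : Bar.Env k (Alg k) :=
  Morse.val (gen k) u ⊗ₜ[k] MulOpposite.op (Morse.val (gen k) v)

theorem lr_mul (u v u' v' : Word) : lr k u v * lr k u' v' = lr k (u ++ u') (v' ++ v) := by
  simp only [lr, Algebra.TensorProduct.tmul_mul_tmul, val_append, MulOpposite.op_mul]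

theorem lr_nil : lr k [] [] = 1 := rfl

/-- The tuple of the `i`-th face of `[w_1 | ⋯ | w_m]`; the face vanishes if it has an empty entry. -/
def faceCell (x : List Word) (i : ℕ) : List Word :=
  if i = 0 then x.tail else if i = x.length then x.dropLast
  else x.take (i - 1) ++ nf (x.getD (i - 1) [] ++ x.getD i []) :: x.drop (i + 1)

/-- The coefficient of the `i`-th face. -/
noncomputable def faceCoef (x : List Word) (i : ℕ) : Bar.Env k (Alg k) :=
  (-1 : k) ^ i • lr k (if i = 0 then x.getD 0 [] else [])
    (if i = x.length then x.getD (x.length - 1) [] else [])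

theorem faceCell_length {x : List Word} {m i : ℕ} (hx : x.length = m + 1) (hi : i ≤ m + 1) :
    (faceCell x i).length = m := by
  unfold faceCell
  split_ifs with h h'
  · simp [hx]
  · simp [hx]
  · simp; omega

/-- Replacing products by normal forms turns each summand of the bar differential into a coefficient
times a tuple of words, so that faces can be computed by `decide`. -/
theorem smul_face {x : List Word} {m : ℕ} (hx : x.length = m + 1) (i : Fin (m + 2)) :
    (-1 : k) ^ i.val • Bar.face i (fun t : Fin (m + 1) => Morse.val (gen k) (x.getD t [])) =
      faceCoef k x i • Morse.cellSymb k (gen k) m (faceCell x i) := by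
  have hm : ∀ t : Fin m, Bar.merge i (fun t : Fin (m + 1) => Morse.val (gen k) (x.getD t [])) t =
      Morse.val (gen k) ((faceCell x i).getD t []) := by
    intro t
    have ht := t.2
    simp only [Bar.merge, Fin.val_castSucc, Fin.val_succ]
    unfold faceCell
    by_cases h0 : i.val = 0
    · rw [if_neg (by omega), if_neg (by omega), if_pos h0]
      simp [List.getD_eq_getElem?_getD]
    rw [if_neg h0]
    by_cases h1 : i.val = m + 1
    · rw [if_pos (by omega), if_pos (by omega)]
      simp [List.getD_eq_getElem?_getD, hx]
    rw [if_neg (c := i.val = x.length) (by omega)]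
    have hi := i.2
    split_ifs with h2 h3
    · rw [List.getD_append _ _ _ _ (by simp; omega)]
      simp [List.getD_eq_getElem?_getD, show t.val < i.val - 1 by omega]
    · rw [List.getD_append_right _ _ _ _ (by simp; omega)]
      have e : t.val - (x.take (i.val - 1)).length = 0 := by simp; omega
      rw [e, List.getD_cons_zero, val_nf, val_append, ← h3, Nat.add_sub_cancel]
    · rw [List.getD_append_right _ _ _ _ (by simp; omega)]
      have e : t.val - (x.take (i.val - 1)).length = t.val - i.val + 1 := by simp; omega
      rw [e, List.getD_cons_succ]
      simp only [List.getD_eq_getElem?_getD, List.getElem?_drop]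
      congr 3
      omega
  have hs (u v : Alg k) (l : Fin m → Alg k) :
      Bar.symb u v l = (u ⊗ₜ[k] MulOpposite.op v : Bar.Env k (Alg k)) • Bar.symb (k := k) 1 1 l := by
    simp only [Bar.symb, TensorProduct.smul_tmul', smul_eq_mul,
      Algebra.TensorProduct.tmul_mul_tmul, mul_one]
    congr 2
    rw [← MulOpposite.op_mul, one_mul]
  rw [Bar.face, hs, funext hm, faceCoef, smul_assoc]
  congr 3
  · simp only [Fin.ext_iff, Fin.val_zero]
    split_ifs <;> rfl
  · simp only [Fin.ext_iff, Fin.val_last, hx, Nat.add_sub_cancel]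
    split_ifs <;> rfl

theorem cellSymb_eq_zero {x : List Word} {m : ℕ} (hx : x.length = m) (h : [] ∈ x) :
    Morse.cellSymb k (gen k) m x = 0 := by
  obtain ⟨t, ht, h'⟩ := List.mem_iff_getElem.1 h
  refine Bar.symb_eq_zero _ _ _ ⟨t, hx ▸ ht⟩ ?_
  change Morse.val (gen k) (x.getD t []) = 1
  rw [List.getD_eq_getElem _ _ ht, h', val_nil]

theorem faceCell_mem {x : List Word} {m i : ℕ} (hx : x ∈ Morse.cells V (m + 1)) (hi : i ≤ m + 1)
    (h : [] ∉ faceCell x i) : faceCell x i ∈ Morse.cells V m := by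
  refine ⟨faceCell_length hx.1 hi, fun w hw => ⟨fun h' => h (h' ▸ hw), ?_⟩⟩
  unfold faceCell at hw
  split_ifs at hw with h1 h2
  · exact (hx.2 w (List.mem_of_mem_tail hw)).2
  · exact (hx.2 w (List.mem_of_mem_dropLast hw)).2
  · rcases List.mem_append.1 hw with hw | hw
    · exact (hx.2 w (List.mem_of_mem_take hw)).2
    · rcases List.mem_cons.1 hw with rfl | hw
      · exact (isReduced_iff _).2 (redB_nf _)
      · exact (hx.2 w (List.mem_of_mem_drop hw)).2

/-- Several faces may be the same vertex, hence a sum. A face with an empty entry is zero in the bar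
module and is never equal to the vertex `z`. -/
theorem inc_eq {x z : List Word} {m : ℕ} (hx : x ∈ Morse.cells V (m + 1))
    (hz : z ∈ Morse.cells V m) :
    Morse.inc V k (gen k) x z =
      ∑ i ∈ Finset.range (m + 2), if faceCell x i = z then faceCoef k x i else 0 := by
  classical
  obtain rfl : m = z.length := hz.1.symm
  have hinj : Function.Injective (Finsupp.linearCombination (Bar.Env k (Alg k))
      (fun x : Morse.cells V z.length => Morse.cellSymb k (gen k) z.length x.1)) :=
    (cellsBasis k z.length).1
  rw [Morse.inc, dif_pos ⟨hx, hz⟩]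
  have key : Bar.d z.length (Morse.cellSymb k (gen k) (z.length + 1) x) =
      Finsupp.linearCombination (Bar.Env k (Alg k))
        (fun x : Morse.cells V z.length => Morse.cellSymb k (gen k) z.length x.1)
        (∑ i ∈ Finset.range (z.length + 2), if h : faceCell x i ∈ Morse.cells V z.length then
          Finsupp.single ⟨faceCell x i, h⟩ (faceCoef k x i) else 0) := by
    rw [Morse.cellSymb, Bar.d_symb, map_sum, Finset.sum_range]
    refine Finset.sum_congr rfl fun i _ => ?_
    rw [smul_face k hx.1 i]
    split_ifs with h
    · rw [Finsupp.linearCombination_single]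
    · rw [map_zero, cellSymb_eq_zero k (faceCell_length hx.1 (by omega)), smul_zero]
      by_contra h'
      exact h (faceCell_mem hx (by omega) h')
  rw [key, Morse.coords, Function.leftInverse_invFun hinj, Finsupp.finsetSum_apply]
  refine Finset.sum_congr rfl fun i _ => ?_
  by_cases h : faceCell x i = z
  · rw [dif_pos (by rw [h]; exact hz), if_pos h]
    simp [h]
  · rw [if_neg h]
    split_ifs with h'
    · simp [h]
    · rfl

end Basis

end G23

namespace G23
open Letter

/-! ### Chains -/

/-- States of the automaton that reads chain tuples. -/
inductive St
  | start
  | inA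
  | inB
  | inC

open St

/-- The transitions of the automaton. -/
def step : St → Word → Option St
  | start, [a] => some inA
  | start, [b] => some inB
  | start, [c] => some inC
  | inA, [a] => some inA
  | inB, [a] => some inA
  | inB, [b] => some inB
  | inB, [c, a] => some inA
  | inC, [c] => some inC
  | _, _ => none

/-- The state after reading a tuple. -/
def run : St → List Word → Option St
  | q, [] => some q
  | q, w :: x => (step q w).bind fun q' => run q' x

theorem step_eq_some {q q' : St} {w : Word} (h : step q w = some q') :
    (w = [a] ∧ q' = inA ∧ q ≠ inC) ∨ (w = [b] ∧ q' = inB ∧ (q = start ∨ q = inB)) ∨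
      (w = [c] ∧ q' = inC ∧ (q = start ∨ q = inC)) ∨ (w = [c, a] ∧ q' = inA ∧ q = inB) := by
  unfold step at h
  split at h <;> simp at h <;> subst h <;> simp

theorem run_cons {q : St} {w : Word} {x : List Word} :
    run q (w :: x) = (step q w).bind fun q' => run q' x := rfl

theorem run_append (q : St) (x y : List Word) :
    run q (x ++ y) = (run q x).bind fun q' => run q' y := by
  induction x generalizing q with
  | nil => rfl
  | cons w x ih =>
    rw [List.cons_append, run, run]
    cases step q w <;> simp [ih]

theorem run_concat {q q' : St} {x : List Word} {u : Word} (h : run q (x ++ [u]) = some q') :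
    ∃ s, run q x = some s ∧ step s u = some q' := by
  rw [run_append, Option.bind_eq_some_iff] at h
  obtain ⟨s, h1, h2⟩ := h
  refine ⟨s, h1, ?_⟩
  simpa [run] using h2

theorem exists_run_of_prefix {q q' : St} {x y : List Word} (h : run q y = some q')
    (hp : x <+: y) : ∃ s, run q x = some s := by
  obtain ⟨z, rfl⟩ := hp
  rw [run_append, Option.bind_eq_some_iff] at h
  obtain ⟨s, h1, -⟩ := h
  exact ⟨s, h1⟩

theorem step_ne_nil {q q' : St} {w : Word} (h : step q w = some q') : w ≠ [] := by
  rintro rfl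
  cases q <;> simp [step] at h

theorem redB_of_step {q q' : St} {w : Word} (h : step q w = some q') : redB w = true := by
  rcases step_eq_some h with ⟨rfl, -⟩ | ⟨rfl, -⟩ | ⟨rfl, -⟩ | ⟨rfl, -⟩ <;> rfl

/-- Valid transitions are prefix-free. -/
theorem step_prefix {q q₁ q₂ : St} {u v : Word} (hu : step q u = some q₁) (hv : step q v = some q₂)
    (h : u <+: v) : u = v := by
  rcases step_eq_some hu with ⟨rfl, -, h1⟩ | ⟨rfl, -, h1⟩ | ⟨rfl, -, h1⟩ | ⟨rfl, -, h1⟩ <;>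
    rcases step_eq_some hv with ⟨rfl, -, h2⟩ | ⟨rfl, -, h2⟩ | ⟨rfl, -, h2⟩ | ⟨rfl, -, h2⟩ <;>
    simp_all [List.cons_prefix_cons]

/-- Admissible entries are prefix-free in every state, so the subdivision of a word is forced entry
by entry. -/
theorem run_prefix {q q₁ q₂ : St} {x y : List Word} (hx : run q x = some q₁)
    (hy : run q y = some q₂) (hl : x.length ≤ y.length) (h : x.flatten <+: y.flatten) :
    x <+: y := by
  induction x generalizing q y with
  | nil => exact List.nil_prefix
  | cons u x ih =>
    rcases y with _ | ⟨v, y⟩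
    · simp at hl
    rw [run_cons, Option.bind_eq_some_iff] at hx hy
    obtain ⟨s, hs, hx⟩ := hx
    obtain ⟨t, ht, hy⟩ := hy
    rw [List.flatten_cons, List.flatten_cons] at h
    have huv : u = v := by
      rcases List.prefix_or_prefix_of_prefix ((List.prefix_append u _).trans h)
        (List.prefix_append v y.flatten) with h' | h'
      · exact step_prefix hs ht h'
      · exact (step_prefix ht hs h').symm
    subst huv
    obtain rfl : s = t := by rw [hs] at ht; exact Option.some.inj ht
    rw [List.prefix_append_right_inj] at h
    rw [List.cons_prefix_cons]
    exact ⟨rfl, ih hx hy (by simpa using hl) h⟩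

/-- Two consecutive entries of a chain tuple. -/
theorem step_step {q q₁ q₂ : St} {u v : Word} (hu : step q u = some q₁) (hv : step q₁ v = some q₂) :
    (∃ w y, u = w ++ [y] ∧ y :: v ∈ V) ∧ redB (u ++ v).dropLast = true := by
  rw [V_eq]
  rcases step_eq_some hu with ⟨rfl, rfl, h1⟩ | ⟨rfl, rfl, h1⟩ | ⟨rfl, rfl, h1⟩ | ⟨rfl, rfl, h1⟩ <;>
    rcases step_eq_some hv with ⟨rfl, rfl, h2⟩ | ⟨rfl, rfl, h2⟩ | ⟨rfl, rfl, h2⟩ | ⟨rfl, rfl, h2⟩ <;>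
    first
    | (simp [step] at hv; done)
    | exact ⟨⟨[], _, rfl, by simp⟩, rfl⟩
    | exact ⟨⟨[c], _, rfl, by simp⟩, rfl⟩

/-- An obstruction that starts in the last entry of a chain tuple ends after a valid entry. -/
theorem step_of_mem_V {q q₁ : St} {u e : Word} (hu : step q u = some q₁) {i : ℕ}
    (hi : i < u.length) (he : e ≠ []) (h : u.drop i ++ e ∈ V) : ∃ q₂, step q₁ e = some q₂ := by
  rw [V_eq] at h
  rcases step_eq_some hu with ⟨rfl, rfl, h1⟩ | ⟨rfl, rfl, h1⟩ | ⟨rfl, rfl, h1⟩ | ⟨rfl, rfl, h1⟩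
  · obtain rfl : i = 0 := by simpa using hi
    simp at h; subst h; exact ⟨_, rfl⟩
  · obtain rfl : i = 0 := by simpa using hi
    simp at h
    rcases h with rfl | rfl | rfl <;> exact ⟨_, rfl⟩
  · obtain rfl : i = 0 := by simpa using hi
    simp at h; subst h; exact ⟨_, rfl⟩
  · have : i = 0 ∨ i = 1 := by simp at hi; omega
    rcases this with rfl | rfl
    · simp at h
    · simp at h; subst h; exact ⟨_, rfl⟩

/-- The length of the first `j` entries of a tuple. -/
def cum (x : List Word) (j : ℕ) : ℕ := (x.take j).flatten.length

theorem exists_split {x : List Word} {q : St} (hx : run start x = some q) {j : ℕ} (hj : 1 ≤ j)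
    (hj' : j + 1 ≤ x.length) : ∃ A u v B s s' s'', x.flatten = A ++ (u ++ v) ++ B ∧
      cum x (j - 1) = A.length ∧ cum x j = A.length + u.length ∧
      cum x (j + 1) = A.length + u.length + v.length ∧ step s u = some s' ∧ step s' v = some s'' := by
  obtain ⟨j, rfl⟩ : ∃ i, j = i + 1 := ⟨j - 1, by omega⟩
  have e1 : x = x.take j ++ x[j] :: x[j + 1] :: x.drop (j + 2) := by
    rw [← List.drop_eq_getElem_cons, ← List.drop_eq_getElem_cons, List.take_append_drop]
  set y := x.take j with hy
  set u := x[j]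
  set v := x[j + 1]
  set z := x.drop (j + 2)
  have hl : y.length = j := by simp [hy]; omega
  rw [e1, run_append, Option.bind_eq_some_iff] at hx
  obtain ⟨s, hs, hx⟩ := hx
  rw [run_cons, Option.bind_eq_some_iff] at hx
  obtain ⟨s', hs', hx⟩ := hx
  rw [run_cons, Option.bind_eq_some_iff] at hx
  obtain ⟨s'', hs'', hx⟩ := hx
  refine ⟨y.flatten, u, v, z.flatten, s, s', s'', ?_, rfl, ?_, ?_, hs', hs''⟩
  · rw [e1]; simp
  · rw [cum, e1, List.take_append, List.take_of_length_le (by omega)]; simp [hl]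
  · rw [cum, e1, List.take_append, List.take_of_length_le (by omega)]; simp [hl, add_assoc]

theorem cum_length (x : List Word) : cum x x.length = x.flatten.length := by simp [cum]

theorem cum_one {x : List Word} {q : St} (hx : run start x = some q) (h : 1 ≤ x.length) :
    cum x 1 = 1 := by
  rcases x with _ | ⟨w, x⟩
  · simp at h
  rw [run_cons, Option.bind_eq_some_iff] at hx
  obtain ⟨s, hs, -⟩ := hx
  rcases step_eq_some hs with ⟨rfl, -⟩ | ⟨rfl, -⟩ | ⟨rfl, -⟩ | ⟨rfl, -, h⟩
  · simp [cum]
  · simp [cum]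
  · simp [cum]
  · cases h

/-- An obstruction in the word of a chain tuple that starts after the first `j - 1` entries does not
end before the end of the entry number `j + 1`. -/
theorem cum_le_of_prefix {x : List Word} {q : St} (hx : run start x = some q) {j : ℕ} (hj : 1 ≤ j)
    (hj' : j + 1 ≤ x.length) {i : ℕ} (hi : cum x (j - 1) ≤ i) {v : Word} (hv : v ∈ V)
    (h : v <+: x.flatten.drop i) : cum x (j + 1) ≤ i + v.length := by
  obtain ⟨A, u, u', B, s, s', s'', e, h0, -, h2, hu, hu'⟩ := exists_split hx hj hj'
  by_contra hlt
  have hred := (step_step hu hu').2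
  rw [← isReduced_iff] at hred
  refine hred v hv ?_
  rw [e, List.append_assoc, List.drop_append, List.drop_eq_nil_of_le (by omega), List.nil_append,
    List.drop_append_of_le_length (by simp; omega)] at h
  have h' : v <+: ((u ++ u').drop (i - A.length)).dropLast := by
    rw [List.dropLast_eq_take]
    have := h.take v.length
    rw [List.take_length, List.take_append_of_le_length (by simp; omega)] at this
    refine this.trans (List.take_prefix_take_left ?_)
    simp; omega
  refine h'.isInfix.trans ?_
  rw [List.dropLast_eq_take, List.dropLast_eq_take, List.length_drop, List.take_drop]
  rw [show i - A.length + ((u ++ u').length - (i - A.length) - 1) = (u ++ u').length - 1 by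
    simp; omega]
  exact (List.drop_suffix _ _).isInfix

/-- By induction `b_(j-2)` is at least the end of entry `j - 1`, and `a_j` exceeds `b_(j-2)`; so the
`j`-th obstruction starts after the first `j - 1` entries and `cum_le_of_prefix` applies. The
subdivision read by the automaton therefore has the earliest possible ends, which is the minimality
required of chains. -/
theorem prechain_bound {x : List Word} {q : St} (hx : run start x = some q) {m : ℕ} {y : Word}
    {f g : ℕ → ℕ} (hd : Morse.PrechainData V m y f g) (hy : y <+: x.flatten) {j : ℕ} (hj : 1 ≤ j)
    (hjm : j ≤ m) (hjx : j + 1 ≤ x.length) : cum x (j + 1) ≤ g j := by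
  induction j using Nat.strong_induction_on with
  | _ j ih =>
  have hf : 1 ≤ f j ∧ cum x (j - 1) ≤ f j - 1 := by
    rcases Nat.lt_or_ge j 3 with h3 | h3
    · have : j = 1 ∨ j = 2 := by omega
      rcases this with rfl | rfl
      · simp [hd.a_one, cum]
      · have := hd.a_lt 1 le_rfl hjm
        rw [hd.a_one] at this
        rw [cum_one hx (by omega)]
        simp at this ⊢; omega
    · obtain ⟨i, rfl⟩ : ∃ i, j = i + 2 := ⟨j - 2, by omega⟩
      have h1 := ih i (by omega) (by omega) (by omega) (by omega)
      have h2 := hd.b_lt i (by omega) hjm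
      rw [show i + 2 - 1 = i + 1 by omega]
      omega
  have hv := hd.mem j hj hjm
  set v := (y.drop (f j - 1)).take (g j + 1 - f j) with hvdef
  have hp : v <+: x.flatten.drop (f j - 1) :=
    (List.take_prefix _ _).trans (hy.drop _)
  have h1 := cum_le_of_prefix hx hj hjx hf.2 hv hp
  have h2 : v.length ≤ g j + 1 - f j := by simp [hvdef]
  have h3 : 0 < v.length := by
    rw [List.length_pos_iff]
    intro h0
    rw [h0, V_eq] at hv
    simp at hv
  omega

/-- The `j`-th obstruction is the last letter of entry `j` followed by entry `j + 1` (`step_step`),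
so `a_j` and `b_j` are the ends of these two entries. Minimality is `prechain_bound`. -/
theorem flatten_mem_chains {x : List Word} {q : St} (hx : run start x = some q) {n : ℕ}
    (hl : x.length = n + 1) : x.flatten ∈ Morse.chains V n := by
  rcases n with _ | n
  · obtain ⟨w, rfl⟩ := List.length_eq_one_iff.1 hl
    have h1 := cum_one hx (by simp)
    simp [cum] at h1
    obtain ⟨y, hy⟩ := List.length_eq_one_iff.1 h1
    exact ⟨y, by simp [hy]⟩
  have hlt : ∀ j, 1 ≤ j → j ≤ n + 1 → cum x j < cum x (j + 1) := by
    intro j h1 h2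
    obtain ⟨A, u, u', B, s, s', s'', e, h0, h1, h2, hu, hu'⟩ := exists_split hx h1 (by omega)
    have := List.length_pos_iff.2 (step_ne_nil hu')
    omega
  have hb : cum x (n + 2) = x.flatten.length := by rw [← cum_length, hl]
  refine ⟨cum x, fun j => cum x (j + 1), ⟨cum_one hx (by omega), hb, ?_, ?_, ?_, ?_, ?_⟩, ?_⟩
  · exact fun j h1 h2 => hlt j h1 (by omega)
  · exact fun j h1 h2 => le_rfl
  · exact fun j h1 h2 => hlt (j + 1) (by omega) (by omega)
  · exact fun h => by simpa using hlt (n + 1) (by omega) (by omega)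
  · intro j h1 h2
    obtain ⟨A, u, u', B, s, s', s'', e, h0, h1, h2, hu, hu'⟩ := exists_split hx h1 (by omega)
    obtain ⟨⟨w, y, rfl, hy⟩, -⟩ := step_step hu hu'
    simp only [List.length_append, List.length_singleton] at h1 h2
    rw [h1, h2, e]
    have : A ++ (w ++ [y] ++ u') ++ B = (A ++ w) ++ ((y :: u') ++ B) := by simp
    rw [this, List.drop_left' (by simp only [List.length_append]; omega), List.take_left' (by simp; omega)]
    exact hy
  · rintro m h1 h2 s hs ⟨f, g, hd⟩
    have hd' := hd.b_last
    have := prechain_bound hx hd (List.take_prefix _ _) h1 le_rfl (by omega)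
    rw [hd', List.length_take] at this
    dsimp only at hs
    omega

/-- Cutting the word at the end of the last but one obstruction leaves a chain of one degree less,
which has a subdivision by induction. The last obstruction starts inside the last entry of that
subdivision, so what remains of it is an admissible entry (`step_of_mem_V`). -/
theorem exists_run_of_mem_chains {n : ℕ} {w : Word} (hw : w ∈ Morse.chains V n) :
    ∃ x q, x.length = n + 1 ∧ run start x = some q ∧ x.flatten = w := by
  induction n generalizing w with
  | zero =>
    obtain ⟨x, rfl⟩ := hw
    rcases x with _ | _ | _
    · exact ⟨[[a]], _, rfl, rfl, rfl⟩
    · exact ⟨[[b]], _, rfl, rfl, rfl⟩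
    · exact ⟨[[c]], _, rfl, rfl, rfl⟩
  | succ n ih =>
    obtain ⟨f, g, hd, hmin⟩ := hw
    rcases n with _ | n
    · have hm := hd.mem 1 le_rfl le_rfl
      have hb := hd.b_last
      simp only [zero_add] at hb
      rw [hd.a_one, hb] at hm
      simp [V_eq] at hm
      rcases hm with rfl | rfl | rfl | rfl | rfl
      · exact ⟨[[a], [a]], _, rfl, rfl, rfl⟩
      · exact ⟨[[b], [b]], _, rfl, rfl, rfl⟩
      · exact ⟨[[c], [c]], _, rfl, rfl, rfl⟩
      · exact ⟨[[b], [a]], _, rfl, rfl, rfl⟩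
      · exact ⟨[[b], [c, a]], _, rfl, rfl, rfl⟩
    have hlast : g (n + 1) < w.length := by
      have := hd.b_lt_last (by omega)
      rwa [hd.b_last] at this
    have hmono : ∀ i, i ≤ n → g (n + 1 - i) ≤ g (n + 1) := by
      intro i
      induction i with
      | zero => intro; rfl
      | succ i ih' =>
        intro hi
        have h1 := hd.b_lt (n - i) (by omega) (by omega)
        have h2 := hd.a_le (n + 1 - i) (by omega) (by omega)
        have h3 := ih' (by omega)
        rw [show n - i + 2 = n + 1 - i + 1 by omega] at h1
        rw [show n + 1 - (i + 1) = n - i by omega]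
        omega
    have hmono' : ∀ j, 1 ≤ j → j ≤ n + 1 → g j ≤ g (n + 1) := by
      intro j h1 h2
      have := hmono (n + 1 - j) (by omega)
      rwa [show n + 1 - (n + 1 - j) = j by omega] at this
    have hd' : Morse.PrechainData V (n + 1) (w.take (g (n + 1))) f g := by
      refine ⟨hd.a_one, by simp; omega, fun j h1 h2 => hd.a_lt j h1 (by omega),
        fun j h1 h2 => hd.a_le j h1 (by omega), fun j h1 h2 => hd.b_lt j h1 (by omega), ?_, ?_⟩
      · intro h
        have h1 := hd.b_lt n (by omega) (by omega)
        have h2 : f (n + 2) ≤ g (n + 1) := hd.a_le (n + 1) (by omega) (by omega)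
        rw [Nat.add_sub_cancel]
        omega
      · intro j h1 h2
        have := hd.mem j h1 (by omega)
        rw [List.drop_take, List.take_take]
        have h3 := hmono' j h1 h2
        rwa [min_eq_left]
        have : f j ≥ 1 := by
          rcases Nat.lt_or_ge j 2 with h4 | h4
          · obtain rfl : j = 1 := by omega
            rw [hd.a_one]
          · have := hd.a_lt (j - 1) (by omega) (by omega)
            rw [Nat.sub_add_cancel (by omega)] at this
            omega
        omega
    obtain ⟨x, q, hl, hx, he⟩ := ih (w := w.take (g (n + 1))) ⟨f, g, hd', by
      intro m h1 h2 s hs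
      rw [List.take_take, min_eq_left (hs.le.trans (hmono' m h1 h2))]
      exact hmin m h1 (by omega) s hs⟩
    -- The last obstruction starts after the first `n + 1` of the `n + 2` entries of `x`, because it
    -- starts after the end of the obstruction number `n`.
    have hf : cum x (n + 1) + 1 ≤ f (n + 2) := by
      rcases Nat.eq_zero_or_pos n with rfl | hn
      · rw [cum_one hx (by omega)]
        have := hd.a_lt 1 le_rfl (by omega)
        rw [hd.a_one] at this
        exact this
      · have h1 := prechain_bound hx hd' (by rw [he]) (j := n) hn (by omega) (by omega)
        have h2 := hd.b_lt n hn (by omega)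
        omega
    have hf' : f (n + 2) ≤ g (n + 1) := hd.a_le (n + 1) (by omega) (by omega)
    have hv := hd.mem (n + 2) (by omega) le_rfl
    have hbl := hd.b_last
    rw [hbl, List.take_of_length_le (by simp; omega)] at hv
    obtain ⟨y, u, rfl⟩ : ∃ y u, x = y ++ [u] :=
      ⟨x.dropLast, x.getLast (by rintro rfl; simp at hl), (List.dropLast_append_getLast _).symm⟩
    obtain ⟨s, hs, hu⟩ := run_concat hx
    have hc : cum (y ++ [u]) (n + 1) = y.flatten.length := by
      rw [cum, List.take_left' (by simpa using hl)]
    have hlen := congr_arg List.length he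
    rw [List.flatten_append, List.length_append, List.flatten_singleton, List.length_take] at hlen
    have hw : w = y.flatten ++ (u ++ w.drop (g (n + 1))) := by
      conv_lhs => rw [← List.take_append_drop (g (n + 1)) w, ← he]
      simp
    have hne : w.drop (g (n + 1)) ≠ [] := by
      rw [Ne, List.drop_eq_nil_iff]; omega
    set e := w.drop (g (n + 1))
    rw [hw, List.drop_append, List.drop_eq_nil_of_le (by omega), List.nil_append,
      List.drop_append_of_le_length (by omega)] at hv
    obtain ⟨q₂, hq₂⟩ := step_of_mem_V hu (by omega) hne hv
    refine ⟨y ++ [u] ++ [e], q₂, by simpa using hl, ?_, ?_⟩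
    · rw [run_append, hx]
      simp [run, hq₂]
    · rw [hw]; simp

/-- If all initial words are chains, then each has an accepted subdivision; by `run_prefix` the
subdivision of a longer one extends that of a shorter one, so together they are the given tuple. -/
theorem isChainTuple_iff (x : List Word) :
    Morse.IsChainTuple V x ↔ ∃ q, run start x = some q := by
  constructor
  · intro h
    induction x using List.reverseRecOn with
    | nil => exact ⟨_, rfl⟩
    | append_singleton x u ih =>
      obtain ⟨q, hq⟩ := ih fun i hi => by
        have := h i (by simp; omega)
        rwa [List.take_append_of_le_length (by omega)] at this
      have h1 := h x.length (by simp)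
      rw [List.take_of_length_le (by simp)] at h1
      obtain ⟨y, q', hl, hy, he⟩ := exists_run_of_mem_chains h1
      obtain ⟨z, rfl⟩ := run_prefix hq hy (by omega) (by rw [he]; simp)
      obtain ⟨v, rfl⟩ := List.length_eq_one_iff.1 (show z.length = 1 by simp at hl; omega)
      have : v = u := by simpa using he
      exact ⟨q', this ▸ hy⟩
  · rintro ⟨q, hq⟩ i hi
    obtain ⟨s, hs⟩ := exists_run_of_prefix hq (List.take_prefix (i + 1) x)
    exact flatten_mem_chains hs (by simp; omega)

theorem run_inA {x : List Word} {q : St} : run inA x = some q ↔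
    x = List.replicate x.length [a] ∧ q = inA := by
  induction x with
  | nil => simp [run, eq_comm]
  | cons w x ih =>
    rw [run_cons, Option.bind_eq_some_iff, List.length_cons, List.replicate_succ, List.cons.injEq]
    constructor
    · rintro ⟨s, hs, h⟩
      rcases step_eq_some hs with ⟨rfl, rfl, -⟩ | ⟨-, -, h'⟩ | ⟨-, -, h'⟩ | ⟨-, -, h'⟩
      · rw [ih] at h
        exact ⟨⟨rfl, h.1⟩, h.2⟩
      all_goals simp at h'
    · rintro ⟨⟨rfl, h⟩, rfl⟩
      exact ⟨inA, rfl, ih.2 ⟨h, rfl⟩⟩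

theorem run_inC {x : List Word} {q : St} : run inC x = some q ↔
    x = List.replicate x.length [c] ∧ q = inC := by
  induction x with
  | nil => simp [run, eq_comm]
  | cons w x ih =>
    rw [run_cons, Option.bind_eq_some_iff, List.length_cons, List.replicate_succ, List.cons.injEq]
    constructor
    · rintro ⟨s, hs, h⟩
      rcases step_eq_some hs with ⟨-, -, h'⟩ | ⟨-, -, h'⟩ | ⟨rfl, rfl, -⟩ | ⟨-, -, h'⟩
      · simp at h'
      · simp at h'
      · rw [ih] at h
        exact ⟨⟨rfl, h.1⟩, h.2⟩
      · simp at h'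
    · rintro ⟨⟨rfl, h⟩, rfl⟩
      exact ⟨inC, rfl, ih.2 ⟨h, rfl⟩⟩

theorem run_replicate_b (q : St) (hq : q = start ∨ q = inB) (i : ℕ) :
    run q (List.replicate (i + 1) [b]) = some inB := by
  induction i generalizing q with
  | zero => rcases hq with rfl | rfl <;> rfl
  | succ i ih =>
    rw [List.replicate_succ, run_cons]
    have : step q [b] = some inB := by rcases hq with rfl | rfl <;> rfl
    rw [this]
    exact ih inB (Or.inr rfl)

theorem run_pw (x : Letter) (i : ℕ) : run start (pw x (i + 1)) =
    some (match x with | a => inA | b => inB | c => inC) := by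
  rcases x with _ | _ | _
  · rw [pw, List.replicate_succ, run_cons]
    exact run_inA.2 ⟨by simp, rfl⟩
  · exact run_replicate_b _ (Or.inl rfl) i
  · rw [pw, List.replicate_succ, run_cons]
    exact run_inC.2 ⟨by simp, rfl⟩

theorem run_ba (i j : ℕ) : run start (ba (i + 1) (j + 1)) = some inA := by
  rw [ba, run_append, run_replicate_b _ (Or.inl rfl), Option.bind_some, List.replicate_succ,
    run_cons]
  exact run_inA.2 ⟨by simp, rfl⟩

theorem run_bca (i j : ℕ) : run start (bca (i + 1) (j + 1)) = some inA := by
  rw [bca, run_append, run_replicate_b _ (Or.inl rfl), Option.bind_some, run_cons]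
  exact run_inA.2 ⟨by simp, rfl⟩

theorem exists_of_run_inB {x : List Word} {q : St} (h : run inB x = some q) :
    (∃ i, x = List.replicate i [b]) ∨ (∃ i j, x = List.replicate i [b] ++ List.replicate (j + 1) [a]) ∨
      (∃ i j, x = List.replicate i [b] ++ [c, a] :: List.replicate j [a]) := by
  induction x with
  | nil => exact Or.inl ⟨0, rfl⟩
  | cons w x ih =>
    rw [run_cons, Option.bind_eq_some_iff] at h
    obtain ⟨s, hs, h⟩ := h
    rcases step_eq_some hs with ⟨rfl, rfl, -⟩ | ⟨rfl, rfl, -⟩ | ⟨-, -, h'⟩ | ⟨rfl, rfl, -⟩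
    · rw [run_inA] at h
      refine Or.inr (Or.inl ⟨0, x.length, ?_⟩)
      rw [List.replicate_succ, ← h.1]; rfl
    · rcases ih h with ⟨i, rfl⟩ | ⟨i, j, rfl⟩ | ⟨i, j, rfl⟩
      · exact Or.inl ⟨i + 1, rfl⟩
      · exact Or.inr (Or.inl ⟨i + 1, j, rfl⟩)
      · exact Or.inr (Or.inr ⟨i + 1, j, rfl⟩)
    · simp at h'
    · rw [run_inA] at h
      refine Or.inr (Or.inr ⟨0, x.length, ?_⟩)
      rw [← h.1]; rfl

/-- The chain tuples of length `n + 1`. -/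
theorem exists_run_iff {x : List Word} {n : ℕ} :
    (x.length = n + 1 ∧ ∃ q, run start x = some q) ↔
      x ∈ ({pw a (n + 1), pw b (n + 1), pw c (n + 1)} ∪
        {x | ∃ i j, i + j = n + 1 ∧ 1 ≤ i ∧ 1 ≤ j ∧ (x = ba i j ∨ x = bca i j)} :
          Set (List Word)) := by
  constructor
  · rintro ⟨hl, q, hx⟩
    rcases x with _ | ⟨w, x⟩
    · simp at hl
    rw [run_cons, Option.bind_eq_some_iff] at hx
    obtain ⟨s, hs, h⟩ := hx
    obtain rfl : x.length = n := by simpa using hl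
    rcases step_eq_some hs with ⟨rfl, rfl, -⟩ | ⟨rfl, rfl, -⟩ | ⟨rfl, rfl, -⟩ | ⟨rfl, rfl, h'⟩
    · refine Or.inl (Or.inl ?_)
      rw [run_inA] at h
      rw [pw, List.replicate_succ, ← h.1]
    · rcases exists_of_run_inB h with ⟨i, rfl⟩ | ⟨i, j, rfl⟩ | ⟨i, j, rfl⟩
      · refine Or.inl (Or.inr (Or.inl ?_))
        simp [pw, List.replicate_succ]
      · exact Or.inr ⟨i + 1, j + 1, by simp; omega, by omega, by omega, Or.inl rfl⟩
      · exact Or.inr ⟨i + 1, j + 1, by simp; omega, by omega, by omega, Or.inr rfl⟩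
    · refine Or.inl (Or.inr (Or.inr ?_))
      rw [run_inC] at h
      simp only [Set.mem_singleton_iff]
      rw [pw, List.replicate_succ, ← h.1]
    · cases h'
  · rintro ((rfl | rfl | rfl) | ⟨i, j, hij, hi, hj, (rfl | rfl)⟩)
    · exact ⟨by simp [pw], _, run_pw _ _⟩
    · exact ⟨by simp [pw], _, run_pw _ _⟩
    · exact ⟨by simp [pw], _, run_pw _ _⟩
    · obtain ⟨i, rfl⟩ := Nat.exists_eq_add_of_le' hi
      obtain ⟨j, rfl⟩ := Nat.exists_eq_add_of_le' hj
      exact ⟨by simp [ba]; omega, _, run_ba _ _⟩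
    · obtain ⟨i, rfl⟩ := Nat.exists_eq_add_of_le' hi
      obtain ⟨j, rfl⟩ := Nat.exists_eq_add_of_le' hj
      exact ⟨by simp [bca]; omega, _, run_bca _ _⟩

theorem chains_eq (n : ℕ) : Morse.chains V n =
      {List.replicate (n + 1) a, List.replicate (n + 1) b, List.replicate (n + 1) c} ∪
      {w | ∃ i j, i + j = n + 1 ∧ 1 ≤ i ∧ 1 ≤ j ∧
        (w = List.replicate i b ++ List.replicate j a ∨
          w = List.replicate i b ++ c :: List.replicate j a)} := by
  have hf (x : Letter) (i : ℕ) : (List.replicate i [x]).flatten = List.replicate i x := by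
    induction i with
    | zero => rfl
    | succ i ih => rw [List.replicate_succ, List.flatten_cons, ih]; rfl
  have h1 : Morse.chains V n = List.flatten '' {x | x.length = n + 1 ∧ ∃ q, run start x = some q} := by
    ext w
    constructor
    · intro h
      obtain ⟨x, q, hl, hx, rfl⟩ := exists_run_of_mem_chains h
      exact ⟨x, ⟨hl, q, hx⟩, rfl⟩
    · rintro ⟨x, ⟨hl, q, hx⟩, rfl⟩
      exact flatten_mem_chains hx hl
  have hbca (i j : ℕ) (hj : 1 ≤ j) :
      (bca i j).flatten = List.replicate i b ++ c :: List.replicate j a := by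
    obtain ⟨j, rfl⟩ := Nat.exists_eq_add_of_le' hj
    simp [bca, hf, List.replicate_succ]
  rw [h1]
  simp only [exists_run_iff]
  ext w
  constructor
  · rintro ⟨x, ((rfl | rfl | rfl) | ⟨i, j, hij, hi, hj, (rfl | rfl)⟩), rfl⟩
    · exact Or.inl (Or.inl (hf _ _))
    · exact Or.inl (Or.inr (Or.inl (hf _ _)))
    · exact Or.inl (Or.inr (Or.inr (hf _ _)))
    · exact Or.inr ⟨i, j, hij, hi, hj, Or.inl (by simp [ba, hf])⟩
    · exact Or.inr ⟨i, j, hij, hi, hj, Or.inr (hbca i j hj)⟩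
  · rintro ((rfl | rfl | rfl) | ⟨i, j, hij, hi, hj, (rfl | rfl)⟩)
    · exact ⟨_, Or.inl (Or.inl rfl), hf _ _⟩
    · exact ⟨_, Or.inl (Or.inr (Or.inl rfl)), hf _ _⟩
    · exact ⟨_, Or.inl (Or.inr (Or.inr rfl)), hf _ _⟩
    · exact ⟨_, Or.inr ⟨i, j, hij, hi, hj, Or.inl rfl⟩, by simp [ba, hf]⟩
    · exact ⟨_, Or.inr ⟨i, j, hij, hi, hj, Or.inr rfl⟩, hbca i j hj⟩

end G23

namespace G23
open Letter St

/-! ### The matching -/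

section Matching
variable (k : Type*) [Field k]

theorem redB_of_infix {u v : Word} (h : u <:+: v) (hv : redB v = true) : redB u = true := by
  rw [← isReduced_iff] at hv ⊢
  exact fun w hw h' => hv w hw (h'.trans h)

theorem mem_cells_iff {n : ℕ} {x : List Word} :
    x ∈ Morse.cells V n ↔ x.length = n ∧ ∀ w ∈ x, w ≠ [] ∧ redB w = true := by
  simp only [Morse.cells, ← isReduced_iff]
  rfl

theorem cells_of_run {q q' : St} {x : List Word} (h : run q x = some q') :
    ∀ w ∈ x, w ≠ [] ∧ redB w = true := by
  induction x generalizing q with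
  | nil => simp
  | cons u x ih =>
    rw [run_cons, Option.bind_eq_some_iff] at h
    obtain ⟨s, hs, h⟩ := h
    intro w hw
    rcases List.mem_cons.1 hw with rfl | hw
    · exact ⟨step_ne_nil hs, redB_of_step hs⟩
    · exact ih h w hw

theorem run_concat_of {q q' q'' : St} {p : List Word} {u : Word} (hp : run q p = some q')
    (hu : step q' u = some q'') : run q (p ++ [u]) = some q'' := by
  rw [run_append, hp]
  simp [run, hu]

/-- The decomposition of a tuple at its first invalid entry is unique. -/
theorem split_unique {p₁ p₂ s₁ s₂ : List Word} {w₁ w₂ : Word} {q q₁ q₂ : St}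
    (h : p₁ ++ w₁ :: s₁ = p₂ ++ w₂ :: s₂) (h₁ : run q p₁ = some q₁) (h₁' : step q₁ w₁ = none)
    (h₂ : run q p₂ = some q₂) (h₂' : step q₂ w₂ = none) : p₁ = p₂ ∧ w₁ = w₂ ∧ s₁ = s₂ := by
  have key {p₁ p₂ r : List Word} {w₁ : Word} {q₁ q₂ : St} (h₁ : run q p₁ = some q₁)
      (h₁' : step q₁ w₁ = none) (h₂ : run q p₂ = some q₂) (e : p₂ = p₁ ++ w₁ :: r) : False := by
    rw [e, run_append, h₁, Option.bind_some, run_cons, h₁'] at h₂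
    simp at h₂
  rcases List.append_eq_append_iff.1 h with ⟨r, e, e'⟩ | ⟨r, e, e'⟩
  · rcases r with _ | ⟨w, r⟩
    · simp at e e'
      exact ⟨e.symm, e'⟩
    · simp at e'
      obtain ⟨rfl, -⟩ := e'
      exact (key h₁ h₁' h₂ e).elim
  · rcases r with _ | ⟨w, r⟩
    · simp at e e'
      exact ⟨e, e'.1.symm, e'.2.symm⟩
    · simp at e'
      obtain ⟨rfl, -⟩ := e'
      exact (key h₂ h₂' h₁ e).elim

theorem step_append_eq_none {q q' : St} {u v : Word} (hu : step q u = some q') (hv : v ≠ []) :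
    step q (u ++ v) = none := by
  by_contra h
  obtain ⟨q'', h⟩ := Option.ne_none_iff_exists'.1 h
  exact hv (by simpa using step_prefix hu h (List.prefix_append u v))

/-- After a valid entry `u`, no prefix of `v` is valid if `uv` is reduced. -/
theorem step_eq_none_of_redB {q q' : St} {u v v' : Word} (hu : step q u = some q')
    (h : redB (u ++ v) = true) (hv : v' <+: v) : step q' v' = none := by
  by_contra h'
  obtain ⟨q'', h'⟩ := Option.ne_none_iff_exists'.1 h'
  obtain ⟨⟨w, y, rfl, hy⟩, -⟩ := step_step hu h'
  rw [← isReduced_iff] at h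
  refine h _ hy ?_
  obtain ⟨r, rfl⟩ := hv
  exact ⟨w, r, by simp⟩

theorem faceCell_append_left {c t : List Word} (ht : t ≠ []) {i : ℕ} (hi : i < c.length) :
    faceCell (c ++ t) i = faceCell c i ++ t := by
  have hl := List.length_pos_iff.2 ht
  unfold faceCell
  by_cases h0 : i = 0
  · rw [if_pos h0, if_pos h0, List.tail_append_of_ne_nil (by rintro rfl; simp at hi)]
  rw [if_neg h0, if_neg h0, if_neg (by simp; omega), if_neg (by omega),
    List.take_append_of_le_length (by omega), List.drop_append_of_le_length (by omega),
    List.getD_append _ _ _ _ (by omega), List.getD_append _ _ _ _ hi]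
  simp

theorem faceCell_append_mid (p s : List Word) (u v : Word) :
    faceCell (p ++ u :: v :: s) (p.length + 1) = p ++ nf (u ++ v) :: s := by
  unfold faceCell
  rw [if_neg (by omega), if_neg (by simp)]
  rw [show p.length + 1 + 1 = p.length + 2 by omega, List.drop_length_add_append]
  simp [List.getD_eq_getElem?_getD]

theorem faceCell_append_right (c t : List Word) (i : ℕ) (hi : i < t.length) :
    faceCell (c ++ t) (c.length + (i + 1)) = c ++ faceCell t (i + 1) := by
  unfold faceCell
  rw [if_neg (c := c.length + (i + 1) = 0) (by omega), if_neg (c := i + 1 = 0) (by omega)]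
  by_cases h : i + 1 = t.length
  · rw [if_pos (by simp [h]), if_pos h, List.dropLast_append_of_ne_nil (by rintro rfl; simp at hi)]
  · rw [if_neg (by simp [h]), if_neg h,
      List.getD_append_right _ _ _ _ (by omega), List.getD_append_right _ _ _ _ (by omega)]
    have e1 : c.length + (i + 1) - 1 = c.length + i := by omega
    have e2 : c.length + (i + 1) + 1 = c.length + (i + 2) := by omega
    have e3 : c.length + i - c.length = i := by omega
    have e4 : c.length + (i + 1) - c.length = i + 1 := by omega
    rw [e1, e2, e3, e4, List.take_length_add_append, List.drop_length_add_append]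
    simp

/-- One entry distinguishes the tuples. A face further left would give `v = uv`, or an entry equal
to its product with the next, nontrivial entry; a face further right would give `u = uv`. -/
theorem faceCell_ne {p s : List Word} {u v : Word} {m i : ℕ}
    (hx : p ++ u :: v :: s ∈ Morse.cells V (m + 1)) (hi : i ≠ p.length + 1) (him : i ≤ m + 1) :
    faceCell (p ++ u :: v :: s) i ≠ p ++ (u ++ v) :: s := by
  intro h
  rw [mem_cells_iff] at hx
  have hu := (hx.2 u (by simp)).1
  have hv := (hx.2 v (by simp)).1
  have hl := hx.1
  simp at hl
  rcases Nat.lt_or_ge i (p.length + 1) with h1 | h1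
  · rcases i with _ | i
    · have := congr_arg (fun y => y.getD p.length []) h
      simp only [faceCell, if_true] at this
      rw [List.getD_append_right _ _ _ _ le_rfl, Nat.sub_self, List.getD_cons_zero] at this
      have e : (p ++ u :: v :: s).tail.getD p.length [] = v := by
        simp [List.getD_eq_getElem?_getD]
      rw [e] at this
      exact hu (by simpa using this)
    · have hi' : i < p.length := by omega
      have := congr_arg (fun y => y.getD i []) h
      simp only [faceCell] at this
      rw [if_neg (by omega), if_neg (by simp; omega),
        List.getD_append_right _ _ _ _ (by simp), List.getD_append _ _ _ _ hi',
        List.getD_append _ _ _ _ (by omega)] at this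
      have e : i - ((p ++ u :: v :: s).take (i + 1 - 1)).length = 0 := by simp; omega
      rw [e, List.getD_cons_zero, Nat.add_sub_cancel] at this
      set w := (p ++ u :: v :: s).getD (i + 1) [] with hw
      have hwm : w ∈ p ++ u :: v :: s := by
        rw [hw, List.getD_eq_getElem _ _ (by simp; omega)]
        exact List.getElem_mem _
      have h2 := congr_arg grpVal this
      rw [grpVal_nf, grpVal_append, mul_eq_left] at h2
      have h3 := hx.2 w hwm
      exact grpVal_ne_one h3.1 ((isReduced_iff _).2 h3.2) h2
  · have := congr_arg (fun y => y.getD p.length []) h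
    have e : (faceCell (p ++ u :: v :: s) i).getD p.length [] = u := by
      obtain ⟨j, rfl⟩ : ∃ j, i = (p ++ [u]).length + (j + 1) :=
        ⟨i - p.length - 2, by simp; omega⟩
      rw [show p ++ u :: v :: s = (p ++ [u]) ++ v :: s by simp,
        faceCell_append_right _ _ _ (by simp at him ⊢; omega)]
      simp [List.getD_eq_getElem?_getD]
    simp only [e] at this
    rw [List.getD_append_right _ _ _ _ le_rfl, Nat.sub_self, List.getD_cons_zero] at this
    exact hv (by simpa using this)

/-- Only one face contributes, so the coefficient on a matched edge is a sign and in particular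
invertible. -/
theorem inc_of_split {p s : List Word} {u v : Word} {m : ℕ}
    (hx : p ++ u :: v :: s ∈ Morse.cells V (m + 1)) (hy : p ++ (u ++ v) :: s ∈ Morse.cells V m) :
    Morse.inc V k (gen k) (p ++ u :: v :: s) (p ++ (u ++ v) :: s) =
      algebraMap k _ ((-1 : k) ^ (p.length + 1)) := by
  rw [inc_eq k hx hy, Finset.sum_eq_single (p.length + 1)]
  · have : redB (u ++ v) = true := ((mem_cells_iff.1 hy).2 _ (by simp)).2
    rw [faceCell_append_mid, nf_of_redB this, if_pos rfl, faceCoef, if_neg (by omega),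
      if_neg (by simp), lr_nil, Algebra.algebraMap_eq_smul_one]
  · intro i hi h
    rw [if_neg (faceCell_ne hx h (by simp at hi; omega))]
  · intro h
    exfalso; apply h
    have := hx.1
    simp at this ⊢; omega

variable {k} in
theorem cells_of_inc_ne_zero {x y : List Word} (h : Morse.inc V k (gen k) x y ≠ 0) :
    x ∈ Morse.cells V (y.length + 1) ∧ y ∈ Morse.cells V y.length := by
  by_contra h'
  exact h (by rw [Morse.inc, dif_neg h'])

/-- Two of the defining conditions are automatic: the coefficient is a sign by `inc_of_split`, and
`p` is the longest initial chain because `uv` has the admissible proper prefix `u` and so is not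
admissible itself. -/
theorem matched_iff {x y : List Word} : Morse.Matched V k (gen k) x y ↔
    ∃ p s u v q q', y = p ++ (u ++ v) :: s ∧ x = p ++ u :: v :: s ∧ run start p = some q ∧
      step q u = some q' ∧ v ≠ [] ∧ y ∈ Morse.cells V y.length := by
  constructor
  · rintro ⟨h, p, s, u, v, rfl, rfl, hp, hmax, hpu⟩
    have hc := cells_of_inc_ne_zero h
    rw [isChainTuple_iff] at hpu
    obtain ⟨q', hq'⟩ := hpu
    obtain ⟨q, hq, hu⟩ := run_concat hq'
    exact ⟨p, s, u, v, q, q', rfl, rfl, hq, hu, (hc.1.2 v (by simp)).1, hc.2⟩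
  · rintro ⟨p, s, u, v, q, q', rfl, rfl, hq, hu, hv, hy⟩
    have hx : p ++ u :: v :: s ∈ Morse.cells V ((p ++ (u ++ v) :: s).length + 1) := by
      rw [mem_cells_iff] at hy ⊢
      refine ⟨by simp; omega, fun w hw => ?_⟩
      have huv := (hy.2 (u ++ v) (by simp)).2
      rw [List.mem_append, List.mem_cons, List.mem_cons] at hw
      rcases hw with hw | rfl | rfl | hw
      · exact hy.2 w (by simp [hw])
      · exact ⟨step_ne_nil hu, redB_of_step hu⟩
      · exact ⟨hv, redB_of_infix (List.suffix_append _ _).isInfix huv⟩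
      · exact hy.2 w (by simp [hw])
    refine ⟨?_, p, s, u, v, rfl, rfl, (isChainTuple_iff p).2 ⟨q, hq⟩, ?_,
      (isChainTuple_iff _).2 ⟨q', run_concat_of hq hu⟩⟩
    · rw [inc_of_split k hx hy]
      have : Nontrivial (Bar.Env k (Alg k)) := inferInstance
      intro h0
      have := (map_eq_zero_iff _ (algebraMap k (Bar.Env k (Alg k))).injective).1 h0
      simp at this
    · rintro r ⟨t, ht⟩ hr
      by_contra hlt
      rw [isChainTuple_iff] at hr
      obtain ⟨q₂, hr⟩ := hr
      have hpre : p ++ [u ++ v] <+: r := by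
        refine List.prefix_of_prefix_length_le (l₃ := p ++ (u ++ v) :: s) ?_ ⟨t, ht⟩ (by simp; omega)
        exact ⟨s, by simp⟩
      obtain ⟨q₃, h3⟩ := exists_run_of_prefix hr hpre
      obtain ⟨q₄, h4, h5⟩ := run_concat h3
      rw [hq] at h4
      obtain rfl := Option.some.inj h4
      rw [step_append_eq_none hu hv] at h5
      cases h5

variable {k}

/-- The first inadmissible entry of a lower end is `uv`, with an admissible proper prefix; that of
an upper end is `v`, without admissible prefix since `uv` is reduced. As `split_unique` locates this
entry, each end determines the edge and no vertex is both an upper and a lower end. This and the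
next two lemmas show that the matched edges are disjoint. -/
theorem matched_unique_up {x x' y : List Word} (h : Morse.Matched V k (gen k) x y)
    (h' : Morse.Matched V k (gen k) x' y) : x = x' := by
  rw [matched_iff] at h h'
  obtain ⟨p, s, u, v, q, q', rfl, rfl, hp, hu, hv, -⟩ := h
  obtain ⟨p', s', u', v', r, r', e, rfl, hp', hu', hv', -⟩ := h'
  obtain ⟨rfl, e2, rfl⟩ := split_unique e hp (step_append_eq_none hu hv) hp'
    (step_append_eq_none hu' hv')
  rw [hp] at hp'
  obtain rfl := Option.some.inj hp'
  have : u = u' := by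
    rcases List.prefix_or_prefix_of_prefix (List.prefix_append u v)
      (e2 ▸ List.prefix_append u' v') with h | h
    · exact step_prefix hu hu' h
    · exact (step_prefix hu' hu h).symm
  subst this
  rw [List.append_cancel_left e2]

theorem matched_unique_down {x y y' : List Word} (h : Morse.Matched V k (gen k) x y)
    (h' : Morse.Matched V k (gen k) x y') : y = y' := by
  rw [matched_iff] at h h'
  obtain ⟨p, s, u, v, q, q', rfl, rfl, hp, hu, hv, hy⟩ := h
  obtain ⟨p', s', u', v', r, r', rfl, e, hp', hu', hv', hy'⟩ := h'
  have e' : (p ++ [u]) ++ v :: s = (p' ++ [u']) ++ v' :: s' := by simpa using e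
  have r1 := (mem_cells_iff.1 hy).2 (u ++ v) (by simp)
  have r2 := (mem_cells_iff.1 hy').2 (u' ++ v') (by simp)
  obtain ⟨e1, rfl, rfl⟩ := split_unique e' (run_concat_of hp hu)
    (step_eq_none_of_redB hu r1.2 (List.prefix_refl v)) (run_concat_of hp' hu')
    (step_eq_none_of_redB hu' r2.2 (List.prefix_refl v'))
  obtain ⟨rfl, e2⟩ := List.append_inj' e1 rfl
  rw [List.singleton_inj.1 e2]

theorem not_matched_matched {x y z : List Word} (h : Morse.Matched V k (gen k) x y)
    (h' : Morse.Matched V k (gen k) z x) : False := by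
  rw [matched_iff] at h h'
  obtain ⟨p, s, u, v, q, q', rfl, rfl, hp, hu, hv, hy⟩ := h
  obtain ⟨p', s', u', v', r, r', e, rfl, hp', hu', hv', -⟩ := h'
  have e' : (p ++ [u]) ++ v :: s = p' ++ (u' ++ v') :: s' := by simpa using e
  have r1 := (mem_cells_iff.1 hy).2 (u ++ v) (by simp)
  obtain ⟨e1, rfl, rfl⟩ := split_unique e' (run_concat_of hp hu)
    (step_eq_none_of_redB hu r1.2 (List.prefix_refl v)) hp' (step_append_eq_none hu' hv')
  rw [← e1, run_concat_of hp hu] at hp'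
  obtain rfl := Option.some.inj hp'
  rw [step_eq_none_of_redB hu r1.2 (List.prefix_append u' v')] at hu'
  cases hu'

/-- No nonempty prefix of the word is valid in the given state. -/
def deadB : St → Word → Bool
  | _, [] => false
  | start, _ => false
  | inA, a :: _ => false
  | inB, a :: _ => false
  | inB, b :: _ => false
  | inB, c :: a :: _ => false
  | inC, c :: _ => false
  | _, _ => true

theorem step_of_deadB {q : St} {w u : Word} (h : deadB q w = true) (hu : u <+: w) :
    step q u = none := by
  by_contra h'
  obtain ⟨q', h'⟩ := Option.ne_none_iff_exists'.1 h'
  obtain ⟨v, rfl⟩ := hu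
  rcases step_eq_some h' with ⟨rfl, -, h1⟩ | ⟨rfl, -, h1⟩ | ⟨rfl, -, h1⟩ | ⟨rfl, -, h1⟩ <;>
    cases q <;> simp_all [deadB]

/-- A nonempty reduced word that is not valid either has a valid proper prefix or is dead. -/
theorem exists_step_or_deadB {q : St} {w : Word} (hw : w ≠ []) (h : step q w = none) :
    (∃ u v q', w = u ++ v ∧ v ≠ [] ∧ step q u = some q') ∨ deadB q w = true := by
  have key {u v : Word} {q' : St} (e : w = u ++ v) (hu : step q u = some q') :
      ∃ u v q', w = u ++ v ∧ v ≠ [] ∧ step q u = some q' := by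
    refine ⟨u, v, q', e, ?_, hu⟩
    rintro rfl
    rw [List.append_nil] at e
    rw [e, hu] at h
    cases h
  rcases w with _ | ⟨x, w⟩
  · exact absurd rfl hw
  rcases q with _ | _ | _ | _
  · left
    rcases x with _ | _ | _
    · exact key (u := [a]) rfl rfl
    · exact key (u := [b]) rfl rfl
    · exact key (u := [c]) rfl rfl
  · rcases x with _ | _ | _
    · exact Or.inl (key (u := [a]) rfl rfl)
    · exact Or.inr rfl
    · exact Or.inr rfl
  · rcases x with _ | _ | _
    · exact Or.inl (key (u := [a]) rfl rfl)
    · exact Or.inl (key (u := [b]) rfl rfl)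
    · rcases w with _ | ⟨(_ | _ | _), w⟩
      · exact Or.inr rfl
      · exact Or.inl (key (u := [c, a]) rfl rfl)
      · exact Or.inr rfl
      · exact Or.inr rfl
  · rcases x with _ | _ | _
    · exact Or.inr rfl
    · exact Or.inr rfl
    · exact Or.inl (key (u := [c]) rfl rfl)

/-- The converse of `step_eq_none_of_redB`: a dead entry can be glued to the entry before it, which
supplies the lower partner of the vertex. -/
theorem redB_append_of_deadB {q q' : St} {u w : Word} (hu : step q u = some q')
    (hw : redB w = true) (h : deadB q' w = true) : redB (u ++ w) = true := by
  rcases step_eq_some hu with ⟨rfl, rfl, h1⟩ | ⟨rfl, rfl, h1⟩ | ⟨rfl, rfl, h1⟩ | ⟨rfl, rfl, h1⟩ <;>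
    rcases w with _ | ⟨(_ | _ | _), _ | ⟨(_ | _ | _), w⟩⟩ <;>
    simp_all [deadB, redB, headOK]

theorem exists_split_of_run_eq_none {q : St} {x : List Word} (h : run q x = none) :
    ∃ p w s q', x = p ++ w :: s ∧ run q p = some q' ∧ step q' w = none := by
  induction x generalizing q with
  | nil => cases h
  | cons u x ih =>
    cases hu : step q u with
    | none => exact ⟨[], u, x, q, rfl, rfl, hu⟩
    | some q' =>
      rw [run_cons, hu] at h
      obtain ⟨p, w, s, q'', rfl, hp, hw⟩ := ih h
      exact ⟨u :: p, w, s, q'', rfl, by rw [run_cons, hu]; exact hp, hw⟩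

theorem exists_matched_of_deadB {p s : List Word} {w : Word} {q : St} (hp : run start p = some q)
    (hw : deadB q w = true) (hc : p ++ w :: s ∈ Morse.cells V (p ++ w :: s).length) :
    ∃ y, Morse.Matched V k (gen k) (p ++ w :: s) y := by
  rcases List.eq_nil_or_concat' p with rfl | ⟨p', u, rfl⟩
  · obtain rfl := Option.some.inj hp
    rcases w with _ | ⟨_, _⟩ <;> simp [deadB] at hw
  · obtain ⟨q', hq', hu⟩ := run_concat hp
    rw [mem_cells_iff] at hc
    have hw' := hc.2 w (by simp)
    refine ⟨p' ++ (u ++ w) :: s, (matched_iff k).2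
      ⟨p', s, u, w, q', q, rfl, by simp, hq', hu, hw'.1, ?_⟩⟩
    rw [mem_cells_iff]
    refine ⟨rfl, fun v hv => ?_⟩
    rw [List.mem_append, List.mem_cons] at hv
    rcases hv with hv | rfl | hv
    · exact hc.2 v (by simp [hv])
    · exact ⟨by simp [hw'.1], redB_append_of_deadB hu hw'.2 hw⟩
    · exact hc.2 v (by simp [hv])

/-- A tuple that is not accepted has a first inadmissible entry. If this has an admissible proper
prefix, splitting it gives a match above; if it is dead, gluing it to its predecessor gives a match
below. Accepted tuples have no inadmissible entry at all. -/
theorem mem_critical_iff {n : ℕ} {x : List Word} :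
    x ∈ critical k n ↔ x.length = n ∧ ∃ q, run start x = some q := by
  constructor
  · rintro ⟨hx, hm⟩
    refine ⟨hx.1, ?_⟩
    by_contra h
    have h : run start x = none := by
      by_contra h'
      exact h (Option.ne_none_iff_exists'.1 h')
    obtain ⟨p, w, s, q, rfl, hp, hw⟩ := exists_split_of_run_eq_none h
    have hc := mem_cells_iff.1 hx
    have hx' : p ++ w :: s ∈ Morse.cells V (p ++ w :: s).length := by rw [hx.1]; exact hx
    rcases exists_step_or_deadB (hc.2 w (by simp)).1 hw with ⟨u, v, q', rfl, hv, hu⟩ | hd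
    · exact (hm _).2 ((matched_iff k).2 ⟨p, s, u, v, q, q', rfl, rfl, hp, hu, hv, hx'⟩)
    · obtain ⟨y, hy⟩ := exists_matched_of_deadB (k := k) hp hd hx'
      exact (hm y).1 hy
  · rintro ⟨hl, q, hq⟩
    have key {p s : List Word} {w : Word} {q' : St} (e : x = p ++ w :: s)
        (hp : run start p = some q') (hw : step q' w = none) : False := by
      rw [e, run_append, hp, Option.bind_some, run_cons, hw] at hq
      cases hq
    refine ⟨mem_cells_iff.2 ⟨hl, cells_of_run hq⟩, fun y => ⟨fun h => ?_, fun h => ?_⟩⟩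
    · obtain ⟨p, s, u, v, r, r', rfl, rfl, hp, hu, hv, hy⟩ := (matched_iff k).1 h
      have r1 := (mem_cells_iff.1 hy).2 (u ++ v) (by simp)
      exact key (p := p ++ [u]) (s := s) (by simp) (run_concat_of hp hu)
        (step_eq_none_of_redB hu r1.2 (List.prefix_refl v))
    · obtain ⟨p, s, u, v, r, r', rfl, rfl, hp, hu, hv, hy⟩ := (matched_iff k).1 h
      exact key rfl hp (step_append_eq_none hu hv)

theorem critical_eq (m : ℕ) : critical k (m + 1) =
      {pw a (m + 1), pw b (m + 1), pw c (m + 1)} ∪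
      {x | ∃ i j, i + j = m + 1 ∧ 1 ≤ i ∧ 1 ≤ j ∧ (x = ba i j ∨ x = bca i j)} := by
  ext x
  rw [mem_critical_iff, exists_run_iff]

end Matching

end G23

namespace G23
open Letter St

/-! ### Sums over paths -/

section Paths
variable {k : Type*} [Field k]


/-- Vertices from which no critical vertex of degree `n` can be reached. -/
def Low (k : Type*) [Field k] (n : ℕ) (x : List Word) : Prop :=
  x.length < n ∨ (x.length = n ∧ x ∉ critical k n ∧ ∀ z, ¬ Morse.Matched V k (gen k) z x)

theorem length_of_edge {x y : List Word} (h : Morse.Edge V k (gen k) x y) :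
    (x.length = y.length + 1 ∧ ¬ Morse.Matched V k (gen k) x y) ∨ (y.length = x.length + 1 ∧ Morse.Matched V k (gen k) y x) := by
  rcases h with h | h
  · exact Or.inl ⟨(cells_of_inc_ne_zero h.1).1.1, h.2⟩
  · exact Or.inr ⟨(cells_of_inc_ne_zero h.1).1.1, h⟩

/-- An ascent into degree `n` arrives at the upper end of a matched edge. Such a vertex is not
critical and is not a lower end, so the path can only descend again. -/
theorem Low.edge {n : ℕ} {x y : List Word} (hx : Low k n x) (h : Morse.Edge V k (gen k) x y) : Low k n y := by
  rcases length_of_edge h with ⟨hl, -⟩ | ⟨hl, hm⟩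
  · rcases hx with hx | ⟨hx, -⟩ <;> exact Or.inl (by omega)
  · rcases hx with hx | ⟨hx, -, h'⟩
    · rcases Nat.lt_or_ge y.length n with h' | h'
      · exact Or.inl h'
      · exact Or.inr ⟨by omega, fun hc => (hc.2 x).1 hm, fun z hz => not_matched_matched hm hz⟩
    · exact absurd hm (h' y)

theorem Low.not_mem_paths {n : ℕ} {x t : List Word} (hx : Low k n x) (ht : t ∈ critical k n)
    (p : List (List Word)) : p ∉ Morse.paths V k (gen k) x t := by
  induction p generalizing x with
  | nil => rintro ⟨h, -⟩; simp at h
  | cons y p ih =>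
    rintro ⟨h1, h2, h3⟩
    obtain rfl : y = x := by simpa using h1
    rcases p with _ | ⟨z, p⟩
    · obtain rfl : y = t := by simpa using h2
      rcases hx with hx | hx
      · exact absurd ht.1.1 (by omega)
      · exact hx.2.1 ht
    · rw [List.isChain_cons_cons] at h3
      exact ih (hx.edge h3.1) ⟨rfl, by simpa using h2, h3.2⟩

/-- There are finitely many paths from `x` to critical vertices of degree `n`, and the sums of their
weights are the coefficients of `F`. -/
def Ev (k : Type*) [Field k] (n : ℕ) (x : List Word) (F : C k n) : Prop :=
  Morse.FinitePaths V k (gen k) n x ∧ ∀ t : critical k n, Morse.pathSum V k (gen k) x t.1 = F t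

theorem Ev.unique {n : ℕ} {x : List Word} {F F' : C k n} (h : Ev k n x F) (h' : Ev k n x F') :
    F = F' := Finsupp.ext fun t => by rw [← h.2, ← h'.2]

theorem Ev.finite {n : ℕ} {x : List Word} {F : C k n} (h : Ev k n x F) {t : List Word}
    (ht : t ∈ critical k n) : (Morse.paths V k (gen k) x t).Finite :=
  h.1.subset fun _ hp => ⟨t, ht, hp⟩

theorem diff_basisElt {n : ℕ} {x : List Word} {F : C k n} (hx : x ∈ critical k (n + 1))
    (h : Ev k n x F) : d k n (Morse.basisElt V k (gen k) (n + 1) x) = F := by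
  rw [Morse.basisElt, dif_pos hx]
  simp only [d, Morse.diff, Finsupp.linearCombination_single, one_smul, h.2]
  rw [finsum_eq_sum_of_support_subset (s := F.support)]
  · exact F.sum_single
  · intro t ht
    by_contra h'
    simp at h'
    simp [h'] at ht

theorem pathSum_eq (x t : List Word) : Morse.pathSum V k (gen k) x t =
    ∑ᶠ p ∈ Morse.paths V k (gen k) x t, Morse.pathWeight V k (gen k) p :=
  finsum_set_coe_eq_finsum_mem (f := Morse.pathWeight V k (gen k)) (Morse.paths V k (gen k) x t)

theorem Low.ev {n : ℕ} {x : List Word} (h : Low k n x) : Ev k n x 0 := by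
  refine ⟨?_, fun t => ?_⟩
  · refine Set.finite_empty.subset ?_
    rintro p ⟨t, ht, hp⟩
    exact h.not_mem_paths ht p hp
  · have : Morse.paths V k (gen k) x t.1 = ∅ :=
      Set.eq_empty_iff_forall_notMem.2 fun p => h.not_mem_paths t.2 p
    rw [pathSum_eq, this, finsum_mem_empty]
    rfl

/-- No matched edge starts or ends at a critical vertex, so every edge leads down to degree `n - 1`,
whence there is no return; only the trivial path remains. -/
theorem ev_critical {n : ℕ} {x : List Word} (hx : x ∈ critical k n) :
    Ev k n x (Morse.basisElt V k (gen k) n x) := by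
  have key : ∀ t ∈ critical k n, ∀ p ∈ Morse.paths V k (gen k) x t, p = [x] ∧ t = x := by
    rintro t ht p ⟨h1, h2, h3⟩
    rcases p with _ | ⟨y, _ | ⟨z, p⟩⟩
    · simp at h1
    · obtain rfl : y = x := by simpa using h1
      exact ⟨rfl, by simpa using h2.symm⟩
    · obtain rfl : y = x := by simpa using h1
      rw [List.isChain_cons_cons] at h3
      have hz : Low k n z := by
        rcases length_of_edge h3.1 with ⟨hl, -⟩ | ⟨-, hm⟩
        · exact Or.inl (by rw [hx.1.1] at hl; omega)
        · exact absurd hm (hx.2 z).2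
      exact absurd ⟨rfl, by simpa using h2, h3.2⟩ (hz.not_mem_paths ht (z :: p))
  refine ⟨(Set.finite_singleton [x]).subset ?_, fun t => ?_⟩
  · rintro p ⟨t, ht, hp⟩
    exact (key t ht p hp).1
  · rw [pathSum_eq, Morse.basisElt, dif_pos hx]
    by_cases h : t = ⟨x, hx⟩
    · subst h
      have : Morse.paths V k (gen k) x x = {[x]} := by
        ext p
        constructor
        · exact fun hp => (key x hx p hp).1
        · rintro rfl
          exact ⟨rfl, rfl, by simp⟩
      rw [this, finsum_mem_singleton, Finsupp.single_eq_same]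
      rfl
    · have : Morse.paths V k (gen k) x t.1 = ∅ :=
        Set.eq_empty_iff_forall_notMem.2 fun p hp => h (Subtype.ext (key t.1 t.2 p hp).2)
      rw [this, finsum_mem_empty, Finsupp.single_eq_of_ne h]

-- The paths from `y` are those from its successors with `y` put in front, and these sets are
-- disjoint. Finiteness is carried along with the value, so it is obtained by the same recursion as
-- the formulas.
open Classical in
theorem ev_step {n : ℕ} {y : List Word} (hy : y ∉ critical k n) (Z : Finset (List Word))
    (F : List Word → C k n) (hZ : ∀ z, Morse.Edge V k (gen k) y z → z ∈ Z ∨ Low k n z)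
    (hF : ∀ z ∈ Z, Morse.Edge V k (gen k) y z → Ev k n z (F z)) :
    Ev k n y (∑ z ∈ Z.filter (Morse.Edge V k (gen k) y), Morse.weight V k (gen k) y z • F z) := by
  have hpaths : ∀ t ∈ critical k n, Morse.paths V k (gen k) y t =
      ⋃ z ∈ (↑(Z.filter (Morse.Edge V k (gen k) y)) : Set (List Word)),
        List.cons y '' Morse.paths V k (gen k) z t := by
    intro t ht
    ext p
    simp only [Set.mem_iUnion, Set.mem_image, Finset.mem_coe, Finset.mem_filter, exists_prop]
    constructor
    · rintro ⟨h1, h2, h3⟩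
      rcases p with _ | ⟨x, _ | ⟨z, p⟩⟩
      · simp at h1
      · obtain rfl : x = y := by simpa using h1
        obtain rfl : x = t := by simpa using h2
        exact absurd ht hy
      · obtain rfl : x = y := by simpa using h1
        rw [List.isChain_cons_cons] at h3
        have hp : z :: p ∈ Morse.paths V k (gen k) z t := ⟨rfl, by simpa using h2, h3.2⟩
        refine ⟨z, ⟨?_, h3.1⟩, z :: p, hp, rfl⟩
        rcases hZ z h3.1 with h | h
        · exact h
        · exact absurd hp (h.not_mem_paths ht _)
    · rintro ⟨z, ⟨-, hz⟩, p, ⟨h1, h2, h3⟩, rfl⟩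
      rcases p with _ | ⟨x, p⟩
      · simp at h1
      · obtain rfl : x = z := by simpa using h1
        exact ⟨rfl, by simpa using h2, by rw [List.isChain_cons_cons]; exact ⟨hz, h3⟩⟩
  have hfin : ∀ z ∈ (↑(Z.filter (Morse.Edge V k (gen k) y)) : Set (List Word)), Ev k n z (F z) := by
    intro z hz
    simp only [Finset.coe_filter, Set.mem_ofPred_eq] at hz
    exact hF z hz.1 hz.2
  refine ⟨?_, fun t => ?_⟩
  · have : {p | ∃ t ∈ critical k n, p ∈ Morse.paths V k (gen k) y t} ⊆
        ⋃ z ∈ (↑(Z.filter (Morse.Edge V k (gen k) y)) : Set (List Word)),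
          List.cons y '' {p | ∃ t ∈ critical k n, p ∈ Morse.paths V k (gen k) z t} := by
      rintro p ⟨t, ht, hp⟩
      rw [hpaths t ht] at hp
      simp only [Set.mem_iUnion, exists_prop] at hp ⊢
      obtain ⟨z, hz, q, hq, rfl⟩ := hp
      exact ⟨z, hz, q, ⟨t, ht, hq⟩, rfl⟩
    refine Set.Finite.subset ?_ this
    exact Set.Finite.biUnion (Finset.finite_toSet _) fun z hz => (hfin z hz).1.image _
  · rw [pathSum_eq, hpaths t.1 t.2, finsum_mem_biUnion]
    · rw [finsum_mem_coe_finset, Finsupp.finsetSum_apply]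
      refine Finset.sum_congr rfl fun z hz => ?_
      have hE := hfin z hz
      rw [finsum_mem_image (fun p _ q _ h => (List.cons.inj h).2), Finsupp.smul_apply, smul_eq_mul,
        ← hE.2 t, pathSum_eq, mul_finsum_mem' _ _ (hE.finite t.2)]
      refine finsum_mem_congr rfl fun p hp => ?_
      rcases p with _ | ⟨x, p⟩
      · have := hp.1
        simp at this
      · have := hp.1
        obtain rfl : x = z := by simpa using this
        simp [Morse.pathWeight]
    · intro z _ z' _ hne
      rw [Function.onFun, Set.disjoint_left]
      rintro _ ⟨p, hp, rfl⟩ ⟨p', hp', he⟩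
      obtain rfl : p' = p := (List.cons.inj he).2
      have h1 := hp.1
      rw [hp'.1] at h1
      exact hne (Option.some.inj h1).symm
    · exact Finset.finite_toSet _
    · exact fun z hz => ((hfin z hz).finite t.2).image _

/-- As `Ev`, for tuples which may have an empty entry and then stand for `0`. -/
def Ev0 (k : Type*) [Field k] (n : ℕ) (x : List Word) (F : C k n) : Prop :=
  ([] ∈ x ∧ F = 0) ∨ ([] ∉ x ∧ Ev k n x F)

open Classical in
/-- The paths from a vertex of degree `n + 1` continue to its unmatched faces. -/
theorem ev_faces {n : ℕ} {x : List Word} (hx : x ∈ Morse.cells V (n + 1)) (hup : ∀ z, ¬ Morse.Matched V k (gen k) z x)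
    (F : ℕ → C k n)
    (hF : ∀ i < n + 2, ¬ Morse.Matched V k (gen k) x (faceCell x i) → Ev0 k n (faceCell x i) (F i)) :
    Ev k n x (∑ i ∈ (Finset.range (n + 2)).filter (fun i => ¬ Morse.Matched V k (gen k) x (faceCell x i)),
      faceCoef k x i • F i) := by
  have hedge : ∀ z, Morse.Edge V k (gen k) x z ↔ z ∈ Morse.cells V n ∧ Morse.inc V k (gen k) x z ≠ 0 ∧ ¬ Morse.Matched V k (gen k) x z := by
    intro z
    constructor
    · rintro (h | h)
      · have := cells_of_inc_ne_zero h.1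
        have hl : z.length = n := by
          have := this.1.1
          rw [hx.1] at this; omega
        rw [hl] at this
        exact ⟨this.2, h⟩
      · exact absurd h (hup z)
    · rintro ⟨-, h⟩
      exact Or.inl h
  -- The values are given per face, but edges lead to vertices, and faces may coincide. By
  -- `Ev.unique` the value depends on the vertex only, so the sum can be regrouped.
  let G : List Word → C k n := fun z => if h : ∃ F, Ev k n z F then h.choose else 0
  have hG : ∀ {z F}, Ev k n z F → G z = F := by
    intro z F h
    have : ∃ F, Ev k n z F := ⟨F, h⟩
    simp only [G, dif_pos this]
    exact this.choose_spec.unique h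
  let Z := (Finset.range (n + 2)).image (faceCell x)
  have hZ : ∀ z, Morse.Edge V k (gen k) x z → z ∈ Z := by
    intro z h
    obtain ⟨hz, h1, -⟩ := (hedge z).1 h
    rw [inc_eq k hx hz] at h1
    obtain ⟨i, hi, h2⟩ := Finset.exists_ne_zero_of_sum_ne_zero h1
    have : faceCell x i = z := by
      by_contra h3
      rw [if_neg h3] at h2
      exact h2 rfl
    exact Finset.mem_image.2 ⟨i, hi, this⟩
  have hx' : x ∉ critical k n := fun h => by
    have h1 := h.1.1
    have h2 := hx.1
    omega
  have hEv := ev_step hx' Z G (fun z h => Or.inl (hZ z h)) (fun z hz h => by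
    obtain ⟨i, hi, rfl⟩ := Finset.mem_image.1 hz
    obtain ⟨h1, -, h3⟩ := (hedge _).1 h
    rcases hF i (Finset.mem_range.1 hi) h3 with h4 | h4
    · exact absurd rfl (h1.2 _ h4.1).1
    · rw [hG h4.2]; exact h4.2)
  convert hEv using 1
  calc ∑ i ∈ (Finset.range (n + 2)).filter (fun i => ¬ Morse.Matched V k (gen k) x (faceCell x i)), faceCoef k x i • F i
      = ∑ i ∈ Finset.range (n + 2), if faceCell x i ∈ Morse.cells V n ∧ ¬ Morse.Matched V k (gen k) x (faceCell x i) then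
          faceCoef k x i • G (faceCell x i) else 0 := by
        rw [Finset.sum_filter]
        refine Finset.sum_congr rfl fun i hi => ?_
        by_cases hm : Morse.Matched V k (gen k) x (faceCell x i)
        · rw [if_neg (not_not.2 hm), if_neg fun h => h.2 hm]
        rw [if_pos hm]
        rcases hF i (Finset.mem_range.1 hi) hm with h | h
        · rw [h.2, smul_zero, if_neg fun h' => (h'.1.2 _ h.1).1 rfl]
        · rw [if_pos ⟨faceCell_mem hx (by simp at hi; omega) h.1, hm⟩, hG h.2]
    _ = ∑ z ∈ Z, ∑ i ∈ Finset.range (n + 2), if faceCell x i = z then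
          if z ∈ Morse.cells V n ∧ ¬ Morse.Matched V k (gen k) x z then faceCoef k x i • G z else 0 else 0 := by
        rw [Finset.sum_comm]
        refine Finset.sum_congr rfl fun i hi => ?_
        rw [Finset.sum_ite_eq, if_pos (Finset.mem_image_of_mem _ hi)]
    _ = ∑ z ∈ Z.filter (Morse.Edge V k (gen k) x), Morse.inc V k (gen k) x z • G z := by
        rw [Finset.sum_filter]
        refine Finset.sum_congr rfl fun z hz => ?_
        by_cases hc : z ∈ Morse.cells V n ∧ ¬ Morse.Matched V k (gen k) x z
        · simp only [if_pos hc]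
          have : (if Morse.Edge V k (gen k) x z then Morse.inc V k (gen k) x z • G z else 0) =
              Morse.inc V k (gen k) x z • G z := by
            split_ifs with he
            · rfl
            · have : Morse.inc V k (gen k) x z = 0 := by
                by_contra h0
                exact he ((hedge z).2 ⟨hc.1, h0, hc.2⟩)
              rw [this]
              exact (zero_smul (Bar.Env k (Alg k)) (G z)).symm
          rw [this, inc_eq k hx hc.1, Finset.sum_smul]
          refine Finset.sum_congr rfl fun i _ => ?_
          split_ifs
          · rfl
          · exact (zero_smul (Bar.Env k (Alg k)) (G z)).symm
        · simp only [if_neg hc, ite_self, Finset.sum_const_zero]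
          rw [if_neg fun h => hc ⟨((hedge z).1 h).1, ((hedge z).1 h).2.2⟩]
    _ = _ := by
        refine Finset.sum_congr rfl fun z hz => ?_
        rw [Morse.weight, if_neg (hup z)]

end Paths

end G23

namespace G23
open Letter St

/-! ### Rules for evaluating the sums over paths -/

section Rules
variable {k : Type*} [Field k]

/-- The vertices with an invalid entry that has no valid prefix contribute nothing. -/
theorem ev0_of_deadB {n : ℕ} {p s : List Word} {w : Word} {q : St} (hp : run start p = some q)
    (hw : deadB q w = true) (hl : (p ++ w :: s).length = n)
    (hr : ∀ v ∈ p ++ w :: s, redB v = true) : Ev0 k n (p ++ w :: s) 0 := by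
  by_cases h : [] ∈ p ++ w :: s
  · exact Or.inl ⟨h, rfl⟩
  refine Or.inr ⟨h, Low.ev (Or.inr ⟨hl, ?_, ?_⟩)⟩
  · rw [mem_critical_iff, run_append, hp, Option.bind_some, run_cons,
      step_of_deadB hw (List.prefix_refl w)]
    simp
  · intro z hz
    have hc : p ++ w :: s ∈ Morse.cells V (p ++ w :: s).length :=
      mem_cells_iff.2 ⟨rfl, fun v hv => ⟨fun h' => h (h' ▸ hv), hr v hv⟩⟩
    obtain ⟨y, hy⟩ := exists_matched_of_deadB (k := k) hp hw hc
    exact not_matched_matched hy hz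

theorem ev0_of_run {n : ℕ} {x : List Word} {q : St} (h : run start x = some q)
    (hl : x.length = n) : Ev0 k n x (Morse.basisElt V k (gen k) n x) :=
  Or.inr ⟨fun h' => (cells_of_run h _ h').1 rfl, ev_critical (mem_critical_iff.2 ⟨hl, q, h⟩)⟩

/-- `G` is the contribution of the faces inside the initial part `c` of the vertex `c ++ t`. -/
def LeftEv (k : Type*) [Field k] (n : ℕ) (c t : List Word) (G : C k n) : Prop :=
  ∃ F : ℕ → C k n, (∀ i < c.length, Ev0 k n (faceCell c i ++ t) (F i)) ∧
    G = lr k (c.getD 0 []) [] • F 0 + ∑ i ∈ Finset.range (c.length - 1), (-1 : k) ^ (i + 1) • F (i + 1)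

theorem faceCoef_of_lt {x : List Word} {i : ℕ} (hi : i < x.length) :
    faceCoef k x i = (-1 : k) ^ i • lr k (if i = 0 then x.getD 0 [] else []) [] := by
  rw [faceCoef, if_neg (c := i = x.length) (by omega)]

theorem sum_faceCoef (c : List Word) (hc : c ≠ []) (t : List Word) {n : ℕ} (F : ℕ → C k n) (ht : t ≠ []) :
    ∑ i ∈ Finset.range c.length, faceCoef k (c ++ t) i • F i =
      lr k (c.getD 0 []) [] • F 0 + ∑ i ∈ Finset.range (c.length - 1), (-1 : k) ^ (i + 1) • F (i + 1) := by
  have h1 := List.length_pos_iff.2 hc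
  have h2 := List.length_pos_iff.2 ht
  obtain ⟨m, hm⟩ : ∃ m, c.length = m + 1 := ⟨c.length - 1, by omega⟩
  rw [hm, Finset.sum_range_succ', add_comm, Nat.add_sub_cancel]
  congr 1
  · rw [faceCoef_of_lt (by simp; omega), if_pos rfl, pow_zero, one_smul,
      List.getD_append _ _ _ _ h1]
  · refine Finset.sum_congr rfl fun i hi => ?_
    have := Finset.mem_range.1 hi
    rw [faceCoef_of_lt (by simp; omega), if_neg (by omega), lr_nil, smul_assoc, one_smul]

theorem ringInverse_algebraMap {A : Type*} [Ring A] [Algebra k A] {x : k} (hx : x ≠ 0) :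
    Ring.inverse (algebraMap k A x) = algebraMap k A x⁻¹ := by
  have := Ring.inverse_unit (Units.map (algebraMap k A).toMonoidHom (Units.mk0 x hx))
  simpa using this

/-- The contribution of a matched vertex `[p | uv | s]`. -/
theorem ev_up {n : ℕ} {p s : List Word} {u v : Word} {q q' : St}
    (hl : (p ++ (u ++ v) :: s).length = n) (hp : run start p = some q) (hu : step q u = some q')
    (hv : v ≠ []) (huv : redB (u ++ v) = true) (hs : ∀ w ∈ s, w ≠ [] ∧ redB w = true)
    {R G : C k n} (hR : s = [] → R = lr k [] v • Morse.basisElt V k (gen k) n (p ++ [u]))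
    (hR' : ∀ s₁ s', s = s₁ :: s' → Ev0 k n (p ++ u :: nf (v ++ s₁) :: s') R)
    (hG : LeftEv k n (p ++ [u]) (v :: s) G) :
    Ev0 k n (p ++ (u ++ v) :: s) (R + (-1 : k) ^ p.length • G) := by
  classical
  -- The ascent to `x = [p | u | v | s]` has weight `(-1)^p.length`. Among the faces of `x`, those
  -- inside `[p | u]` give `G`, the matched one is excluded, the next one gives `R` with sign
  -- `(-1)^p.length`, so that its signs cancel, and those further right vanish.
  obtain ⟨F, hF, rfl⟩ := hG
  have hy : p ++ (u ++ v) :: s ∈ Morse.cells V (p ++ (u ++ v) :: s).length := by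
    refine mem_cells_iff.2 ⟨rfl, fun w hw => ?_⟩
    rw [List.mem_append, List.mem_cons] at hw
    rcases hw with hw | rfl | hw
    · exact cells_of_run hp w hw
    · exact ⟨by simp [hv], huv⟩
    · exact hs w hw
  have hm : Morse.Matched V k (gen k) (p ++ u :: v :: s) (p ++ (u ++ v) :: s) :=
    (matched_iff k).2 ⟨p, s, u, v, q, q', rfl, rfl, hp, hu, hv, hy⟩
  have hx := (cells_of_inc_ne_zero hm.1).1
  rw [hl] at hx hy
  have hnil : [] ∉ p ++ (u ++ v) :: s := fun h => (hy.2 _ h).1 rfl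
  refine Or.inr ⟨hnil, ?_⟩
  set x := p ++ u :: v :: s with hxdef
  set y := p ++ (u ++ v) :: s with hydef
  have hln : p.length + 1 + s.length = n := by simp [hydef] at hl; omega
  have hmi : ∀ i < n + 2, (Morse.Matched V k (gen k) x (faceCell x i) ↔ i = p.length + 1) := by
    intro i hi
    constructor
    · intro h
      by_contra hne
      exact faceCell_ne hx hne (by omega) (matched_unique_down hm h).symm
    · rintro rfl
      rw [hxdef, faceCell_append_mid, nf_of_redB huv]
      exact hm
  -- For empty `s` the face after the matched one deletes `v`, which moves into the coefficient; the
  -- value stored for the face itself must then be the bare basis element.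
  set Rc : C k n := if s = [] then Morse.basisElt V k (gen k) n (p ++ [u]) else R with hRc
  let F' : ℕ → C k n := fun i => if i ≤ p.length then F i else if i = p.length + 2 then Rc else 0
  have hxc : x = (p ++ [u]) ++ v :: s := by simp [hxdef]
  have hdead : deadB q' v = true := by
    rcases exists_step_or_deadB hv (step_eq_none_of_redB hu huv (List.prefix_refl v)) with
      ⟨u', v', q'', rfl, -, h⟩ | h
    · rw [step_eq_none_of_redB hu huv (List.prefix_append u' v')] at h
      cases h
    · exact h
  have hEx := ev_faces hx (fun z hz => not_matched_matched hm hz) F' (fun i hi hni => by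
    rw [hmi i hi] at hni
    by_cases h1 : i ≤ p.length
    · simp only [F', if_pos h1]
      rw [hxc, faceCell_append_left (by simp) (by simp; omega)]
      exact hF i (by simp; omega)
    simp only [F', if_neg h1]
    by_cases h2 : i = p.length + 2
    · rw [if_pos h2, hxc, h2, show p.length + 2 = (p ++ [u]).length + (0 + 1) by simp,
        faceCell_append_right _ _ _ (by simp)]
      rcases s with _ | ⟨s₁, s'⟩
      · rw [hRc, if_pos rfl]
        simp only [faceCell, List.length_singleton, zero_add, if_true]
        rw [if_neg (by omega)]
        simp only [List.dropLast_singleton, List.append_nil]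
        exact ev0_of_run (run_concat_of hp hu) (by simpa using hln)
      · rw [hRc, if_neg (by simp)]
        have e : faceCell (v :: s₁ :: s') (0 + 1) = nf (v ++ s₁) :: s' :=
          faceCell_append_mid [] s' v s₁
        rw [e]
        simpa using hR' s₁ s' rfl
    -- These faces leave the dead entry `v` in place.
    · rw [if_neg h2]
      obtain ⟨j, rfl⟩ : ∃ j, i = (p ++ [u] ++ [v]).length + (j + 1) :=
        ⟨i - p.length - 3, by simp; omega⟩
      have hc := hxc
      rw [show p ++ [u] ++ v :: s = (p ++ [u] ++ [v]) ++ s by simp] at hc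
      have hj : j < s.length := by simp at hi; omega
      have e : faceCell x ((p ++ [u] ++ [v]).length + (j + 1)) =
          (p ++ [u]) ++ v :: faceCell s (j + 1) := by
        rw [hc, faceCell_append_right _ _ _ hj]; simp
      have hlen := faceCell_length hx.1 (i := (p ++ [u] ++ [v]).length + (j + 1)) (by omega)
      by_cases hn : [] ∈ faceCell x ((p ++ [u] ++ [v]).length + (j + 1))
      · exact Or.inl ⟨hn, rfl⟩
      have hcell := faceCell_mem hx (by omega) hn
      rw [e] at hlen hcell ⊢
      exact ev0_of_deadB (run_concat_of hp hu) hdead hlen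
        (fun w hw => ((mem_cells_iff.1 hcell).2 w hw).2))
  have hw : Morse.weight V k (gen k) y x = algebraMap k _ ((-1 : k) ^ p.length) := by
    rw [Morse.weight, if_pos hm, inc_of_split k hx hy, ringInverse_algebraMap (by simp), ← map_neg]
    congr 1
    rcases neg_one_pow_eq_or k p.length with h | h <;> simp [pow_succ, h]
  have hEy := ev_step (k := k) (n := n) (y := y) (fun h => (h.2 x).2 hm) {x}
    (fun _ => ∑ i ∈ (Finset.range (n + 2)).filter
      (fun i => ¬ Morse.Matched V k (gen k) x (faceCell x i)), faceCoef k x i • F' i)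
    (fun z hz => by
      rcases length_of_edge hz with ⟨h, -⟩ | ⟨-, h⟩
      · exact Or.inr (Or.inl (by omega))
      · exact Or.inl (by rw [matched_unique_up h hm]; simp))
    (fun z hz _ => by rw [Finset.mem_singleton.1 hz]; exact hEx)
  have hE : Morse.Edge V k (gen k) y x := Or.inr hm
  rw [Finset.filter_singleton, if_pos hE, Finset.sum_singleton, hw] at hEy
  convert hEy using 1
  rw [algebraMap_smul]
  have hsum : ∑ i ∈ (Finset.range (n + 2)).filter
      (fun i => ¬ Morse.Matched V k (gen k) x (faceCell x i)), faceCoef k x i • F' i =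
      ∑ i ∈ Finset.range (p.length + 1), faceCoef k x i • F' i +
        faceCoef k x (p.length + 2) • F' (p.length + 2) := by
    rw [← Finset.sum_singleton (fun i => faceCoef k x i • F' i) (p.length + 2),
      ← Finset.sum_union (by simp)]
    symm
    apply Finset.sum_subset
    · intro i hi
      simp only [Finset.mem_union, Finset.mem_range, Finset.mem_singleton] at hi
      rw [Finset.mem_filter, Finset.mem_range]
      refine ⟨by omega, ?_⟩
      rw [hmi i (by omega)]
      omega
    · intro i hi hi'
      rw [Finset.mem_filter, Finset.mem_range] at hi
      have h1 := hi.2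
      rw [hmi i hi.1] at h1
      simp only [Finset.mem_union, Finset.mem_range, Finset.mem_singleton] at hi'
      simp only [F']
      rw [if_neg (by omega), if_neg (by omega), smul_zero]
  have hleft : ∑ i ∈ Finset.range (p.length + 1), faceCoef k x i • F' i =
      ∑ i ∈ Finset.range (p ++ [u]).length, faceCoef k (p ++ [u] ++ v :: s) i • F i := by
    rw [← hxc]
    simp only [List.length_append, List.length_singleton]
    refine Finset.sum_congr rfl fun i hi => ?_
    have := Finset.mem_range.1 hi
    simp only [F']
    rw [if_pos (by omega)]
  have hright : faceCoef k x (p.length + 2) • F' (p.length + 2) = (-1 : k) ^ p.length • R := by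
    simp only [F']
    rw [if_neg (by omega), if_true, hRc, faceCoef, if_neg (by omega)]
    rw [pow_add, neg_one_sq, mul_one]
    split_ifs with h1 h2 h2
    · rw [hR h2, smul_assoc]
      congr 3
      simp [hxdef, h2]
    · exfalso; apply h2
      simp [hxdef] at h1
      exact h1
    · exfalso; apply h1
      simp [hxdef, h2]
    · rw [lr_nil, smul_assoc, one_smul]
  rw [hsum, hleft, hright, sum_faceCoef _ (by simp) _ F (by simp)]
  generalize lr k ((p ++ [u]).getD 0 []) [] • F 0 + _ = G
  rw [smul_add, smul_smul, ← mul_pow, add_comm]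
  simp only [neg_mul, one_mul, neg_neg, one_pow, one_smul]

/-- The differential of a critical vertex. -/
theorem ev_walk {n : ℕ} {x : List Word} {q : St} (hx : run start x = some q)
    (hl : x.length = n + 1) {G L : C k n} (hG : LeftEv k n x [] G) (hL : Ev0 k n x.dropLast L) :
    Ev k n x (G + (-1 : k) ^ (n + 1) • lr k [] (x.getD n []) • L) := by
  classical
  obtain ⟨F, hF, rfl⟩ := hG
  have hc : x ∈ critical k (n + 1) := mem_critical_iff.2 ⟨hl, q, hx⟩
  let F' : ℕ → C k n := fun i => if i < n + 1 then F i else L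
  have h := ev_faces hc.1 (fun z => (hc.2 z).2) F' (fun i hi _ => by
    by_cases h1 : i < n + 1
    · simp only [F', if_pos h1]
      simpa using hF i (by omega)
    · simp only [F', if_neg h1]
      rw [faceCell, if_neg (by omega), if_pos (by omega)]
      exact hL)
  convert h using 1
  rw [Finset.filter_true_of_mem (fun i _ => (hc.2 _).1), Finset.sum_range_succ]
  congr 1
  · rw [Finset.sum_range_succ', add_comm, hl, Nat.add_sub_cancel]
    congr 1
    · refine Finset.sum_congr rfl fun i hi => ?_
      have := Finset.mem_range.1 hi
      simp only [F']
      rw [faceCoef_of_lt (by omega), if_neg (by omega), if_pos (by omega), lr_nil, smul_assoc,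
        one_smul]
    · simp only [F']
      rw [faceCoef_of_lt (by omega), if_pos rfl, if_pos (by omega), pow_zero, one_smul]
  · simp only [F']
    rw [faceCoef, if_neg (by omega), if_pos hl.symm, if_neg (by omega), hl, Nat.add_sub_cancel,
      smul_assoc]

end Rules

end G23

namespace G23
open Letter St

/-! ### Faces of the critical tuples -/

section Shapes
variable {k : Type*} [Field k]

theorem nil_mem_faceCell_pw (e : Letter) {l i : ℕ} (hi : i < l) :
    [] ∈ faceCell (pw e (l + 1)) (i + 1) := by
  have h : pw e (l + 1) = pw e i ++ [e] :: [e] :: pw e (l - 1 - i) := by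
    simp only [pw]
    rw [← List.replicate_succ, ← List.replicate_succ, List.replicate_append_replicate]
    congr 1
    omega
  have h2 : faceCell (pw e (l + 1)) (i + 1) = pw e i ++ nf ([e] ++ [e]) :: pw e (l - 1 - i) := by
    have := faceCell_append_mid (pw e i) (pw e (l - 1 - i)) [e] [e]
    rwa [← h, show (pw e i).length = i by simp [pw]] at this
  have : nf ([e] ++ [e]) = [] := by cases e <;> decide
  rw [h2, this]
  simp

/-- Every inner face contains `e·e = 1` and vanishes; only the deletion of the first entry survives.
-/
theorem leftEv_pw {n : ℕ} (e : Letter) (l : ℕ) {t : List Word} {F₀ : C k n}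
    (h : Ev0 k n (pw e l ++ t) F₀) : LeftEv k n (pw e (l + 1)) t (lr k [e] [] • F₀) := by
  refine ⟨fun i => if i = 0 then F₀ else 0, fun i hi => ?_, ?_⟩
  · rcases i with _ | i
    · exact h
    · exact Or.inl ⟨List.mem_append_left _ (nil_mem_faceCell_pw e (by simpa [pw] using hi)), rfl⟩
  · simp [pw]

/-- The products `b·b` and `a·a` are trivial, so beside the deletion of the first `b` only the face
with `b·a = cabc` remains. -/
theorem leftEv_ba {n : ℕ} (i j : ℕ) {t : List Word} {F₀ F₁ : C k n}
    (h₀ : Ev0 k n (ba i (j + 1) ++ t) F₀)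
    (h₁ : Ev0 k n (pw b i ++ [c, a, b, c] :: (pw a j ++ t)) F₁) :
    LeftEv k n (ba (i + 1) (j + 1)) t (lr k [b] [] • F₀ + (-1 : k) ^ (i + 1) • F₁) := by
  have hpw (e : Letter) (m : ℕ) : (pw e m).length = m := by simp [pw]
  have hba : ba (i + 1) (j + 1) = pw b (i + 1) ++ pw a (j + 1) := rfl
  refine ⟨fun m => if m = 0 then F₀ else if m = i + 1 then F₁ else 0, fun m hm => ?_, ?_⟩
  · rcases m with _ | m
    · exact h₀
    rw [hba, List.length_append, hpw, hpw] at hm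
    simp only [Nat.add_eq_zero_iff, one_ne_zero, and_false, if_false]
    rcases lt_trichotomy m i with h | rfl | h
    · rw [if_neg (by omega)]
      refine Or.inl ⟨List.mem_append_left _ ?_, rfl⟩
      rw [hba, faceCell_append_left (by simp [pw]) (by rw [hpw]; omega)]
      exact List.mem_append_left _ (nil_mem_faceCell_pw b h)
    · rw [if_pos rfl]
      have e1 : ba (m + 1) (j + 1) = pw b m ++ [b] :: [a] :: pw a j := by
        rw [hba]
        simp only [pw]
        rw [List.replicate_succ', List.replicate_succ, List.append_assoc]; rfl
      have e2 := faceCell_append_mid (pw b m) (pw a j) [b] [a]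
      rw [hpw, ← e1, show nf ([b] ++ [a]) = [c, a, b, c] by decide] at e2
      rw [e2]
      simpa using h₁
    · rw [if_neg (by omega)]
      refine Or.inl ⟨List.mem_append_left _ ?_, rfl⟩
      obtain ⟨m', rfl⟩ : ∃ m', m = i + 1 + m' := ⟨m - i - 1, by omega⟩
      have e2 := faceCell_append_right (pw b (i + 1)) (pw a (j + 1)) m' (by rw [hpw]; omega)
      rw [hpw, ← add_assoc, ← hba] at e2
      rw [e2]
      exact List.mem_append_right _ (nil_mem_faceCell_pw a (by omega))
  · have hl : (ba (i + 1) (j + 1)).length - 1 = i + 1 + j := by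
      rw [hba, List.length_append, hpw, hpw]; omega
    rw [hl, Finset.sum_eq_single i]
    · simp [ba, List.replicate_succ]
    · intro m _ hm
      beta_reduce
      rw [if_neg (by omega), if_neg (by omega), smul_zero]
    · intro h
      simp at h; omega

/-- As for `leftEv_ba`, now with `b·ca = acb`. There is one more nonzero face, with `ca·a = c`; its
contribution is zero by `h₂`, since `c` is dead after `b`. -/
theorem leftEv_bca {n : ℕ} (i j : ℕ) {t : List Word} {F₀ F₁ : C k n}
    (h₀ : Ev0 k n (bca i (j + 1) ++ t) F₀)
    (h₁ : Ev0 k n (pw b i ++ [a, c, b] :: (pw a j ++ t)) F₁)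
    (h₂ : ∀ j', j = j' + 1 → Ev0 k n (pw b (i + 1) ++ [c] :: (pw a j' ++ t)) 0) :
    LeftEv k n (bca (i + 1) (j + 1)) t (lr k [b] [] • F₀ + (-1 : k) ^ (i + 1) • F₁) := by
  have hpw (e : Letter) (m : ℕ) : (pw e m).length = m := by simp [pw]
  have hba : bca (i + 1) (j + 1) = pw b (i + 1) ++ [c, a] :: pw a j := rfl
  refine ⟨fun m => if m = 0 then F₀ else if m = i + 1 then F₁ else 0, fun m hm => ?_, ?_⟩
  · rcases m with _ | m
    · exact h₀
    rw [hba, List.length_append, hpw, List.length_cons, hpw] at hm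
    simp only [Nat.add_eq_zero_iff, one_ne_zero, and_false, if_false]
    rcases lt_trichotomy m i with h | rfl | h
    · rw [if_neg (by omega)]
      refine Or.inl ⟨List.mem_append_left _ ?_, rfl⟩
      rw [hba, faceCell_append_left (by simp) (by rw [hpw]; omega)]
      exact List.mem_append_left _ (nil_mem_faceCell_pw b h)
    · rw [if_pos rfl]
      have e1 : bca (m + 1) (j + 1) = pw b m ++ [b] :: [c, a] :: pw a j := by
        rw [hba]
        simp only [pw]
        rw [List.replicate_succ', List.append_assoc]; rfl
      have e2 := faceCell_append_mid (pw b m) (pw a j) [b] [c, a]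
      rw [hpw, ← e1, show nf ([b] ++ [c, a]) = [a, c, b] by decide] at e2
      rw [e2]
      simpa using h₁
    · rw [if_neg (by omega)]
      obtain ⟨j', rfl⟩ : ∃ j', j = j' + 1 := ⟨j - 1, by omega⟩
      rcases Nat.eq_or_lt_of_le (Nat.succ_le_of_lt h) with h' | h'
      · obtain rfl : m = i + 1 := h'.symm
        have e2 := faceCell_append_mid (pw b (i + 1)) (pw a j') [c, a] [a]
        rw [hpw, show nf ([c, a] ++ [a]) = [c] by decide] at e2
        have e1 : bca (i + 1) (j' + 1 + 1) = pw b (i + 1) ++ [c, a] :: [a] :: pw a j' := rfl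
        rw [e1, e2]
        simpa using h₂ j' rfl
      · refine Or.inl ⟨List.mem_append_left _ ?_, rfl⟩
        obtain ⟨m', rfl⟩ : ∃ m', m = i + 2 + m' := ⟨m - i - 2, by omega⟩
        have e1 : bca (i + 1) (j' + 1 + 1) = (pw b (i + 1) ++ [[c, a]]) ++ pw a (j' + 1) := by
          rw [hba]; simp
        have e2 := faceCell_append_right (pw b (i + 1) ++ [[c, a]]) (pw a (j' + 1)) m'
          (by rw [hpw]; omega)
        have e3 : (pw b (i + 1) ++ [[c, a]]).length = i + 2 := by simp [pw]
        rw [e3, ← add_assoc] at e2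
        rw [e1, e2]
        exact List.mem_append_right _ (nil_mem_faceCell_pw a (by omega))
  · have hl : (bca (i + 1) (j + 1)).length - 1 = i + 1 + j := by
      rw [hba, List.length_append, hpw, List.length_cons, hpw]; omega
    rw [hl, Finset.sum_eq_single i]
    · simp [bca, List.replicate_succ]
    · intro m _ hm
      beta_reduce
      rw [if_neg (by omega), if_neg (by omega), smul_zero]
    · intro h
      simp at h; omega

/-- The state of the automaton after a letter. -/
def letterSt : Letter → St
  | a => inA
  | b => inB
  | c => inC

theorem run_pw' (e : Letter) (i : ℕ) : run start (pw e (i + 1)) = some (letterSt e) := by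
  rw [run_pw]; cases e <;> rfl

theorem redB_pw (e : Letter) (i : ℕ) : ∀ w ∈ pw e i, w ≠ [] ∧ redB w = true := by
  intro w hw
  rw [List.eq_of_mem_replicate hw]
  exact ⟨by simp, by cases e <;> rfl⟩

theorem tm_eq (n : ℕ) (u : Word) (x : List Word) (v : Word) :
    tm k n u x v = lr k u v • Morse.basisElt V k (gen k) n x := rfl

/-- The contribution of `[e | ⋯ | e | ev | s]`. -/
theorem ev_up_pw {n : ℕ} (e : Letter) (l : ℕ) {v : Word} {s : List Word} {R F₀ : C k n}
    (hl : l + 1 + s.length = n) (hv : v ≠ []) (hr : redB (e :: v) = true)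
    (hs : ∀ w ∈ s, w ≠ [] ∧ redB w = true) (hR : s = [] → R = tm k n [] (pw e n) v)
    (hR' : ∀ s₁ s', s = s₁ :: s' → Ev0 k n (pw e (l + 1) ++ nf (v ++ s₁) :: s') R)
    (hF : Ev0 k n (pw e l ++ v :: s) F₀) :
    Ev0 k n (pw e l ++ (e :: v) :: s) (R + (-1 : k) ^ l • lr k [e] [] • F₀) := by
  have hpe : pw e l ++ [[e]] = pw e (l + 1) := by simp [pw, List.replicate_succ']
  obtain ⟨q, hq⟩ : ∃ q, run start (pw e l) = some q :=
    exists_run_of_prefix (run_pw' e l) ⟨[[e]], hpe⟩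
  have h1 := run_pw' e l
  rw [← hpe] at h1
  obtain ⟨q₁, h2, hu⟩ := run_concat h1
  rw [hq] at h2
  obtain rfl := Option.some.inj h2
  have hG := leftEv_pw e l hF
  rw [← hpe] at hG
  have := ev_up (k := k) (n := n) (p := pw e l) (s := s) (u := [e]) (v := v) (R := R)
    (by simp [pw]; omega) hq hu hv hr hs
    (fun h => by
      rw [hpe, hR h, tm_eq]
      congr 3
      simp [h] at hl
      exact hl.symm)
    (fun s₁ s' h => by
      have := hR' s₁ s' h
      rw [← hpe] at this
      simpa using this) hG
  rwa [show (pw e l).length = l by simp [pw]] at this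

/-- Deleting the first entry leaves at least one `e` before `v`, which is still dead there, so only
the product of `v` with the tail counts. -/
theorem ev_up_pw_dead {n : ℕ} (e : Letter) (l : ℕ) {v : Word} {s : List Word} {R : C k n}
    (hl : l + 2 + s.length = n) (hd : deadB (letterSt e) v = true) (hr : redB (e :: v) = true)
    (hs : ∀ w ∈ s, w ≠ [] ∧ redB w = true) (hR : s = [] → R = tm k n [] (pw e n) v)
    (hR' : ∀ s₁ s', s = s₁ :: s' → Ev0 k n (pw e (l + 2) ++ nf (v ++ s₁) :: s') R) :
    Ev0 k n (pw e (l + 1) ++ (e :: v) :: s) R := by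
  have hv : v ≠ [] := by
    rintro rfl
    cases e <;> simp [deadB] at hd
  have := ev_up_pw e (l + 1) (by omega) hv hr hs hR hR' (F₀ := 0)
    (ev0_of_deadB (run_pw' e l) hd (by simp [pw]; omega) (fun w hw => by
      rw [List.mem_append, List.mem_cons] at hw
      rcases hw with hw | rfl | hw
      · exact (redB_pw _ _ w hw).2
      · exact redB_of_infix (List.suffix_cons e w).isInfix hr
      · exact (hs w hw).2))
  simpa using this

end Shapes

end G23

namespace G23
open Letter St

/-! ### Tails made of letters `a` and rotations `bc`, `cb` -/

section Tails

/-- The words `bc` and `cb`. -/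
def rot (φ : Bool) : Word := bif φ then [b, c] else [c, b]

/-- Tuples of letters `a` and words `bc`, `cb`, the latter determined by the parity of the
position. -/
def tl : Bool → List Bool → List Word
  | _, [] => []
  | φ, true :: s => [a] :: tl (!φ) s
  | φ, false :: s => rot φ :: tl (!φ) s

@[simp] theorem length_tl (φ : Bool) (s : List Bool) : (tl φ s).length = s.length := by
  induction s generalizing φ with
  | nil => rfl
  | cons e s ih => cases e <;> simp [tl, ih]

theorem tl_good (φ : Bool) (s : List Bool) : ∀ w ∈ tl φ s, w ≠ [] ∧ redB w = true := by
  induction s generalizing φ with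
  | nil => simp [tl]
  | cons e s ih =>
    intro w hw
    cases e <;> simp only [tl, List.mem_cons] at hw <;> rcases hw with rfl | hw
    · cases φ <;> exact ⟨by simp [rot], rfl⟩
    · exact ih _ _ hw
    · exact ⟨by simp, rfl⟩
    · exact ih _ _ hw

theorem tl_replicate (φ : Bool) (j : ℕ) (s : List Bool) :
    tl φ (List.replicate j true ++ s) = pw a j ++ tl (xor φ j.bodd) s := by
  induction j generalizing φ with
  | zero => simp [pw]
  | succ j ih => simp [List.replicate_succ, tl, pw, ih]

theorem pw_append (e : Letter) (l : ℕ) (s : List Word) : pw e l ++ [e] :: s = pw e (l + 1) ++ s := by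
  simp [pw, List.replicate_succ']

theorem length_pw (e : Letter) (l : ℕ) : (pw e l).length = l := by simp [pw]

theorem deadB_rot {q : St} (hq : q = inA) (φ : Bool) : deadB q (rot φ) = true := by
  subst hq; cases φ <;> rfl

/-- Passing an `a` exchanges `bc` and `cb`. This is why the kind of a rotation is determined by its
position, so that a tail can be encoded by Booleans, and why two rotations that meet are inverse to
each other. -/
theorem nf_rot_a (φ : Bool) : nf (rot φ ++ [a]) = a :: rot (!φ) := by cases φ <;> decide

theorem nf_rot_rot (φ : Bool) : nf (rot φ ++ rot (!φ)) = [] := by cases φ <;> decide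

end Tails

/-! ### Contributions of the tuples with such tails -/

section Families
variable (k : Type*) [Field k] (n : ℕ)

/-- The contributions of `[c | ⋯ | c | cb | tl true s]`, `[c | ⋯ | c | cabc | tl false s]` and
`[c | ⋯ | c | tl false s]`, encoded by the letters `a`, `b`, `c`. -/
noncomputable def cv : Letter → List Bool → C k n
  | a, [] => tm k n [] (pw c n) [b]
  | b, [] => tm k n [] (pw c n) [a, b, c]
  | c, [] => tm k n [] (pw c n) []
  | a, true :: s => cv b s
  | a, false :: s => cv c s
  | b, true :: s => cv a s
  | b, false :: _ => 0
  | c, true :: _ => 0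
  | c, false :: s => cv a s

/-- The contribution of `[a | ⋯ | a | a·rot φ | tl (!φ) s]`. -/
noncomputable def av : Bool → List Bool → C k n
  | φ, [] => tm k n [] (pw a n) (rot φ)
  | φ, true :: s => av (!φ) s
  | _, false :: _ => 0

/-- The contributions of `[bⁱ | tl true s]` and of `[bⁱ | bc | tl false s]`. -/
noncomputable def bev : Bool → ℕ → List Bool → C k n
  | true, _, [] => tm k n [] (pw b n) []
  | true, i, true :: s => if s.all id then tm k n [] (ba i (s.length + 1)) [] else 0
  | true, i, false :: s => bev false i s
  | false, _, [] => tm k n [] (pw b n) [c]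
  | false, i, true :: s => if s.all id then tm k n [] (bca (i + 1) (s.length + 1)) [] else 0
  | false, i, false :: s => bev true (i + 2) s

/-- The sum of `g` over all ways to insert `false` into a word, up to the first `false`, with
alternating signs; `e` is added if no `false` is present. -/
def insSum {M : Type*} [AddCommGroup M] [Module k M] (g : List Bool → M) (e : ℕ → M) :
    ℕ → List Bool → M
  | j, [] => (-1 : k) ^ j • g (List.replicate j true ++ [false]) + e j
  | j, true :: s => (-1 : k) ^ j • g (List.replicate j true ++ false :: true :: s) + insSum g e (j + 1) s
  | j, false :: s => (-1 : k) ^ j • g (List.replicate j true ++ false :: false :: s)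

/-- The contributions of `[bⁱ | cabc | tl false s]` and of `[bⁱ | acb | tl true s]`. -/
noncomputable def fh : Bool → ℕ → List Bool → C k n
  | true, 0, s => cv k n b s + lr k [c] [] • (av k n true s +
      lr k [a] [] • (bev k n false 0 s + lr k [b] [] • cv k n c s))
  | false, 0, s => av k n false s + lr k [a] [] • (cv k n a s + lr k [c] [] • bev k n true 1 s)
  | true, i + 1, s => insSum k (fh false i)
      (fun j => tm k n [] (bca (i + 1) (j + 1)) (rot (xor true j.bodd))) 0 s
  | false, i + 1, s => insSum k (fh true i)
      (fun j => tm k n [] (ba (i + 1) (j + 1)) (rot (xor false j.bodd))) 0 s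

variable {k n}

theorem basisElt_eq_tm (x : List Word) : Morse.basisElt V k (gen k) n x = tm k n [] x [] := by
  rw [tm_eq, lr_nil, one_smul]

/-- The three shapes pass into each other as the tail is consumed: after one `c` is split off, `b·bc
= c`, `b·a = cabc`, `abc·a = cb` and `abc·cb = a`. In the last case, and when an `a` follows the
power of `c`, the tuple is dead. -/
theorem ev_cv (s : List Bool) : ∀ l,
    (l + 2 + s.length = n → Ev0 k n (pw c (l + 1) ++ [c, b] :: tl true s) (cv k n a s)) ∧
    (l + 2 + s.length = n → Ev0 k n (pw c (l + 1) ++ [c, a, b, c] :: tl false s) (cv k n b s)) ∧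
    (l + 1 + s.length = n → Ev0 k n (pw c (l + 1) ++ tl false s) (cv k n c s)) := by
  induction s with
  | nil =>
    intro l
    refine ⟨fun h => ?_, fun h => ?_, fun h => ?_⟩
    · exact ev_up_pw_dead c l h rfl rfl (tl_good _ _) (fun _ => rfl) (by simp [tl])
    · exact ev_up_pw_dead c l h rfl rfl (tl_good _ _) (fun _ => rfl) (by simp [tl])
    · simp only [List.length_nil, add_zero] at h
      simp only [tl, List.append_nil, cv]
      rw [← basisElt_eq_tm, ← h]
      exact ev0_of_run (run_pw' c l) (length_pw _ _)
  | cons e s ih =>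
    intro l
    simp only [List.length_cons]
    refine ⟨fun h => ?_, fun h => ?_, fun h => ?_⟩
    · refine ev_up_pw_dead c l (by simp; omega) rfl rfl (tl_good _ _) (by cases e <;> simp [tl])
        fun s₁ s' hs => ?_
      cases e <;> simp only [tl, List.cons.injEq] at hs <;> obtain ⟨rfl, rfl⟩ := hs
      · rw [show nf ([b] ++ rot true) = [c] by decide, pw_append]
        exact (ih _).2.2 (by omega)
      · rw [show nf ([b] ++ [a]) = [c, a, b, c] by decide]
        exact (ih _).2.1 (by omega)
    · refine ev_up_pw_dead c l (by simp; omega) rfl rfl (tl_good _ _) (by cases e <;> simp [tl])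
        fun s₁ s' hs => ?_
      cases e <;> simp only [tl, List.cons.injEq] at hs <;> obtain ⟨rfl, rfl⟩ := hs
      · rw [show nf ([a, b, c] ++ rot false) = [a] by decide]
        refine ev0_of_deadB (run_pw' c _) rfl (by simp [length_pw]; omega) fun w hw => ?_
        rw [List.mem_append, List.mem_cons] at hw
        rcases hw with hw | rfl | hw
        · exact (redB_pw _ _ w hw).2
        · rfl
        · exact (tl_good _ _ w hw).2
      · rw [show nf ([a, b, c] ++ [a]) = [c, b] by decide]
        exact (ih _).1 (by omega)
    · cases e
      · exact (ih _).1 (by omega)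
      · refine ev0_of_deadB (run_pw' c _) rfl (by simp [length_pw]; omega) fun w hw => ?_
        rw [List.mem_append, List.mem_cons] at hw
        rcases hw with hw | rfl | hw
        · exact (redB_pw _ _ w hw).2
        · rfl
        · exact (tl_good _ _ w hw).2

/-- The vertices that end with `rot φ | tl _ s` after an initial part in state `inA`. -/
theorem ev_dead_rot {p : List Word} (hp : run start p = some inA) (φ ψ : Bool) (s : List Bool)
    (hl : p.length + 1 + s.length = n) : Ev0 k n (p ++ rot φ :: tl ψ s) 0 := by
  refine ev0_of_deadB hp (deadB_rot rfl φ) (by simp; omega) fun w hw => ?_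
  rw [List.mem_append, List.mem_cons] at hw
  rcases hw with hw | rfl | hw
  · exact (cells_of_run hp w hw).2
  · cases φ <;> rfl
  · exact (tl_good _ _ w hw).2

/-- Once the automaton is in the state `inA`, a rotation is dead, so only tails of letters survive,
and these give critical vertices. -/
theorem ev_inA {p : List Word} (hp : run start p = some inA) (φ : Bool) (s : List Bool)
    (hl : p.length + s.length = n) :
    Ev0 k n (p ++ tl φ s) (if s.all id then tm k n [] (p ++ pw a s.length) [] else 0) := by
  induction s generalizing p φ with
  | nil =>
    simp only [tl, List.append_nil, List.all_nil, if_true, List.length_nil, pw, List.replicate_zero,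
      ← basisElt_eq_tm]
    exact ev0_of_run hp hl
  | cons e s ih =>
    simp only [List.length_cons] at hl
    cases e
    · simpa [tl] using ev_dead_rot hp φ (!φ) s (by omega)
    · have := ih (p := p ++ [[a]]) (run_concat_of hp rfl) (!φ) (by simp; omega)
      simpa [tl, pw, List.replicate_succ] using this

/-- The rotation moves to the right through the letters; meeting another rotation it cancels and the
tuple becomes zero. -/
theorem ev_av (s : List Bool) (φ : Bool) (l : ℕ) (hl : l + 2 + s.length = n) :
    Ev0 k n (pw a (l + 1) ++ (a :: rot φ) :: tl (!φ) s) (av k n φ s) := by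
  induction s generalizing φ l with
  | nil =>
    exact ev_up_pw_dead a l hl (deadB_rot rfl φ) (by cases φ <;> rfl) (tl_good _ _) (fun _ => rfl)
      (by simp [tl])
  | cons e s ih =>
    simp only [List.length_cons] at hl
    refine ev_up_pw_dead a l (by simp; omega) (deadB_rot rfl φ) (by cases φ <;> rfl)
      (tl_good _ _) (by cases e <;> simp [tl]) fun s₁ s' hs => ?_
    cases e <;> simp only [tl, List.cons.injEq] at hs <;> obtain ⟨rfl, rfl⟩ := hs
    · rw [nf_rot_rot]
      exact Or.inl ⟨by simp, rfl⟩
    · rw [nf_rot_a]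
      exact ih (!φ) (l + 1) (by omega)


/-- From `[b | ⋯ | bc | s]` one splits off `b`; then `c·cb = b` prolongs the power of `b` by a
second letter, while `c·a = ca` leads to the state `inA`. -/
theorem ev_bev (s : List Bool) : ∀ i,
    (i + 1 + s.length = n → Ev0 k n (pw b (i + 1) ++ tl true s) (bev k n true (i + 1) s)) ∧
    (i + 2 + s.length = n →
      Ev0 k n (pw b (i + 1) ++ [b, c] :: tl false s) (bev k n false (i + 1) s)) := by
  induction s with
  | nil =>
    intro i
    refine ⟨fun h => ?_, fun h => ?_⟩
    · simp only [List.length_nil, add_zero] at h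
      simp only [tl, List.append_nil, bev]
      rw [← basisElt_eq_tm, ← h]
      exact ev0_of_run (run_pw' b i) (length_pw _ _)
    · exact ev_up_pw_dead b i h rfl rfl (tl_good _ _) (fun _ => rfl) (by simp [tl])
  | cons e s ih =>
    intro i
    simp only [List.length_cons]
    refine ⟨fun h => ?_, fun h => ?_⟩
    · cases e
      · exact (ih i).2 (by omega)
      · have := ev_inA (k := k) (n := n) (run_concat_of (run_pw' b i) (u := [a]) rfl) false s
          (by simp [length_pw]; omega)
        simpa [tl, bev, ba, pw, List.replicate_succ] using this
    · refine ev_up_pw_dead b i (by simp; omega) rfl rfl (tl_good _ _) (by cases e <;> simp [tl])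
        fun s₁ s' hs => ?_
      cases e <;> simp only [tl, List.cons.injEq] at hs <;> obtain ⟨rfl, rfl⟩ := hs
      · rw [show nf ([c] ++ rot false) = [b] by decide, pw_append]
        exact (ih _).1 (by omega)
      · have := ev_inA (k := k) (n := n) (run_concat_of (run_pw' b (i + 1)) (u := [c, a]) rfl) true s
          (by simp [length_pw]; omega)
        rw [show nf ([c] ++ [a]) = [c, a] by decide]
        simpa [bev, bca, pw] using this

theorem ev_bc (s : List Bool) (hl : 1 + s.length = n) : Ev0 k n ([b, c] :: tl false s)
    (bev k n false 0 s + lr k [b] [] • cv k n c s) := by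
  have := ev_up_pw (k := k) (n := n) b 0 (v := [c]) (s := tl false s) (R := bev k n false 0 s)
    (F₀ := cv k n c s) (by simp; omega) (by simp) rfl (tl_good _ _)
    (fun h => by
      rcases s with _ | ⟨e, s⟩
      · rfl
      · cases e <;> simp [tl] at h)
    (fun s₁ s' hs => by
      rcases s with _ | ⟨e, s⟩
      · simp [tl] at hs
      simp only [List.length_cons] at hl
      cases e <;> simp only [tl, List.cons.injEq] at hs <;> obtain ⟨rfl, rfl⟩ := hs
      · rw [show nf ([c] ++ rot false) = [b] by decide, pw_append]
        exact (ev_bev s 1).1 (by omega)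
      · have := ev_inA (k := k) (n := n) (run_concat_of (run_pw' b 0) (u := [c, a]) rfl) true s
          (by simp [length_pw]; omega)
        rw [show nf ([c] ++ [a]) = [c, a] by decide]
        simpa [bev, bca, pw] using this)
    ((ev_cv s 0).2.2 (by omega))
  simpa [pw] using this

theorem ev_cb (s : List Bool) (hl : 1 + s.length = n) : Ev0 k n ([c, b] :: tl true s)
    (cv k n a s + lr k [c] [] • bev k n true 1 s) := by
  have := ev_up_pw (k := k) (n := n) c 0 (v := [b]) (s := tl true s) (R := cv k n a s)
    (F₀ := bev k n true 1 s) (by simp; omega) (by simp) rfl (tl_good _ _)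
    (fun h => by
      rcases s with _ | ⟨e, s⟩
      · rfl
      · cases e <;> simp [tl] at h)
    (fun s₁ s' hs => by
      rcases s with _ | ⟨e, s⟩
      · simp [tl] at hs
      simp only [List.length_cons] at hl
      cases e <;> simp only [tl, List.cons.injEq] at hs <;> obtain ⟨rfl, rfl⟩ := hs
      · rw [show nf ([b] ++ rot true) = [c] by decide, pw_append]
        exact (ev_cv s _).2.2 (by omega)
      · rw [show nf ([b] ++ [a]) = [c, a, b, c] by decide]
        exact (ev_cv s _).2.1 (by omega))
    ((ev_bev s 0).1 (by omega))
  simpa [pw] using this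

theorem ev_a_rot (φ : Bool) (s : List Bool) (hl : 1 + s.length = n) {F : C k n}
    (hF : Ev0 k n (rot φ :: tl (!φ) s) F) :
    Ev0 k n ((a :: rot φ) :: tl (!φ) s) (av k n φ s + lr k [a] [] • F) := by
  have := ev_up_pw (k := k) (n := n) a 0 (v := rot φ) (s := tl (!φ) s) (R := av k n φ s)
    (F₀ := F) (by simp; omega) (by cases φ <;> simp [rot]) (by cases φ <;> rfl) (tl_good _ _)
    (fun h => by
      rcases s with _ | ⟨e, s⟩
      · rfl
      · cases e <;> simp [tl] at h)
    (fun s₁ s' hs => by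
      rcases s with _ | ⟨e, s⟩
      · simp [tl] at hs
      simp only [List.length_cons] at hl
      cases e <;> simp only [tl, List.cons.injEq] at hs <;> obtain ⟨rfl, rfl⟩ := hs
      · rw [nf_rot_rot]
        exact Or.inl ⟨by simp, rfl⟩
      · rw [nf_rot_a]
        exact ev_av s (!φ) 0 (by omega))
    (by simpa [pw] using hF)
  simpa [pw] using this

/-- With nothing in front, deleting the split-off first letter does not lead to a dead tuple but to
a shorter first word: `cabc`, `abc`, `bc`, `c` and `acb`, `cb`, `b`. Each deletion contributes a
letter to the coefficient. -/
theorem ev_fh_zero (s : List Bool) (hl : 1 + s.length = n) :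
    Ev0 k n ([c, a, b, c] :: tl false s) (fh k n true 0 s) ∧
    Ev0 k n ([a, c, b] :: tl true s) (fh k n false 0 s) := by
  refine ⟨?_, ev_a_rot false s hl (ev_cb s hl)⟩
  have := ev_up_pw (k := k) (n := n) c 0 (v := [a, b, c]) (s := tl false s) (R := cv k n b s)
    (F₀ := _) (by simp; omega) (by simp) rfl (tl_good _ _)
    (fun h => by
      rcases s with _ | ⟨e, s⟩
      · rfl
      · cases e <;> simp [tl] at h)
    (fun s₁ s' hs => by
      rcases s with _ | ⟨e, s⟩
      · simp [tl] at hs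
      simp only [List.length_cons] at hl
      cases e <;> simp only [tl, List.cons.injEq] at hs <;> obtain ⟨rfl, rfl⟩ := hs
      · rw [show nf ([a, b, c] ++ rot false) = [a] by decide]
        refine ev0_of_deadB (run_pw' c _) rfl (by simp [length_pw]; omega) fun w hw => ?_
        rw [List.mem_append, List.mem_cons] at hw
        rcases hw with hw | rfl | hw
        · exact (redB_pw _ _ w hw).2
        · rfl
        · exact (tl_good _ _ w hw).2
      · rw [show nf ([a, b, c] ++ [a]) = [c, b] by decide]
        exact (ev_cv s 0).1 (by omega))
    (ev_a_rot true s hl (ev_bc s hl))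
  rw [pow_zero, one_smul] at this
  exact this

/-- The chain is `p j`, followed by the entry `u j · rotation` that is split. Contracting to the
left leaves the rotation behind as a new entry at position `j` of the tail (`g`); otherwise it
passes the next letter and `j` grows. It stops at another rotation, which cancels it, or at the end
of the tail, where it becomes a right coefficient (`e`). -/
theorem ev_insSum {i : ℕ} (φ : Bool) {p : ℕ → List Word} {u : ℕ → Word} {q : ℕ → St}
    {g : List Bool → C k n} (hp : ∀ j, run start (p j) = some (q j))
    (hu : ∀ j, step (q j) (u j) = some inA) (hpl : ∀ j, (p j).length = i + 1 + j)
    (hpu : ∀ j, p (j + 1) = p j ++ [u j]) (hua : ∀ j, u (j + 1) = [a])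
    (hr : ∀ j ψ, redB (u j ++ rot ψ) = true)
    (hG : ∀ j s, i + 1 + j + 1 + s.length = n → LeftEv k n (p j ++ [u j])
      (rot (xor φ j.bodd) :: tl (!(xor φ j.bodd)) s)
        ((-1 : k) ^ (i + 1) • g (List.replicate j true ++ false :: s)))
    (s : List Bool) (j : ℕ) (hl : i + 1 + j + 1 + s.length = n) :
    Ev0 k n (p j ++ (u j ++ rot (xor φ j.bodd)) :: tl (!(xor φ j.bodd)) s)
      (insSum k g (fun j => tm k n [] (p j ++ [u j]) (rot (xor φ j.bodd))) j s) := by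
  -- The sign of the ascent has exponent `i + 1 + j`, and the left contraction carries `(-1)^(i +
  -- 1)`; only `(-1)^j` is left.
  have hsign (j : ℕ) (x : C k n) :
      (-1 : k) ^ (p j).length • (-1 : k) ^ (i + 1) • x = (-1 : k) ^ j • x := by
    rw [hpl, smul_smul, ← pow_add, show i + 1 + j + (i + 1) = j + 2 * (i + 1) by ring, pow_add,
      pow_mul]
    simp
  induction s generalizing j with
  | nil =>
    have := ev_up (k := k) (n := n) (s := []) (v := rot (xor φ j.bodd))
      (by simp [hpl]; simpa using hl) (hp j) (hu j) (by cases xor φ j.bodd <;> simp [rot]) (hr j _)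
      (by simp) (fun _ => rfl) (by simp) (hG j [] hl)
    rw [hsign, add_comm] at this
    exact this
  | cons e s ih =>
    simp only [List.length_cons] at hl
    have hup := fun R hR => ev_up (k := k) (n := n) (s := tl (!(xor φ j.bodd)) (e :: s)) (R := R)
      (v := rot (xor φ j.bodd)) (by simp [hpl]; omega) (hp j) (hu j)
      (by cases xor φ j.bodd <;> simp [rot]) (hr j _) (tl_good _ _) (by cases e <;> simp [tl])
      hR (hG j (e :: s) (by simpa using hl))
    simp only [hsign] at hup
    cases e
    · have := hup 0 (fun s₁ s' hs => by
        simp only [tl, List.cons.injEq] at hs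
        obtain ⟨rfl, rfl⟩ := hs
        rw [nf_rot_rot]
        exact Or.inl ⟨by simp, rfl⟩)
      rw [zero_add] at this
      exact this
    · have := hup _ (fun s₁ s' hs => by
        simp only [tl, List.cons.injEq] at hs
        obtain ⟨rfl, rfl⟩ := hs
        rw [nf_rot_a]
        have := ih (j + 1) (by omega)
        rw [hpu, hua, Nat.bodd_succ, List.append_assoc] at this
        simpa using this)
      rw [add_comm] at this
      exact this

theorem run_ba' (i j : ℕ) : run start (ba i (j + 1)) = some inA := by
  rcases i with _ | i
  · exact run_pw' a j
  · exact run_ba i j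

/-- The vertices `[ca | a | ⋯ | a | rot φ | tl ψ s]`. -/
theorem ev_ca (j : ℕ) (φ ψ : Bool) (s : List Bool) (hl : j + 2 + s.length = n) :
    Ev0 k n ([c, a] :: (pw a j ++ rot φ :: tl ψ s)) 0 := by
  have := ev_up_pw (k := k) (n := n) c 0 (v := [a]) (s := pw a j ++ rot φ :: tl ψ s) (R := 0)
    (F₀ := 0) (by simp [length_pw]; omega) (by simp) rfl
    (fun w hw => by
      rw [List.mem_append, List.mem_cons] at hw
      rcases hw with hw | rfl | hw
      · exact redB_pw _ _ w hw
      · cases φ <;> exact ⟨by simp [rot], rfl⟩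
      · exact tl_good _ _ w hw)
    (by simp)
    (fun s₁ s' hs => by
      rcases j with _ | j
      · simp only [pw, List.replicate_zero, List.nil_append, List.cons.injEq] at hs
        obtain ⟨rfl, rfl⟩ := hs
        rw [show nf ([a] ++ rot φ) = a :: rot φ by cases φ <;> decide]
        refine ev0_of_deadB (run_pw' c _) (by cases φ <;> rfl) (by simp [length_pw]; omega) fun w hw => ?_
        rw [List.mem_append, List.mem_cons] at hw
        rcases hw with hw | rfl | hw
        · exact (redB_pw _ _ w hw).2
        · cases φ <;> rfl
        · exact (tl_good _ _ w hw).2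
      · simp only [pw, List.replicate_succ, List.cons_append, List.cons.injEq] at hs
        obtain ⟨rfl, rfl⟩ := hs
        rw [show nf ([a] ++ [a]) = [] by decide]
        exact Or.inl ⟨by simp, rfl⟩)
    (by
      have := ev_dead_rot (k := k) (n := n) (run_pw' a j) φ ψ s (by simp [length_pw]; omega)
      simpa [pw, List.replicate_succ] using this)
  simpa [pw] using this

/-- Induction on the number of letters `b`. Contracting the last `b` with `ca` gives `acb` and with
`a` gives `cabc`, so the two families alternate; deleting the first `b` contributes nothing because
of the rotation in the tail. -/
theorem ev_fh (i : ℕ) : ∀ s : List Bool, i + 1 + s.length = n →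
    Ev0 k n (pw b i ++ [c, a, b, c] :: tl false s) (fh k n true i s) ∧
    Ev0 k n (pw b i ++ [a, c, b] :: tl true s) (fh k n false i s) := by
  induction i with
  | zero => intro s hl; exact ev_fh_zero s (by omega)
  | succ i ih =>
    intro s hl
    have htl (φ : Bool) (j : ℕ) (s : List Bool) :
        tl φ (List.replicate j true ++ false :: s) =
          pw a j ++ rot (xor φ j.bodd) :: tl (!(xor φ j.bodd)) s := tl_replicate φ j (false :: s)
    constructor
    -- The case `j = 0` is separate because the split entry is then `ca` itself, and `bca (i + 1) 0`
    -- would already contain it.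
    · have e (j : ℕ) : (pw b (i + 1) ++ if j = 0 then [] else [c, a] :: pw a (j - 1)) ++
          [if j = 0 then [c, a] else [a]] = bca (i + 1) (j + 1) := by
        rcases j with _ | j
        · simp [bca, pw]
        · simp [bca, pw, List.replicate_succ']
      have := ev_insSum (k := k) (n := n) (i := i) true
        (p := fun j => pw b (i + 1) ++ if j = 0 then [] else [c, a] :: pw a (j - 1))
        (u := fun j => if j = 0 then [c, a] else [a])
        (q := fun j => if j = 0 then inB else inA) (g := fh k n false i)
        (fun j => by
          rcases j with _ | j
          · simpa [letterSt] using run_pw' b i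
          · exact run_bca i j)
        (fun j => by rcases j with _ | j <;> rfl)
        (fun j => by rcases j with _ | j <;> simp [length_pw])
        (fun j => by
          rw [e]
          simp [bca, pw])
        (fun j => by simp)
        (fun j ψ => by rcases j with _ | j <;> cases ψ <;> rfl)
        (fun j s hl => by
          rw [e]
          have := leftEv_bca (k := k) (n := n) i j (t := rot (xor true j.bodd) :: tl (!(xor true j.bodd)) s)
            (F₀ := 0) (F₁ := fh k n false i (List.replicate j true ++ false :: s))
            (by
              rcases i with _ | i
              -- With no `b` left, `ca` is inadmissible as a first entry and has to be split once
              -- more.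
              · exact ev_ca j _ _ s (by omega)
              · exact ev_dead_rot (run_bca i j) _ _ s (by simp [bca]; omega))
            (by rw [← htl]; exact (ih _ (by simp; omega)).2)
            (fun j' hj' => by
              refine ev0_of_deadB (run_pw' b _) rfl (by simp [length_pw]; omega) fun w hw => ?_
              rw [List.mem_append, List.mem_cons, List.mem_append, List.mem_cons] at hw
              rcases hw with hw | rfl | hw | rfl | hw
              · exact (redB_pw _ _ w hw).2
              · rfl
              · exact (redB_pw _ _ w hw).2
              · cases xor true j.bodd <;> rfl
              · exact (tl_good _ _ w hw).2)
          rwa [smul_zero, zero_add] at this) s 0 (by omega)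
      simp only [e] at this
      simpa [fh, rot] using this
    · have e (j : ℕ) : (pw b (i + 1) ++ pw a j) ++ [[a]] = ba (i + 1) (j + 1) := by
        simp [ba, pw, List.replicate_succ']
      have := ev_insSum (k := k) (n := n) (i := i) false
        (p := fun j => pw b (i + 1) ++ pw a j) (u := fun _ => [a])
        (q := fun j => if j = 0 then inB else inA) (g := fh k n true i)
        (fun j => by
          rcases j with _ | j
          · simpa [pw, letterSt] using run_pw' b i
          · exact run_ba i j)
        (fun j => by rcases j with _ | j <;> rfl)
        (fun j => by simp [length_pw])
        (fun j => by simp [pw, List.replicate_succ'])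
        (fun j => rfl)
        (fun j ψ => by cases ψ <;> rfl)
        (fun j s hl => by
          rw [e]
          have := leftEv_ba (k := k) (n := n) i j
            (t := rot (xor false j.bodd) :: tl (!(xor false j.bodd)) s)
            (F₀ := 0) (F₁ := fh k n true i (List.replicate j true ++ false :: s))
            (ev_dead_rot (run_ba' i j) _ _ s (by simp [ba]; omega))
            (by rw [← htl]; exact (ih _ (by simp; omega)).1)
          rwa [smul_zero, zero_add] at this) s 0 (by omega)
      simp only [e] at this
      simpa [fh, rot, pw] using this

end Families

end G23

namespace G23
open Letter St

/-! ### Alternating sums of binomial coefficients -/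

section Coefficients
variable (k : Type*) [Field k]

/-- Binomial coefficients, placed at the indices of parity `φ`. -/
def chooseAt (φ : Bool) (r p : ℕ) : k :=
  if p.bodd = φ then ((p / 2 + r).choose r : ℕ) else 0

/-- As `chooseAt false ((i - 1) / 2)`, with the convention `-1 choose -1 = 1`. -/
def chooseAtPred : ℕ → ℕ → k
  | 0, p => if p = 0 then 1 else 0
  | i + 1, p => chooseAt k false (i / 2) p

variable {k}

theorem bodd_eq_false_iff {p : ℕ} : p.bodd = false ↔ p % 2 = 0 := by
  rw [Nat.mod_two_of_bodd]; cases p.bodd <;> simp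

theorem bodd_eq_true_iff {p : ℕ} : p.bodd = true ↔ p % 2 = 1 := by
  rw [Nat.mod_two_of_bodd]; cases p.bodd <;> simp

/-- The hockey-stick identity, carried by the even indices; odd steps leave both sides unchanged. -/
theorem sum_chooseAt_false (r q : ℕ) :
    ∑ p ∈ Finset.range (q + 1), (-1 : k) ^ p * chooseAt k false r p =
      ((q / 2 + r + 1).choose (r + 1) : ℕ) := by
  induction q with
  | zero => simp [chooseAt]
  | succ q ih =>
    rw [Finset.sum_range_succ, ih, chooseAt]
    simp only [bodd_eq_false_iff]
    split_ifs with h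
    · have e : (q + 1) / 2 = q / 2 + 1 := by omega
      rw [e, (Nat.even_iff.2 h).neg_one_pow, one_mul, ← Nat.cast_add]
      congr 1
      rw [show q / 2 + 1 + r + 1 = (q / 2 + r + 1) + 1 by omega,
        Nat.choose_succ_succ (q / 2 + r + 1) r, show q / 2 + 1 + r = q / 2 + r + 1 by omega, add_comm]
    · rw [show (q + 1) / 2 = q / 2 by omega]
      simp

theorem sum_chooseAt_true (r q : ℕ) :
    ∑ p ∈ Finset.range (q + 1), (-1 : k) ^ p * chooseAt k true r p =
      - (((q + 1) / 2 + r).choose (r + 1) : ℕ) := by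
  induction q with
  | zero => simp [chooseAt]
  | succ q ih =>
    rw [Finset.sum_range_succ, ih, chooseAt]
    simp only [bodd_eq_true_iff]
    split_ifs with h
    · have e : (q + 1) / 2 = q / 2 := by omega
      rw [show (q + 1 + 1) / 2 = (q + 1) / 2 + 1 by omega,
        (Nat.odd_iff.2 h).neg_one_pow, neg_one_mul, ← neg_add, ← Nat.cast_add]
      congr 2
      rw [show (q + 1) / 2 + 1 + r = ((q + 1) / 2 + r) + 1 by omega,
        Nat.choose_succ_succ _ r, add_comm]
    · rw [show (q + 1 + 1) / 2 = (q + 1) / 2 by omega]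
      simp

/-- The convention in `chooseAtPred` is chosen so that the case `i = 0`, a single term, obeys the
same formula. -/
theorem sum_chooseAtPred (i q : ℕ) :
    ∑ p ∈ Finset.range (q + 1), (-1 : k) ^ p * chooseAtPred k i p =
      ((q / 2 + (i + 1) / 2).choose ((i + 1) / 2) : ℕ) := by
  rcases i with _ | i
  · simp [chooseAtPred]
  · simp only [chooseAtPred]
    rw [sum_chooseAt_false, show (i + 1 + 1) / 2 = i / 2 + 1 by omega, add_assoc]

theorem chooseAtPred_of_bodd {i p : ℕ} (h : p.bodd = true) : chooseAtPred k i p = 0 := by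
  rcases i with _ | i
  · have : p ≠ 0 := by rintro rfl; simp at h
    simp [chooseAtPred, this]
  · simp [chooseAtPred, chooseAt, h]

variable {M : Type*} [AddCommGroup M] [Module k M]

/-- Insertion is possible at the positions `0, …, q` of the initial run of letters and not beyond
its end; the final term survives only if no rotation follows. -/
theorem insSum_replicate (g : List Bool → M) (e : ℕ → M) (u : List Bool)
    (hu : u = [] ∨ ∃ s, u = false :: s) (q j : ℕ) :
    insSum k g e j (List.replicate q true ++ u) =
      ∑ p ∈ Finset.range (q + 1), (-1 : k) ^ (j + p) •
        g (List.replicate (j + p) true ++ false :: (List.replicate (q - p) true ++ u)) +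
      if u = [] then e (j + q) else 0 := by
  induction q generalizing j with
  | zero =>
    rcases hu with rfl | ⟨s, rfl⟩ <;> simp [insSum]
  | succ q ih =>
    rw [List.replicate_succ, List.cons_append, insSum, ih, Finset.sum_range_succ' _ (q + 1), ← add_assoc,
      add_comm (Finset.sum _ _)]
    congr 1
    · congr 1
      refine Finset.sum_congr rfl fun p _ => ?_
      rw [show j + 1 + p = j + (p + 1) by ring, Nat.add_sub_add_right]
    · rw [show j + 1 + q = j + (q + 1) by ring]

theorem sum_smul_ite (x : ℕ → k) (y : M) (q : ℕ) :
    ∑ p ∈ Finset.range (q + 1), (-1 : k) ^ p • x p • (if q - p = 0 then y else 0) =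
      ((-1 : k) ^ q * x q) • y := by
  rw [Finset.sum_range_succ, Finset.sum_eq_zero, zero_add]
  · simp [smul_smul]
  · intro p hp
    have := Finset.mem_range.1 hp
    rw [if_neg (by omega), smul_zero, smul_zero]

/-- Only indices `p` of parity `φ` count; for these the parity of `q - p` is constant and the vector
factors out. -/
theorem sum_smul_parity (x : ℕ → k) (φ : Bool) (hx : ∀ p, p.bodd ≠ φ → x p = 0) (y : Bool → M)
    (q : ℕ) :
    ∑ p ∈ Finset.range (q + 1), (-1 : k) ^ p • x p • y (q - p).bodd =
      (∑ p ∈ Finset.range (q + 1), (-1 : k) ^ p * x p) • y (xor q.bodd φ) := by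
  rw [Finset.sum_smul]
  refine Finset.sum_congr rfl fun p hp => ?_
  have := Finset.mem_range.1 hp
  by_cases h : p.bodd = φ
  · rw [smul_smul]
    have e : xor q.bodd φ = (q - p).bodd := by
      have : q.bodd = xor (q - p).bodd p.bodd := by
        rw [← Nat.bodd_add]; congr 1; omega
      rw [this, h]; simp
    rw [e]
  · simp [hx p h]

end Coefficients

/-! ### Closed forms of the contributions `fh` -/

section ClosedForms
variable {k : Type*} [Field k] {n : ℕ}

theorem cv_c_replicate (m : ℕ) (u : List Bool) :
    cv k n c (List.replicate m true ++ u) = if m = 0 then cv k n c u else 0 := by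
  rcases m with _ | m
  · simp
  · simp [List.replicate_succ, cv]

/-- Each letter `a` exchanges the shapes ending in `cb` and in `cabc`. -/
theorem cv_replicate (m : ℕ) (u : List Bool) :
    cv k n a (List.replicate m true ++ u) = cv k n (bif m.bodd then b else a) u ∧
    cv k n b (List.replicate m true ++ u) = cv k n (bif m.bodd then a else b) u := by
  induction m with
  | zero => simp
  | succ m ih =>
    simp only [List.replicate_succ, List.cons_append, cv, ih, Nat.bodd_succ]
    cases m.bodd <;> simp

theorem av_replicate_false (φ : Bool) (m : ℕ) (s : List Bool) :
    av k n φ (List.replicate m true ++ false :: s) = 0 := by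
  induction m generalizing φ with
  | zero => rfl
  | succ m ih => simpa [List.replicate_succ, av] using ih (!φ)

theorem av_replicate (φ : Bool) (m : ℕ) :
    av k n φ (List.replicate m true) = tm k n [] (pw a n) (rot (xor φ m.bodd)) := by
  induction m generalizing φ with
  | zero => simp [av]
  | succ m ih => simpa [List.replicate_succ, av] using ih (!φ)

theorem bev_replicate_false (φ : Bool) (i m : ℕ) (s : List Bool) (hm : m ≠ 0) :
    bev k n φ i (List.replicate m true ++ false :: s) = 0 := by
  obtain ⟨m, rfl⟩ := Nat.exists_eq_succ_of_ne_zero hm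
  cases φ <;> simp [List.replicate_succ, bev]

/-- The coefficient words `ca` and `ac`. -/
def lamW (i : ℕ) : Word := bif i.bodd then [a, c] else [c, a]

/-- The coefficient words `cab` and `a`. -/
def muW (i : ℕ) : Word := bif i.bodd then [a] else [c, a, b]

theorem lamW_add_two (i : ℕ) : lamW (i + 2) = lamW i := by simp [lamW]

theorem muW_add_two (i : ℕ) : muW (i + 2) = muW i := by simp [muW]

theorem lr_smul_smul (u v u' v' : Word) (x : C k n) :
    lr k u v • lr k u' v' • x = lr k (u ++ u') (v' ++ v) • x := by
  rw [← lr_mul]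
  exact (mul_smul (lr k u v) (lr k u' v') x).symm

/-- The shape of the contribution `fh true i` on words that contain `false`. -/
def FhTrue (k : Type*) [Field k] (n i : ℕ) : Prop := ∀ q s,
  fh k n true i (List.replicate q true ++ false :: s) =
    chooseAtPred k i q • lr k (muW i) [] • cv k n a s +
    (bif i.bodd then 0 else chooseAt k true (i / 2) q) • cv k n c s +
    if q = 0 then lr k (lamW i) [] • bev k n true (i + 2) s else 0

/-- The shape of the contribution `fh false i` on words that contain `false`. -/
def FhFalse (k : Type*) [Field k] (n i : ℕ) : Prop := ∀ q s,
  fh k n false i (List.replicate q true ++ false :: s) =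
    chooseAt k false (i / 2) q • lr k (muW (i + 1)) [] • cv k n c s +
    (bif i.bodd then -chooseAt k true (i / 2) q else 0) • cv k n a s +
    if q = 0 then lr k (lamW (i + 1)) [] • bev k n false (i + 1) s else 0

theorem sum_smul_ite_zero {M : Type*} [AddCommGroup M] [Module k M] (f : ℕ → M) (q : ℕ) :
    ∑ p ∈ Finset.range (q + 1), (-1 : k) ^ p • (if p = 0 then f (q - p) else 0) = f q := by
  rw [Finset.sum_range_succ', Finset.sum_eq_zero]
  · simp
  · intro p _
    simp

/-- The summand with insertion at `p` is `fh false i` on a tail with `p` letters before its first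
rotation, so `hi` applies. Of its three terms, the one with `cv c` survives only for `p = q`, the
one with `cv a` sees only the parity of `q - p` and yields a hockey-stick sum, and the one with
`bev` occurs only for `p = 0`. -/
theorem fh_true_succ {i : ℕ} (hi : FhFalse k n i) (q : ℕ) (u : List Bool)
    (hu : u = [] ∨ ∃ s, u = false :: s) :
    fh k n true (i + 1) (List.replicate q true ++ u) =
      chooseAt k false (i / 2) q • lr k (muW (i + 1)) [] • cv k n c u +
      (bif i.bodd then (((q + 1) / 2 + i / 2).choose (i / 2 + 1) : k) else 0) •
        cv k n (bif q.bodd then a else b) u +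
      lr k (lamW (i + 1)) [] • bev k n false (i + 1) (List.replicate q true ++ u) +
      if u = [] then tm k n [] (bca (i + 1) (q + 1)) (rot (xor true q.bodd)) else 0 := by
  rw [fh, insSum_replicate _ _ u hu]
  simp only [zero_add]
  congr 1
  simp only [hi _ _, cv_c_replicate, (cv_replicate _ _).1, smul_add, Finset.sum_add_distrib,
    smul_ite, smul_zero]
  congr 1
  · congr 1
    · have := sum_smul_ite (chooseAt k false (i / 2)) (lr k (muW (i + 1)) [] • cv k n c u) q
      simp only [smul_ite, smul_zero] at this
      rw [this]
      unfold chooseAt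
      split_ifs with h
      · rw [(Nat.even_iff.2 (bodd_eq_false_iff.1 h)).neg_one_pow, one_mul]
      · simp
    · have := sum_smul_parity (fun p => bif i.bodd then -chooseAt k true (i / 2) p else 0) true
        (fun p hp => by cases i.bodd <;> simp [chooseAt, hp])
        (fun φ => cv k n (bif φ then b else a) u) q
      rw [this]
      congr 1
      · cases i.bodd
        · simp
        · simp only [cond_true, mul_neg, Finset.sum_neg_distrib]
          rw [sum_chooseAt_true, neg_neg]
      · cases q.bodd <;> rfl
  · have := sum_smul_ite_zero (k := k) (fun m => lr k (lamW (i + 1)) [] •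
      bev k n false (i + 1) (List.replicate m true ++ u)) q
    simp only [smul_ite, smul_zero] at this
    exact this

/-- The same computation with the two families exchanged; now the term with `cv a` is summed with
the coefficients `chooseAtPred`, hence nonzero for every parity of `i`. -/
theorem fh_false_succ {i : ℕ} (hi : FhTrue k n i) (q : ℕ) (u : List Bool)
    (hu : u = [] ∨ ∃ s, u = false :: s) :
    fh k n false (i + 1) (List.replicate q true ++ u) =
      ((q / 2 + (i + 1) / 2).choose ((i + 1) / 2) : k) • lr k (muW i) [] •
        cv k n (bif q.bodd then b else a) u +
      (bif i.bodd then 0 else -chooseAt k true (i / 2) q) • cv k n c u +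
      lr k (lamW i) [] • bev k n true (i + 2) (List.replicate q true ++ u) +
      if u = [] then tm k n [] (ba (i + 1) (q + 1)) (rot (xor false q.bodd)) else 0 := by
  rw [fh, insSum_replicate _ _ u hu]
  simp only [zero_add]
  congr 1
  simp only [hi _ _, cv_c_replicate, (cv_replicate _ _).1, smul_add, Finset.sum_add_distrib,
    smul_ite, smul_zero]
  congr 1
  · congr 1
    · have := sum_smul_parity (chooseAtPred k i) false
        (fun p hp => chooseAtPred_of_bodd (by simpa using hp))
        (fun φ => lr k (muW i) [] • cv k n (bif φ then b else a) u) q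
      rw [this, sum_chooseAtPred, Bool.xor_false]
    · have := sum_smul_ite (fun p => bif i.bodd then 0 else chooseAt k true (i / 2) p) (cv k n c u) q
      simp only [smul_ite, smul_zero] at this
      rw [this]
      congr 1
      cases i.bodd
      · simp only [cond_false]
        unfold chooseAt
        split_ifs with h
        · rw [(Nat.odd_iff.2 (bodd_eq_true_iff.1 h)).neg_one_pow, neg_one_mul]
        · simp
      · simp
  · have := sum_smul_ite_zero (k := k) (fun m => lr k (lamW i) [] •
      bev k n true (i + 2) (List.replicate m true ++ u)) q
    simp only [smul_ite, smul_zero] at this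
    exact this

/-- The two shapes are proved together, since each family at `i + 1` uses the other at `i`. The
recursion closes because a rotation turns `cv c` into `cv a`, `cv a` into `cv c`, and `cv b` into
zero. -/
theorem fhTrue_fhFalse (i : ℕ) : FhTrue k n i ∧ FhFalse k n i := by
  induction i with
  | zero =>
    constructor
    · intro q s
      rw [fh, av_replicate_false, cv_c_replicate, (cv_replicate _ _).2]
      rcases q with _ | q
      · simp [chooseAtPred, chooseAt, cv, bev, lr_smul_smul, lamW, muW, smul_add, add_comm]
      · rw [bev_replicate_false _ _ _ _ (by simp)]
        simp only [chooseAtPred, chooseAt, muW, Nat.bodd_succ]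
        cases q.bodd <;> simp [cv]
    · intro q s
      rw [fh, av_replicate_false, (cv_replicate _ _).1]
      rcases q with _ | q
      · simp [chooseAt, cv, bev, lr_smul_smul, lamW, muW, smul_add]
      · rw [bev_replicate_false _ _ _ _ (by simp)]
        simp only [chooseAt, muW, Nat.bodd_succ]
        cases q.bodd <;> simp [cv]
  | succ i ih =>
    constructor
    · intro q s
      rw [fh_true_succ ih.2 q _ (Or.inr ⟨s, rfl⟩)]
      simp only [chooseAtPred, List.cons_ne_nil, if_false, add_zero, cv]
      congr 1
      · congr 1
        cases h : i.bodd <;> cases hq : q.bodd <;> simp [chooseAt, h, hq, cv]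
        rw [bodd_eq_true_iff] at h hq
        rw [show (q + 1) / 2 + i / 2 = q / 2 + (i + 1) / 2 by omega,
          show i / 2 + 1 = (i + 1) / 2 by omega]
      · split_ifs with h
        · subst h; simp [bev]
        · rw [bev_replicate_false _ _ _ _ h, smul_zero]
    · intro q s
      rw [fh_false_succ ih.1 q _ (Or.inr ⟨s, rfl⟩)]
      simp only [List.cons_ne_nil, if_false, add_zero, cv, muW_add_two, lamW_add_two]
      congr 1
      · congr 1
        · cases hq : q.bodd <;> simp [chooseAt, hq, cv]
        · cases h : i.bodd <;> simp [chooseAt, h]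
          rw [bodd_eq_false_iff] at h
          rw [show (i + 1) / 2 = i / 2 by omega]
      · split_ifs with h
        · subst h; simp [bev]
        · rw [bev_replicate_false _ _ _ _ h, smul_zero]

end ClosedForms

end G23

namespace G23
open Letter St

/-! ### The differential before separating parities -/

section Differential
variable {k : Type*} [Field k] {n : ℕ}

theorem tl_replicate_nil (φ : Bool) (j : ℕ) : tl φ (List.replicate j true) = pw a j := by
  simpa [tl] using tl_replicate φ j []

theorem lr_smul_tm (u v u' v' : Word) (x : List Word) :
    lr k u v • tm k n u' x v' = tm k n (u ++ u') x (v' ++ v) := by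
  rw [tm_eq, tm_eq, lr_smul_smul]

theorem diff_tm {x : List Word} {q : St} {F : C k n} (hx : run start x = some q)
    (hl : x.length = n + 1) (h : Ev k n x F) : d k n (tm k (n + 1) [] x []) = F := by
  rw [← basisElt_eq_tm]
  exact diff_basisElt (mem_critical_iff.2 ⟨hl, q, hx⟩) h

theorem ev0_tm {x : List Word} {q : St} (h : run start x = some q) (hl : x.length = n) :
    Ev0 k n x (tm k n [] x []) := by
  rw [← basisElt_eq_tm]
  exact ev0_of_run h hl

theorem ev_pw (e : Letter) (n : ℕ) : Ev k (n + 1) (pw e (n + 2))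
    (tm k (n + 1) [e] (pw e (n + 1)) [] +
      (-1 : k) ^ (n + 2) • tm k (n + 1) [] (pw e (n + 1)) [e]) := by
  have h := ev0_tm (k := k) (run_pw' e n) (length_pw _ _)
  have := ev_walk (k := k) (run_pw' e (n + 1)) (length_pw _ _)
    (leftEv_pw e (n + 1) (t := []) (by simpa using h)) (L := _) (by simpa [pw] using h)
  have e1 : (pw e (n + 2)).getD (n + 1) [] = [e] := by simp [pw]
  rw [e1, lr_smul_tm, lr_smul_tm] at this
  exact this

theorem run_ba_left (i j : ℕ) : ∃ q, run start (ba (i + 1) j) = some q := by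
  rcases j with _ | j
  · exact ⟨_, by simpa [ba, pw] using run_pw' b i⟩
  · exact ⟨_, run_ba i j⟩

theorem ev_ba (i j : ℕ) (hn : n = i + j + 1) : Ev k n (ba (i + 1) (j + 1))
    (tm k n [b] (ba i (j + 1)) [] + (-1 : k) ^ (i + 1) • fh k n true i (List.replicate j true) +
      (-1 : k) ^ (n + 1) • tm k n [] (ba (i + 1) j) [a]) := by
  obtain ⟨q, hq⟩ := run_ba_left i j
  have e1 : ba (i + 1) (j + 1) = ba (i + 1) j ++ [[a]] := by simp [ba, List.replicate_succ']
  have e2 : (ba (i + 1) j).length = n := by simp [ba, hn]; omega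
  have := ev_walk (k := k) (n := n) (run_ba i j) (by simp [ba, hn]; omega)
    (leftEv_ba i j (t := []) (F₀ := tm k n [] (ba i (j + 1)) [])
      (by simpa using ev0_tm (run_ba' i j) (by simp [ba, hn]; omega))
      (F₁ := fh k n true i (List.replicate j true))
      (by
        rw [List.append_nil, ← tl_replicate_nil false]
        exact (ev_fh i _ (by simp; omega)).1))
    (L := tm k n [] (ba (i + 1) j) [])
    (by rw [e1, List.dropLast_concat]; exact ev0_tm hq e2)
  have e3 : (ba (i + 1) (j + 1)).getD n [] = [a] := by
    rw [e1, List.getD_append_right _ _ _ _ e2.le, e2]; simp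
  rw [e3, lr_smul_tm, lr_smul_tm] at this
  exact this

/-- The first and the last face are left open: the first is not critical if there is only one `b`,
and the last removes `ca` instead of `a` if `j = 0`. -/
theorem ev_bca_aux (i j : ℕ) (hn : n = i + j + 1) {F₀ L : C k n} {x : List Word} {w : Word}
    (hF : Ev0 k n (bca i (j + 1)) F₀) (hx : bca (i + 1) (j + 1) = x ++ [w]) (hL : Ev0 k n x L) :
    Ev k n (bca (i + 1) (j + 1))
      (lr k [b] [] • F₀ + (-1 : k) ^ (i + 1) • fh k n false i (List.replicate j true) +
        (-1 : k) ^ (n + 1) • lr k [] w • L) := by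
  have hl : (bca (i + 1) (j + 1)).length = n + 1 := by simp [bca, hn]; omega
  have hxl : x.length = n := by rw [hx] at hl; simpa using hl
  have := ev_walk (k := k) (n := n) (run_bca i j) hl
    (leftEv_bca i j (t := []) (F₀ := F₀) (by simpa using hF)
      (F₁ := fh k n false i (List.replicate j true))
      (by
        rw [List.append_nil, ← tl_replicate_nil true]
        exact (ev_fh i _ (by simp; omega)).2)
      (fun j' hj' => by
        refine ev0_of_deadB (run_pw' b i) rfl (by simp [length_pw]; omega) fun v hv => ?_
        rw [List.mem_append, List.mem_cons, List.append_nil] at hv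
        rcases hv with hv | rfl | hv
        · exact (redB_pw _ _ v hv).2
        · rfl
        · exact (redB_pw _ _ v hv).2))
    (L := L) (by rw [hx, List.dropLast_concat]; exact hL)
  have e3 : (bca (i + 1) (j + 1)).getD n [] = w := by
    rw [hx, List.getD_append_right _ _ _ _ hxl.le, hxl]; simp
  rw [e3] at this
  exact this

theorem ev_bca_last (i j : ℕ) (hn : n = i + j + 1) {F₀ : C k n}
    (hF : Ev0 k n (bca i (j + 1)) F₀) : Ev k n (bca (i + 1) (j + 1))
      (lr k [b] [] • F₀ + (-1 : k) ^ (i + 1) • fh k n false i (List.replicate j true) +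
        (-1 : k) ^ (n + 1) • if j = 0 then tm k n [] (pw b n) [c, a]
          else tm k n [] (bca (i + 1) j) [a]) := by
  rcases j with _ | j
  · have := ev_bca_aux i 0 hn hF (x := pw b (i + 1)) (w := [c, a]) (by simp [bca, pw])
      (ev0_tm (run_pw' b i) (by simp [length_pw, hn]))
    rw [lr_smul_tm] at this
    simpa [hn] using this
  · have := ev_bca_aux i (j + 1) hn hF (x := bca (i + 1) (j + 1)) (w := [a])
      (by simp [bca, List.replicate_succ'])
      (ev0_tm (run_bca i j) (by simp [bca, hn]; omega))
    rw [lr_smul_tm] at this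
    simpa using this

theorem ev_bca (i j : ℕ) (hn : n = i + j + 2) : Ev k n (bca (i + 2) (j + 1))
      (tm k n [b] (bca (i + 1) (j + 1)) [] +
        (-1 : k) ^ (i + 2) • fh k n false (i + 1) (List.replicate j true) +
        (-1 : k) ^ (n + 1) • if j = 0 then tm k n [] (pw b n) [c, a]
          else tm k n [] (bca (i + 2) j) [a]) := by
  have := ev_bca_last (i + 1) j (by omega)
    (ev0_tm (k := k) (n := n) (run_bca i j) (by simp [bca, hn]; omega))
  rw [lr_smul_tm] at this
  exact this

/-- Deleting the only `b` leaves `[ca | a | ⋯ | a]`, which is not critical. Splitting it as `[c | a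
| a | ⋯ | a]` and deleting `c` gives `c [a^n]`, while `a·a = 1` kills the product with the tail. -/
theorem ev_bca_one (j : ℕ) (hn : n = j + 2) : Ev k n (bca 1 (j + 2))
      (tm k n [b, c] (pw a n) [] + (-1 : k) • fh k n false 0 (List.replicate (j + 1) true) +
        (-1 : k) ^ (n + 1) • tm k n [] (bca 1 (j + 1)) [a]) := by
  have hF := ev_up_pw (k := k) (n := n) c 0 (v := [a]) (s := pw a (j + 1)) (R := 0)
    (F₀ := tm k n [] (pw a n) []) (by simp [length_pw]; omega) (by simp) rfl (redB_pw _ _)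
    (by simp [pw])
    (fun s₁ s' hs => by
      simp only [pw, List.replicate_succ, List.cons.injEq] at hs
      obtain ⟨rfl, rfl⟩ := hs
      rw [show nf ([a] ++ [a]) = [] by decide]
      exact Or.inl ⟨by simp, rfl⟩)
    (by
      subst hn
      exact ev0_tm (x := pw a (j + 2)) (run_pw' a (j + 1)) (length_pw _ _))
  rw [pow_zero, one_smul, zero_add, lr_smul_tm] at hF
  have := ev_bca_last 0 (j + 1) (by omega) (F₀ := tm k n [c] (pw a n) [])
    (by simpa [bca, pw] using hF)
  rw [lr_smul_tm] at this
  simpa using this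

theorem bev_true_replicate (i m : ℕ) : bev k n true i (List.replicate m true) =
    if m = 0 then tm k n [] (pw b n) [] else tm k n [] (ba i m) [] := by
  rcases m with _ | m <;> simp [bev, List.replicate_succ]

theorem bev_false_replicate (i m : ℕ) : bev k n false i (List.replicate m true) =
    if m = 0 then tm k n [] (pw b n) [c] else tm k n [] (bca (i + 1) m) [] := by
  rcases m with _ | m <;> simp [bev, List.replicate_succ]

theorem cv_nil (e : Letter) : cv k n e [] =
    tm k n [] (pw c n) (match e with | a => [b] | b => [a, b, c] | c => []) := by
  cases e <;> rfl

/-- The contraction `b·a = cabc` produces `fh true (i + 1)` on a tail without rotations, so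
`fh_true_succ` is used with empty `u`; there the term for the end of the tail is present. -/
theorem diff_ba (i m : ℕ) (hn : n = i + m + 2) :
    d k n (tm k (n + 1) [] (ba (i + 2) (m + 1)) []) =
      tm k n [b] (ba (i + 1) (m + 1)) [] + (-1 : k) ^ i •
        (chooseAt k false (i / 2) m • tm k n (muW (i + 1)) (pw c n) [] +
          (bif i.bodd then (((m + 1) / 2 + i / 2).choose (i / 2 + 1) : k) else 0) •
            tm k n [] (pw c n) (bif m.bodd then [b] else [a, b, c]) +
          (if m = 0 then tm k n (lamW (i + 1)) (pw b n) [c]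
            else tm k n (lamW (i + 1)) (bca (i + 2) m) []) +
          tm k n [] (bca (i + 1) (m + 1)) (rot (!m.bodd))) +
      (-1 : k) ^ (n + 1) • tm k n [] (ba (i + 2) m) [a] := by
  rw [diff_tm (run_ba (i + 1) m) (by simp [ba, hn]; omega) (ev_ba (i + 1) m (by omega))]
  have := fh_true_succ (k := k) (n := n) (fhTrue_fhFalse i).2 m [] (Or.inl rfl)
  rw [List.append_nil] at this
  rw [this, bev_false_replicate, cv_nil, cv_nil, lr_smul_tm, show (-1 : k) ^ (i + 1 + 1) = (-1) ^ i by
    rw [pow_succ, pow_succ]; ring]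
  congr 4
  · congr 1
    · congr 2
      · simp
      · cases m.bodd <;> rfl
    · split_ifs <;> simp [lr_smul_tm]
  · simp

theorem diff_bca (i m : ℕ) (hn : n = i + m + 2) :
    d k n (tm k (n + 1) [] (bca (i + 2) (m + 1)) []) =
      tm k n [b] (bca (i + 1) (m + 1)) [] + (-1 : k) ^ i •
        (((m / 2 + (i + 1) / 2).choose ((i + 1) / 2) : k) •
            tm k n (muW i) (pw c n) (bif m.bodd then [a, b, c] else [b]) +
          (bif i.bodd then 0 else -chooseAt k true (i / 2) m) • tm k n [] (pw c n) [] +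
          (if m = 0 then tm k n (lamW i) (pw b n) [] else tm k n (lamW i) (ba (i + 2) m) []) +
          tm k n [] (ba (i + 1) (m + 1)) (rot m.bodd)) +
      (-1 : k) ^ (n + 1) • if m = 0 then tm k n [] (pw b n) [c, a]
          else tm k n [] (bca (i + 2) m) [a] := by
  rw [diff_tm (run_bca (i + 1) m) (by simp [bca, hn]; omega) (ev_bca i m hn)]
  have := fh_false_succ (k := k) (n := n) (fhTrue_fhFalse i).1 m [] (Or.inl rfl)
  rw [List.append_nil] at this
  rw [this, bev_true_replicate, cv_nil, cv_nil, lr_smul_tm, show (-1 : k) ^ (i + 2) = (-1) ^ i by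
    rw [pow_succ, pow_succ]; ring]
  congr 4
  · congr 1
    · congr 2
      cases m.bodd <;> simp
    · split_ifs <;> simp [lr_smul_tm]
  · simp

/-- A single `b` leads to `fh true 0`, whose value on a tail of letters is read off from its
definition; in particular the term with `av`, which vanishes when there are rotations, now gives
`[a^n]`. -/
theorem diff_ba_one (m : ℕ) (hn : n = m + 2) :
    d k n (tm k (n + 1) [] (ba 1 n) []) =
      tm k n [b] (pw a n) [] + (-1 : k) •
        (tm k n [] (pw c n) (bif m.bodd then [a, b, c] else [b]) +
          tm k n [c] (pw a n) (rot m.bodd) + tm k n [c, a] (bca 1 (m + 1)) []) +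
      (-1 : k) ^ (n + 1) • tm k n [] (ba 1 (m + 1)) [a] := by
  have e1 : ba 1 n = ba (0 + 1) (m + 1 + 1) := by rw [hn]
  have e2 : ba 0 (m + 1 + 1) = pw a n := by simp [ba, pw, hn]
  rw [e1, diff_tm (run_ba 0 (m + 1)) (by simp [ba, hn]) (ev_ba 0 (m + 1) (by omega)), e2]
  have h1 := (cv_replicate (k := k) (n := n) (m + 1) []).2
  have h2 := cv_c_replicate (k := k) (n := n) (m + 1) []
  rw [List.append_nil] at h1 h2
  rw [fh, h1, h2, av_replicate, bev_false_replicate, if_neg (by omega), if_neg (by omega), smul_zero,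
    add_zero, smul_add (lr k [c] []), lr_smul_tm, lr_smul_tm, lr_smul_tm, cv_nil]
  congr 3
  · rw [zero_add, pow_one]
  · rw [← add_assoc]
    congr 2
    · cases h : m.bodd <;> simp [h]
    · simp

theorem diff_bca_one (m : ℕ) (hn : n = m + 2) :
    d k n (tm k (n + 1) [] (bca 1 n) []) =
      tm k n [b, c] (pw a n) [] + (-1 : k) •
        (tm k n [a] (pw c n) (bif m.bodd then [b] else [a, b, c]) +
          tm k n [] (pw a n) (rot (!m.bodd)) + tm k n [a, c] (ba 1 (m + 1)) []) +
      (-1 : k) ^ (n + 1) • tm k n [] (bca 1 (m + 1)) [a] := by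
  have e1 : bca 1 n = bca (0 + 1) (m + 1 + 1) := by rw [hn]
  rw [e1, diff_tm (run_bca 0 (m + 1)) (by simp [bca, hn]) (ev_bca_one m hn)]
  have h1 := (cv_replicate (k := k) (n := n) (m + 1) []).1
  rw [List.append_nil] at h1
  rw [fh, h1, av_replicate, bev_true_replicate, if_neg (by omega), smul_add (lr k [a] []), lr_smul_tm,
    cv_nil, lr_smul_tm, lr_smul_tm]
  congr 3
  rw [← add_assoc, add_comm (tm k n [] (pw a n) _)]
  congr 2
  · cases h : m.bodd <;> simp [h]
  · simp

theorem finitePaths (hn : 2 ≤ n) {x : List Word} (hx : x ∈ critical k (n + 1)) :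
    Morse.FinitePaths V k (gen k) n x := by
  obtain ⟨m, rfl⟩ : ∃ m, n = m + 2 := ⟨n - 2, by omega⟩
  rw [critical_eq] at hx
  rcases hx with (rfl | rfl | rfl) | ⟨i, j, hij, hi, hj, rfl | rfl⟩
  · exact (ev_pw a (m + 1)).1
  · exact (ev_pw b (m + 1)).1
  · exact (ev_pw c (m + 1)).1
  · obtain ⟨i, rfl⟩ := Nat.exists_eq_add_of_le' hi
    obtain ⟨j, rfl⟩ := Nat.exists_eq_add_of_le' hj
    exact (ev_ba i j (by omega)).1
  · obtain ⟨j, rfl⟩ := Nat.exists_eq_add_of_le' hj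
    obtain rfl | ⟨i, rfl⟩ : i = 1 ∨ ∃ i', i = i' + 2 := by
      rcases Nat.eq_or_lt_of_le hi with h | h
      · exact Or.inl h.symm
      · exact Or.inr ⟨i - 2, by omega⟩
    · obtain rfl : j = m + 1 := by omega
      exact (ev_bca_one m rfl).1
    · exact (ev_bca i j (by omega)).1

end Differential

end G23

namespace G23
open Letter St

/-! ### The differential by parity of `n + 1` and `j` -/

section Parity
variable {k : Type*} [Field k] {n : ℕ}

theorem diff_of_even (h3 : 3 ≤ n) (hn : Even (n + 1)) :
      d k n (tm k (n + 1) [] (ba n 1) []) =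
        tm k n [b] (ba (n - 1) 1) [] + tm k n [] (pw b n) [a] - tm k n [] (bca (n - 1) 1) [b, c]
          - tm k n [c, a] (pw b n) [c] - tm k n [c, a, b] (pw c n) [] ∧
      d k n (tm k (n + 1) [] (ba 1 n) []) =
        tm k n [b] (pw a n) [] + tm k n [] (ba 1 (n - 1)) [a] - tm k n [c, a] (bca 1 (n - 1)) []
          - tm k n [c] (pw a n) [b, c] - tm k n [] (pw c n) [a, b, c] ∧
      d k n (tm k (n + 1) [] (bca n 1) []) =
        tm k n [b] (bca (n - 1) 1) [] + tm k n [] (pw b n) [c, a] - tm k n [] (ba (n - 1) 1) [c, b]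
          - tm k n [a, c] (pw b n) [] - tm k n [a] (pw c n) [b] ∧
      d k n (tm k (n + 1) [] (bca 1 n) []) =
        tm k n [b, c] (pw a n) [] + tm k n [] (bca 1 (n - 1)) [a] - tm k n [a, c] (ba 1 (n - 1)) []
          - tm k n [] (pw a n) [c, b] - tm k n [a] (pw c n) [b] := by
  obtain ⟨i, rfl⟩ : ∃ i, n = i + 2 := ⟨n - 2, by omega⟩
  have hi : i.bodd = true := bodd_eq_true_iff.2 (by have := Nat.even_iff.1 hn; omega)
  have hs : (-1 : k) ^ i = -1 := (Nat.odd_iff.2 (bodd_eq_true_iff.1 hi)).neg_one_pow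
  have hb : ba (i + 2) 0 = pw b (i + 2) := by simp [ba, pw]
  refine ⟨?_, ?_, ?_, ?_⟩
  · rw [diff_ba i 0 rfl, hn.neg_one_pow, hs, hb]
    simp [chooseAt, hi, muW, lamW, rot]
    module
  · rw [diff_ba_one i rfl, hn.neg_one_pow]
    simp [hi, rot]
    module
  · rw [diff_bca i 0 rfl, hn.neg_one_pow, hs]
    simp [hi, muW, lamW, rot]
    module
  · rw [diff_bca_one i rfl, hn.neg_one_pow]
    simp [hi, rot]
    module

theorem diff_of_odd (h3 : 3 ≤ n) (hn : Odd (n + 1)) :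
      d k n (tm k (n + 1) [] (ba n 1) []) =
        tm k n [b] (ba (n - 1) 1) [] - tm k n [] (pw b n) [a] + tm k n [] (bca (n - 1) 1) [b, c]
          + tm k n [a, c] (pw b n) [c] + tm k n [a] (pw c n) [] ∧
      d k n (tm k (n + 1) [] (ba 1 n) []) =
        tm k n [b] (pw a n) [] - tm k n [] (ba 1 (n - 1)) [a] - tm k n [c, a] (bca 1 (n - 1)) []
          - tm k n [c] (pw a n) [c, b] - tm k n [] (pw c n) [b] ∧
      d k n (tm k (n + 1) [] (bca n 1) []) =
        tm k n [b] (bca (n - 1) 1) [] - tm k n [] (pw b n) [c, a] + tm k n [] (ba (n - 1) 1) [c, b]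
          + tm k n [c, a] (pw b n) [] + tm k n [c, a, b] (pw c n) [b] ∧
      d k n (tm k (n + 1) [] (bca 1 n) []) =
        tm k n [b, c] (pw a n) [] - tm k n [] (bca 1 (n - 1)) [a] - tm k n [a, c] (ba 1 (n - 1)) []
          - tm k n [] (pw a n) [b, c] - tm k n [a] (pw c n) [a, b, c] := by
  obtain ⟨i, rfl⟩ : ∃ i, n = i + 2 := ⟨n - 2, by omega⟩
  have hi : i.bodd = false := bodd_eq_false_iff.2 (by have := Nat.odd_iff.1 hn; omega)
  have hs : (-1 : k) ^ i = 1 := (Nat.even_iff.2 (bodd_eq_false_iff.1 hi)).neg_one_pow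
  have hb : ba (i + 2) 0 = pw b (i + 2) := by simp [ba, pw]
  refine ⟨?_, ?_, ?_, ?_⟩
  · rw [diff_ba i 0 rfl, hn.neg_one_pow, hs, hb]
    simp [chooseAt, hi, muW, lamW, rot]
    module
  · rw [diff_ba_one i rfl, hn.neg_one_pow]
    simp [hi, rot]
    module
  · rw [diff_bca i 0 rfl, hn.neg_one_pow, hs]
    simp [chooseAt, hi, muW, lamW, rot]
    module
  · rw [diff_bca_one i rfl, hn.neg_one_pow]
    simp [hi, rot]
    module

theorem diff_of_even_of_even (hn : Even (n + 1)) {i j : ℕ} (hij : i + j = n + 1)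
    (hj : Even j) (hj2 : 2 ≤ j) (hjn : j ≤ n - 1) :
        d k n (tm k (n + 1) [] (ba i j) []) =
          tm k n [b] (ba (i - 1) j) [] + tm k n [] (ba i (j - 1)) [a]
            + tm k n [] (bca (i - 1) j) [c, b] + tm k n [a, c] (bca i (j - 1)) [] ∧
        d k n (tm k (n + 1) [] (bca i j) []) =
          tm k n [b] (bca (i - 1) j) [] + tm k n [] (bca i (j - 1)) [a]
            + tm k n [] (ba (i - 1) j) [b, c] + tm k n [c, a] (ba i (j - 1)) []
            + (Nat.choose ((n - 3) / 2) ((j - 2) / 2) : k) • tm k n [c, a, b] (pw c n) [a, b, c]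
            - (Nat.choose ((n - 3) / 2) ((i - 2) / 2) : k) • tm k n [] (pw c n) [] := by
  obtain ⟨m, rfl⟩ : ∃ m, j = m + 1 := ⟨j - 1, by omega⟩
  obtain ⟨i, rfl⟩ : ∃ i', i = i' + 2 := ⟨i - 2, by omega⟩
  have hnp := Nat.even_iff.1 hn
  have hjp := Nat.even_iff.1 hj
  have hi : i.bodd = false := bodd_eq_false_iff.2 (by omega)
  have hm : m.bodd = true := bodd_eq_true_iff.2 (by omega)
  have hs : (-1 : k) ^ i = 1 := (Nat.even_iff.2 (bodd_eq_false_iff.1 hi)).neg_one_pow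
  have hm0 : m ≠ 0 := by omega
  constructor
  · rw [diff_ba i m (by omega), hn.neg_one_pow, hs]
    simp [chooseAt, hi, hm, muW, lamW, rot, hm0]
    module
  -- By symmetry of the binomial coefficients the two coefficients in the formula agree, and both
  -- are `choose (m / 2 + i / 2) (i / 2)`.
  · rw [diff_bca i m (by omega), hn.neg_one_pow, hs, show (n - 3) / 2 = m / 2 + i / 2 by omega,
      show (m + 1 - 2) / 2 = m / 2 by omega, show (i + 1) / 2 = i / 2 by
        rw [bodd_eq_false_iff] at hi; omega, Nat.choose_symm_add]
    simp [chooseAt, hi, hm, muW, lamW, rot, hm0]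
    module

theorem diff_of_even_of_odd (hn : Even (n + 1)) {i j : ℕ} (hij : i + j = n + 1)
    (hj : Odd j) (hj2 : 3 ≤ j) (hjn : j ≤ n - 2) :
        d k n (tm k (n + 1) [] (ba i j) []) =
          tm k n [b] (ba (i - 1) j) [] + tm k n [] (ba i (j - 1)) [a]
            - tm k n [] (bca (i - 1) j) [b, c] - tm k n [c, a] (bca i (j - 1)) []
            - (Nat.choose ((n - 3) / 2) ((i - 3) / 2) : k) • tm k n [c, a, b] (pw c n) []
            - (Nat.choose ((n - 3) / 2) ((j - 3) / 2) : k) • tm k n [] (pw c n) [a, b, c] ∧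
        d k n (tm k (n + 1) [] (bca i j) []) =
          tm k n [b] (bca (i - 1) j) [] + tm k n [] (bca i (j - 1)) [a]
            - tm k n [] (ba (i - 1) j) [c, b] - tm k n [a, c] (ba i (j - 1)) []
            - ((Nat.choose ((n - 3) / 2) ((i - 3) / 2) : k) +
                (Nat.choose ((n - 3) / 2) ((j - 3) / 2) : k)) • tm k n [a] (pw c n) [b] := by
  obtain ⟨m, rfl⟩ : ∃ m, j = m + 1 := ⟨j - 1, by omega⟩
  obtain ⟨i, rfl⟩ : ∃ i', i = i' + 2 := ⟨i - 2, by omega⟩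
  have hnp := Nat.even_iff.1 hn
  have hjp := Nat.odd_iff.1 hj
  have hi : i.bodd = true := bodd_eq_true_iff.2 (by omega)
  have hm : m.bodd = false := bodd_eq_false_iff.2 (by omega)
  have hs : (-1 : k) ^ i = -1 := (Nat.odd_iff.2 (bodd_eq_true_iff.1 hi)).neg_one_pow
  have hm0 : m ≠ 0 := by omega
  have hip := bodd_eq_true_iff.1 hi
  have e : (m / 2 + i / 2).choose ((m + 1 - 3) / 2) = (m / 2 + i / 2).choose (i / 2 + 1) :=
    Nat.choose_symm_of_eq_add (by omega)
  rw [show (n - 3) / 2 = m / 2 + i / 2 by omega, show (i + 2 - 3) / 2 = i / 2 by omega, e]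
  constructor
  · rw [diff_ba i m (by omega), hn.neg_one_pow, hs, show (m + 1) / 2 = m / 2 by omega]
    simp [chooseAt, hi, hm, muW, lamW, rot, hm0]
    module
  -- Here there is a single binomial coefficient; Pascal's rule splits it into the two in the
  -- formula.
  · rw [diff_bca i m (by omega), hn.neg_one_pow, hs, show (i + 1) / 2 = i / 2 + 1 by omega,
      ← Nat.cast_add, ← Nat.choose_succ_succ, ← add_assoc]
    simp [hi, hm, muW, lamW, rot, hm0]
    module

theorem diff_of_odd_of_even (hn : Odd (n + 1)) {i j : ℕ} (hij : i + j = n + 1)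
    (hj : Even j) (hj2 : 2 ≤ j) (hjn : j ≤ n - 2) :
        d k n (tm k (n + 1) [] (ba i j) []) =
          tm k n [b] (ba (i - 1) j) [] - tm k n [] (ba i (j - 1)) [a]
            - tm k n [] (bca (i - 1) j) [c, b] - tm k n [c, a] (bca i (j - 1)) []
            - (Nat.choose ((n - 2) / 2) ((j - 2) / 2) : k) • tm k n [] (pw c n) [b] ∧
        d k n (tm k (n + 1) [] (bca i j) []) =
          tm k n [b] (bca (i - 1) j) [] - tm k n [] (bca i (j - 1)) [a]
            - tm k n [] (ba (i - 1) j) [b, c] - tm k n [a, c] (ba i (j - 1)) []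
            - (Nat.choose ((n - 2) / 2) ((j - 2) / 2) : k) • tm k n [a] (pw c n) [a, b, c] := by
  obtain ⟨m, rfl⟩ : ∃ m, j = m + 1 := ⟨j - 1, by omega⟩
  obtain ⟨i, rfl⟩ : ∃ i', i = i' + 2 := ⟨i - 2, by omega⟩
  have hnp := Nat.odd_iff.1 hn
  have hjp := Nat.even_iff.1 hj
  have hi : i.bodd = true := bodd_eq_true_iff.2 (by omega)
  have hm : m.bodd = true := bodd_eq_true_iff.2 (by omega)
  have hs : (-1 : k) ^ i = -1 := (Nat.odd_iff.2 (bodd_eq_true_iff.1 hi)).neg_one_pow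
  have hm0 : m ≠ 0 := by omega
  have hip := bodd_eq_true_iff.1 hi
  -- The formula counts from the side of `j`, the summation from the side of `i`; symmetry exchanges
  -- them.
  rw [show (n - 2) / 2 = m / 2 + (i / 2 + 1) by omega, show (m + 1 - 2) / 2 = m / 2 by omega,
    Nat.choose_symm_add]
  constructor
  · rw [diff_ba i m (by omega), hn.neg_one_pow, hs,
      show (m + 1) / 2 + i / 2 = m / 2 + (i / 2 + 1) by omega]
    simp [chooseAt, hi, hm, muW, lamW, rot, hm0]
    module
  · rw [diff_bca i m (by omega), hn.neg_one_pow, hs, show (i + 1) / 2 = i / 2 + 1 by omega]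
    simp [hi, hm, muW, lamW, rot, hm0]
    module

theorem diff_of_odd_of_odd (hn : Odd (n + 1)) {i j : ℕ} (hij : i + j = n + 1)
    (hj : Odd j) (hj2 : 3 ≤ j) (hjn : j ≤ n - 1) :
        d k n (tm k (n + 1) [] (ba i j) []) =
          tm k n [b] (ba (i - 1) j) [] - tm k n [] (ba i (j - 1)) [a]
            + tm k n [] (bca (i - 1) j) [b, c] + tm k n [a, c] (bca i (j - 1)) []
            + (Nat.choose ((n - 2) / 2) ((i - 2) / 2) : k) • tm k n [a] (pw c n) [] ∧
        d k n (tm k (n + 1) [] (bca i j) []) =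
          tm k n [b] (bca (i - 1) j) [] - tm k n [] (bca i (j - 1)) [a]
            + tm k n [] (ba (i - 1) j) [c, b] + tm k n [c, a] (ba i (j - 1)) []
            + (Nat.choose ((n - 2) / 2) ((i - 2) / 2) : k) • tm k n [c, a, b] (pw c n) [b] := by
  obtain ⟨m, rfl⟩ : ∃ m, j = m + 1 := ⟨j - 1, by omega⟩
  obtain ⟨i, rfl⟩ : ∃ i', i = i' + 2 := ⟨i - 2, by omega⟩
  have hnp := Nat.odd_iff.1 hn
  have hjp := Nat.odd_iff.1 hj
  have hi : i.bodd = false := bodd_eq_false_iff.2 (by omega)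
  have hm : m.bodd = false := bodd_eq_false_iff.2 (by omega)
  have hs : (-1 : k) ^ i = 1 := (Nat.even_iff.2 (bodd_eq_false_iff.1 hi)).neg_one_pow
  have hm0 : m ≠ 0 := by omega
  have hip := bodd_eq_false_iff.1 hi
  rw [show (n - 2) / 2 = m / 2 + i / 2 by omega, Nat.add_sub_cancel]
  constructor
  · rw [diff_ba i m (by omega), hn.neg_one_pow, hs]
    simp [chooseAt, hi, hm, muW, lamW, rot, hm0]
    module
  · rw [diff_bca i m (by omega), hn.neg_one_pow, hs, show (i + 1) / 2 = i / 2 by omega]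
    simp [chooseAt, hi, hm, muW, lamW, rot, hm0]
    module

end Parity

end G23

theorem mainTheorem1 (k : Type*) [Field k] :
    -- `S` is a Gröbner–Shirshov basis for `G^2_3`, and the vertices form bases of the modules `B_m`
    (∀ p ∈ S, grpVal p.1 = grpVal p.2) ∧
    (∀ g : Grp, ∃! w : Word, Morse.IsReduced V w ∧ grpVal w = g) ∧
    (∀ m, Morse.CellsBasis V k (gen k) m) ∧
    ∀ n : ℕ, 3 ≤ n →
    -- the `n`-chains
    Morse.chains V n =
      {List.replicate (n + 1) a, List.replicate (n + 1) b, List.replicate (n + 1) c} ∪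
      {w | ∃ i j, i + j = n + 1 ∧ 1 ≤ i ∧ 1 ≤ j ∧
        (w = List.replicate i b ++ List.replicate j a ∨
          w = List.replicate i b ++ c :: List.replicate j a)} ∧
    -- the critical vertices of degrees `n + 1` and `n`
    (∀ m, m = n ∨ m + 1 = n → critical k (m + 1) =
      {pw a (m + 1), pw b (m + 1), pw c (m + 1)} ∪
      {x | ∃ i j, i + j = m + 1 ∧ 1 ≤ i ∧ 1 ≤ j ∧ (x = ba i j ∨ x = bca i j)}) ∧
    -- the sums over paths are finite
    (∀ x ∈ critical k (n + 1), Morse.FinitePaths V k (gen k) n x) ∧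
    -- the differential
    (∀ x : Letter, d k n (tm k (n + 1) [] (pw x (n + 1)) []) =
      tm k n [x] (pw x n) [] + (-1 : k) ^ (n + 1) • tm k n [] (pw x n) [x]) ∧
    (Even (n + 1) →
      d k n (tm k (n + 1) [] (ba n 1) []) =
        tm k n [b] (ba (n - 1) 1) [] + tm k n [] (pw b n) [a] - tm k n [] (bca (n - 1) 1) [b, c]
          - tm k n [c, a] (pw b n) [c] - tm k n [c, a, b] (pw c n) [] ∧
      d k n (tm k (n + 1) [] (ba 1 n) []) =
        tm k n [b] (pw a n) [] + tm k n [] (ba 1 (n - 1)) [a] - tm k n [c, a] (bca 1 (n - 1)) []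
          - tm k n [c] (pw a n) [b, c] - tm k n [] (pw c n) [a, b, c] ∧
      d k n (tm k (n + 1) [] (bca n 1) []) =
        tm k n [b] (bca (n - 1) 1) [] + tm k n [] (pw b n) [c, a] - tm k n [] (ba (n - 1) 1) [c, b]
          - tm k n [a, c] (pw b n) [] - tm k n [a] (pw c n) [b] ∧
      d k n (tm k (n + 1) [] (bca 1 n) []) =
        tm k n [b, c] (pw a n) [] + tm k n [] (bca 1 (n - 1)) [a] - tm k n [a, c] (ba 1 (n - 1)) []
          - tm k n [] (pw a n) [c, b] - tm k n [a] (pw c n) [b] ∧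
      (∀ i j, i + j = n + 1 → Even j → 2 ≤ j → j ≤ n - 1 →
        d k n (tm k (n + 1) [] (ba i j) []) =
          tm k n [b] (ba (i - 1) j) [] + tm k n [] (ba i (j - 1)) [a]
            + tm k n [] (bca (i - 1) j) [c, b] + tm k n [a, c] (bca i (j - 1)) [] ∧
        d k n (tm k (n + 1) [] (bca i j) []) =
          tm k n [b] (bca (i - 1) j) [] + tm k n [] (bca i (j - 1)) [a]
            + tm k n [] (ba (i - 1) j) [b, c] + tm k n [c, a] (ba i (j - 1)) []
            + (Nat.choose ((n - 3) / 2) ((j - 2) / 2) : k) • tm k n [c, a, b] (pw c n) [a, b, c]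
            - (Nat.choose ((n - 3) / 2) ((i - 2) / 2) : k) • tm k n [] (pw c n) []) ∧
      (∀ i j, i + j = n + 1 → Odd j → 3 ≤ j → j ≤ n - 2 →
        d k n (tm k (n + 1) [] (ba i j) []) =
          tm k n [b] (ba (i - 1) j) [] + tm k n [] (ba i (j - 1)) [a]
            - tm k n [] (bca (i - 1) j) [b, c] - tm k n [c, a] (bca i (j - 1)) []
            - (Nat.choose ((n - 3) / 2) ((i - 3) / 2) : k) • tm k n [c, a, b] (pw c n) []
            - (Nat.choose ((n - 3) / 2) ((j - 3) / 2) : k) • tm k n [] (pw c n) [a, b, c] ∧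
        d k n (tm k (n + 1) [] (bca i j) []) =
          tm k n [b] (bca (i - 1) j) [] + tm k n [] (bca i (j - 1)) [a]
            - tm k n [] (ba (i - 1) j) [c, b] - tm k n [a, c] (ba i (j - 1)) []
            - ((Nat.choose ((n - 3) / 2) ((i - 3) / 2) : k) +
                (Nat.choose ((n - 3) / 2) ((j - 3) / 2) : k)) • tm k n [a] (pw c n) [b])) ∧
    (Odd (n + 1) →
      d k n (tm k (n + 1) [] (ba n 1) []) =
        tm k n [b] (ba (n - 1) 1) [] - tm k n [] (pw b n) [a] + tm k n [] (bca (n - 1) 1) [b, c]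
          + tm k n [a, c] (pw b n) [c] + tm k n [a] (pw c n) [] ∧
      d k n (tm k (n + 1) [] (ba 1 n) []) =
        tm k n [b] (pw a n) [] - tm k n [] (ba 1 (n - 1)) [a] - tm k n [c, a] (bca 1 (n - 1)) []
          - tm k n [c] (pw a n) [c, b] - tm k n [] (pw c n) [b] ∧
      d k n (tm k (n + 1) [] (bca n 1) []) =
        tm k n [b] (bca (n - 1) 1) [] - tm k n [] (pw b n) [c, a] + tm k n [] (ba (n - 1) 1) [c, b]
          + tm k n [c, a] (pw b n) [] + tm k n [c, a, b] (pw c n) [b] ∧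
      d k n (tm k (n + 1) [] (bca 1 n) []) =
        tm k n [b, c] (pw a n) [] - tm k n [] (bca 1 (n - 1)) [a] - tm k n [a, c] (ba 1 (n - 1)) []
          - tm k n [] (pw a n) [b, c] - tm k n [a] (pw c n) [a, b, c] ∧
      (∀ i j, i + j = n + 1 → Even j → 2 ≤ j → j ≤ n - 2 →
        d k n (tm k (n + 1) [] (ba i j) []) =
          tm k n [b] (ba (i - 1) j) [] - tm k n [] (ba i (j - 1)) [a]
            - tm k n [] (bca (i - 1) j) [c, b] - tm k n [c, a] (bca i (j - 1)) []
            - (Nat.choose ((n - 2) / 2) ((j - 2) / 2) : k) • tm k n [] (pw c n) [b] ∧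
        d k n (tm k (n + 1) [] (bca i j) []) =
          tm k n [b] (bca (i - 1) j) [] - tm k n [] (bca i (j - 1)) [a]
            - tm k n [] (ba (i - 1) j) [b, c] - tm k n [a, c] (ba i (j - 1)) []
            - (Nat.choose ((n - 2) / 2) ((j - 2) / 2) : k) • tm k n [a] (pw c n) [a, b, c]) ∧
      (∀ i j, i + j = n + 1 → Odd j → 3 ≤ j → j ≤ n - 1 →
        d k n (tm k (n + 1) [] (ba i j) []) =
          tm k n [b] (ba (i - 1) j) [] - tm k n [] (ba i (j - 1)) [a]
            + tm k n [] (bca (i - 1) j) [b, c] + tm k n [a, c] (bca i (j - 1)) []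
            + (Nat.choose ((n - 2) / 2) ((i - 2) / 2) : k) • tm k n [a] (pw c n) [] ∧
        d k n (tm k (n + 1) [] (bca i j) []) =
          tm k n [b] (bca (i - 1) j) [] - tm k n [] (bca i (j - 1)) [a]
            + tm k n [] (ba (i - 1) j) [c, b] + tm k n [c, a] (ba i (j - 1)) []
            + (Nat.choose ((n - 2) / 2) ((i - 2) / 2) : k) • tm k n [c, a, b] (pw c n) [b])) := by
  refine ⟨grpVal_S, existsUnique_reduced, cellsBasis k, fun n hn => ⟨chains_eq n, fun m _ => critical_eq m,
    fun x hx => finitePaths (by omega) hx, fun x => ?_, fun h => ?_, fun h => ?_⟩⟩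
  · obtain ⟨n, rfl⟩ : ∃ n', n = n' + 1 := ⟨n - 1, by omega⟩
    exact diff_tm (run_pw' x (n + 1)) (length_pw _ _) (ev_pw x n)
  · obtain ⟨h1, h2, h3, h4⟩ := diff_of_even (k := k) hn h
    exact ⟨h1, h2, h3, h4, fun i j hij hj hj2 hjn => diff_of_even_of_even h hij hj hj2 hjn,
      fun i j hij hj hj2 hjn => diff_of_even_of_odd h hij hj hj2 hjn⟩
  · obtain ⟨h1, h2, h3, h4⟩ := diff_of_odd (k := k) hn h
    exact ⟨h1, h2, h3, h4, fun i j hij hj hj2 hjn => diff_of_odd_of_even h hij hj hj2 hjn,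
      fun i j hij hj hj2 hjn => diff_of_odd_of_odd h hij hj hj2 hjn⟩
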